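/- Let $X$ be a random vector in $\mathbb{R}^d$ whose law has no atoms and is multivariate regularly varying with limit measure $\mu$ and index $\alpha>1$: there are $0<a_n\uparrow\infty$ and a non-null Radon measure $\mu$ on $[-\infty,\infty]^d\setminus\{0\}$, not charging the points at infinity, such that $nP(X/a_n\in\cdot)\to\mu$ vaguely, and $P(\|X\|_2>b)=b^{-\alpha}L(b)$ for $b>0$ with $L$ slowly varying. Suppose $EX=\eta:=-(1,\dots,1)^T$. Let $v_1^*,\dots,v_m^*\in\mathbb{R}^d$ and $a_1^*,\dots,a_m^*>0$ satisfy $\eta^Tv_j^*=-1$ for every $j$, put $A^*=\bigcup_{j=1}^m\{y: y^Tv_j^*>a_j^*\}$, and suppose $\mu(A^*)>0$. Let $S_n=S_0+X_1+\dots+X_n$ be the random walk with i.i.d. increments distributed as $X$, write $T_C=\inf\{n\ge 0:S_n\in C\}$, and let $P_0^*=P(S\in\cdot\mid T_{bA^*}<\infty,\ S_0=0)$. For parameters $\theta,a,\delta,\delta_2\in(0,1)$ and $\beta,\gamma,b>0$ define $v_1,\dots,v_{2m+d}$ and $a_1,\dots,a_{2m+d}$ by $v_j=v_j^*$, $v_{m+j}=(v_j^*+\delta\eta/\|\eta\|_2^2)/(1-\delta)$,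 $a_j=a_{m+j}=a_j^*$ for $1\le j\le m$, and $v_{2m+i}=e_i$ (the $i$-th unit vector), $a_{2m+i}=\beta$ for $1\le i\le d$. Put $$A=\bigcup_{j=1}^{2m+d}\{y:y^Tv_j>a_j\},\qquad \Gamma=\{y:y^T\eta\ge\gamma\},\qquad r_b(s)=\max_{1\le j\le 2m+d}(s^Tv_j-a_jb),$$ $$v_b(s)=\int_0^\infty P(X+t\eta+s\in bA)\,dt,\qquad A_{b,a}(s)=\Bigl\{s_1:\max_{1\le j\le 2m+d}\bigl[(s_1-s)^Tv_j-a(a_jb-s^Tv_j)\bigr]>0\Bigr\},$$ $$p_b(s)=\min\Bigl(\frac{\theta\,P(s+X\in A_{b,a}(s))}{v_b(s)},\,1\Bigr)\,I\bigl(r_b(s)\le-\delta_2b\bigr),$$ $$\hat K(s_0,ds_1)=P(X+s_0\in ds_1)\Bigl\{\frac{p_b(s_0)\,I(s_1\in A_{b,a}(s_0))}{P(s_0+X\in A_{b,a}(s_0))}+1-p_b(s_0)\Bigr\}.$$ Let $\hat P_0$ be the law on path space of the process started at $0$ that makes transitions according to $\hat K$ up to time $T_{bA}\wedge T_{b\Gamma}$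 and according to $K(s_0,ds_1)=P(X+s_0\in ds_1)$ afterwards. Then for every $\varepsilon>0$ there exist $\theta,a,\delta,\delta_2\in(0,1)$ (with $\theta,a$ arbitrarily close to $1$ and $\delta,\delta_2$ arbitrarily close to $0$), $\beta,\gamma>0$ (arbitrarily large) and $b_0>0$ such that for all real $b\ge b_0$ $$\sup_{B\in\mathcal F}\bigl|\hat P_0(B)-P_0^*(B)\bigr|\le\varepsilon,$$ where $\mathcal F=\sigma\bigl(\bigcup_{n\ge0}\sigma\{S_k:0\le k\le n\}\bigr)$. -/

import Mathlib

open MeasureTheory ProbabilityTheory Set Filter Topology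
open scoped ENNReal Pointwise

noncomputable section

namespace RuinWalk

/-- The state space `ℝ^d` with its Euclidean structure. -/
abbrev E (d : ℕ) : Type := EuclideanSpace ℝ (Fin d)

/-- The drift vector `η = -(1, …, 1)`. -/
def drift (d : ℕ) : E d := WithLp.toLp 2 (fun _ => (-1 : ℝ))

/-! ### Multivariate regular variation -/

/-- The embedding of `ℝ^d` into its compactification `[-∞, ∞]^d`. -/
def toCompact {d : ℕ} (x : E d) : Fin d → EReal := fun i => ((x i : ℝ) : EReal)

/-- `ν`, the law of a random vector `X`, is multivariate regularly varying with limit measure `μ`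
and index `α`.

A Radon measure on `[-∞, ∞]^d ∖ {0}` that does not charge the points at infinity is the same as a
measure `μ` on `ℝ^d` without mass at the origin which is finite on the complement of every
neighbourhood of the origin. The field `vague` is vague convergence of `n P(X / a_n ∈ ·)` to `μ`
on `[-∞, ∞]^d ∖ {0}`: a continuous function with compact support in that space is a continuous
function on `[-∞, ∞]^d` that vanishes in a neighbourhood of the origin. -/
structure IsRegularlyVarying {d : ℕ} (ν : Measure (E d)) (α : ℝ) (μ : Measure (E d)) : Prop where
  nonnull : μ ≠ 0
  origin : μ {0} = 0
  radon : ∀ r : ℝ, 0 < r → μ {y | r ≤ ‖y‖} < ∞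
  vague : ∃ a : ℕ → ℝ, (∀ n, 0 < a n) ∧ Monotone a ∧ Tendsto a atTop atTop ∧
    ∀ f : C(Fin d → EReal, ℝ), (∀ᶠ y in 𝓝 (0 : Fin d → EReal), f y = 0) →
      Tendsto (fun n : ℕ => (n : ℝ) * ∫ x, f (toCompact ((a n)⁻¹ • x)) ∂ν) atTop
        (𝓝 (∫ y, f (toCompact y) ∂μ))
  index : ∃ L : ℝ → ℝ, (∀ t : ℝ, 0 < t → Tendsto (fun b => L (t * b) / L b) atTop (𝓝 1)) ∧
    ∀ b : ℝ, 0 < b → ν.real {x | b < ‖x‖} = b ^ (-α) * L b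

/-! ### The random walk -/

/-- The law on path space of the random walk `S_n = s + X_1 + ⋯ + X_n` with i.i.d. increments of
law `ν`. -/
def walkLaw {d : ℕ} (ν : Measure (E d)) [IsProbabilityMeasure ν] (s : E d) : Measure (ℕ → E d) :=
  (Measure.infinitePi (fun _ : ℕ => ν)).map (fun x n => s + ∑ i ∈ Finset.range n, x i)

/-- The event `T_C < ∞`, where `T_C = inf {n ≥ 0 : S_n ∈ C}`. -/
def hits {d : ℕ} (C : Set (E d)) : Set (ℕ → E d) := {S | ∃ n, S n ∈ C}

/-- The union of half-spaces `⋃_j {y : yᵀ v_j > a_j}`. -/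
def halfSpaces {d : ℕ} {ι : Type} (v : ι → E d) (c : ι → ℝ) : Set (E d) :=
  {y | ∃ j, c j < inner ℝ y (v j)}

/-- The law `P_s^*` of the walk conditioned on `T_{bA^*} < ∞`, with
`A^* = ⋃_j {y : yᵀ v_j^* > a_j^*}`. -/
def conditionedLaw {d m : ℕ} (ν : Measure (E d)) [IsProbabilityMeasure ν] (vS : Fin m → E d)
    (aS : Fin m → ℝ) (b : ℝ) (s : E d) : Measure (ℕ → E d) :=
  (walkLaw ν s)[|hits (b • halfSpaces vS aS)]

/-! ### The enlarged target -/

/-- Index set of the `2m + d` half-spaces that make up the enlarged target. -/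
abbrev Idx (d m : ℕ) : Type := Fin m ⊕ (Fin m ⊕ Fin d)

/-- The normals `v_j`: the `v_j^*`, then the `v_j^*(δ) = (v_j^* + δ η / ‖η‖²) / (1 - δ)`, then the
unit vectors `e_i`. -/
def normal {d m : ℕ} (vS : Fin m → E d) (δ : ℝ) : Idx d m → E d
  | .inl j => vS j
  | .inr (.inl j) => (1 - δ)⁻¹ • (vS j + (δ / ‖drift d‖ ^ 2) • drift d)
  | .inr (.inr i) => EuclideanSpace.single i 1

/-- The levels `a_j`: the `a_j^*` twice, then `β` for each coordinate direction. -/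
def level {d m : ℕ} (aS : Fin m → ℝ) (β : ℝ) : Idx d m → ℝ
  | .inl j => aS j
  | .inr (.inl j) => aS j
  | .inr (.inr _) => β

/-- The enlarged target `A = ⋃_j {y : yᵀ v_j > a_j}` (over all `2m + d` indices). -/
def enlarged {d m : ℕ} (vS : Fin m → E d) (aS : Fin m → ℝ) (δ β : ℝ) : Set (E d) :=
  halfSpaces (normal vS δ) (level aS β)

/-- The half-space `Γ = {y : yᵀ η ≥ γ}`. -/
def farSet (d : ℕ) (γ : ℝ) : Set (E d) := {y | γ ≤ inner ℝ y (drift d)}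

/-- `r_b(z) = max_j (zᵀ v_j - a_j b)`. -/
def rFun {d m : ℕ} (vS : Fin m → E d) (aS : Fin m → ℝ) (δ β b : ℝ) (z : E d) : ℝ :=
  ⨆ j : Idx d m, (inner ℝ z (normal vS δ j) - level aS β j * b)

/-- `v_b(s) = ∫_0^∞ P(X + t η + s ∈ bA) dt`. -/
def vFun {d m : ℕ} (ν : Measure (E d)) (vS : Fin m → E d) (aS : Fin m → ℝ) (δ β b : ℝ)
    (s : E d) : ℝ≥0∞ :=
  ∫⁻ t in Ioi (0 : ℝ), ν {x | x + t • drift d + s ∈ b • enlarged vS aS δ β}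

/-- The set `A_{b,a}(s₀) = {s₁ : max_j [(s₁ - s₀)ᵀ v_j - a (a_j b - s₀ᵀ v_j)] > 0}`. -/
def jumpSet {d m : ℕ} (vS : Fin m → E d) (aS : Fin m → ℝ) (δ β b a : ℝ) (s₀ : E d) : Set (E d) :=
  {s₁ | ∃ j : Idx d m, 0 < inner ℝ (s₁ - s₀) (normal vS δ j)
      - a * (level aS β j * b - inner ℝ s₀ (normal vS δ j))}

/-! ### The kernels -/

/-- The transition kernel of the walk, `K(s, ·) = P(X + s ∈ ·)`. -/
def nominalKernel {d : ℕ} (ν : Measure (E d)) [IsProbabilityMeasure ν] : Kernel (E d) (E d) where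
  toFun s := ν.map (fun x => x + s)
  measurable' := by
    refine Measure.measurable_of_measurable_coe _ fun B hB => ?_
    have h : MeasurableSet {q : E d × E d | q.2 + q.1 ∈ B} :=
      (measurable_snd.add measurable_fst) hB
    have h2 := measurable_measure_prodMk_left (ν := ν) h
    have h3 : (fun s => ν.map (fun x => x + s) B) =
        fun s => ν (Prod.mk s ⁻¹' {q : E d × E d | q.2 + q.1 ∈ B}) := by
      funext s
      rw [Measure.map_apply (measurable_add_const s) hB]
      rfl
    rw [h3]
    exact h2

instance {d : ℕ} (ν : Measure (E d)) [IsProbabilityMeasure ν] :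
    IsMarkovKernel (nominalKernel ν) :=
  ⟨fun s => Measure.isProbabilityMeasure_map (measurable_add_const s).aemeasurable⟩

/-- The mixture probability
`p_b(s) = min (θ P(s + X ∈ A_{b,a}(s)) / v_b(s), 1) · 1{r_b(s) ≤ -δ₂ b}`. -/
def mixProb {d m : ℕ} (ν : Measure (E d)) [IsProbabilityMeasure ν] (vS : Fin m → E d)
    (aS : Fin m → ℝ) (θ a δ δ₂ β b : ℝ) (s : E d) : ℝ≥0∞ :=
  {s | rFun vS aS δ β b s ≤ -δ₂ * b}.indicator
    (fun s => min (ENNReal.ofReal θ * nominalKernel ν s (jumpSet vS aS δ β b a s)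
      / vFun ν vS aS δ β b s) 1) s

/-- The density of `K̂(s₀, ds₁)` with respect to `P(X + s₀ ∈ ds₁)`. -/
def hatDensity {d m : ℕ} (ν : Measure (E d)) [IsProbabilityMeasure ν] (vS : Fin m → E d)
    (aS : Fin m → ℝ) (θ a δ δ₂ β b : ℝ) (s₀ s₁ : E d) : ℝ≥0∞ :=
  mixProb ν vS aS θ a δ δ₂ β b s₀ * (jumpSet vS aS δ β b a s₀).indicator 1 s₁
      / nominalKernel ν s₀ (jumpSet vS aS δ β b a s₀)
    + (1 - mixProb ν vS aS θ a δ δ₂ β b s₀)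

/-- The kernel `K̂`. -/
def hatKernel {d m : ℕ} (ν : Measure (E d)) [IsProbabilityMeasure ν] (vS : Fin m → E d)
    (aS : Fin m → ℝ) (θ a δ δ₂ β b : ℝ) : Kernel (E d) (E d) :=
  (nominalKernel ν).withDensity (hatDensity ν vS aS θ a δ δ₂ β b)

lemma isOpen_halfSpaces {d : ℕ} {ι : Type} (v : ι → E d) (c : ι → ℝ) :
    IsOpen (halfSpaces v c) := by
  have : halfSpaces v c = ⋃ j, {y | c j < inner ℝ y (v j)} := by
    ext; simp [halfSpaces]
  rw [this]
  exact isOpen_iUnion fun j => isOpen_lt (by fun_prop) (by fun_prop)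

lemma measurableSet_smul_enlarged {d m : ℕ} (vS : Fin m → E d) (aS : Fin m → ℝ) (δ β b : ℝ) :
    MeasurableSet (b • enlarged vS aS δ β) :=
  (isOpen_halfSpaces _ _).measurableSet.const_smul₀ b

lemma measurableSet_smul_farSet {d : ℕ} (γ b : ℝ) : MeasurableSet (b • farSet d γ) :=
  (isClosed_le (by fun_prop) (by fun_prop) : IsClosed (farSet d γ)).measurableSet.const_smul₀ b

lemma measurableSet_jumpSet {d m : ℕ} (vS : Fin m → E d) (aS : Fin m → ℝ) (δ β b a : ℝ) :
    MeasurableSet {q : E d × E d | q.2 ∈ jumpSet vS aS δ β b a q.1} := by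
  have : {q : E d × E d | q.2 ∈ jumpSet vS aS δ β b a q.1} =
      ⋃ j : Idx d m, {q : E d × E d | 0 < inner ℝ (q.2 - q.1) (normal vS δ j)
      - a * (level aS β j * b - inner ℝ q.1 (normal vS δ j))} := by
    ext; simp [jumpSet]
  rw [this]
  exact MeasurableSet.iUnion fun j => (isOpen_lt (by fun_prop) (by fun_prop)).measurableSet

lemma measurable_rFun {d m : ℕ} (vS : Fin m → E d) (aS : Fin m → ℝ) (δ β b : ℝ) :
    Measurable (rFun vS aS δ β b) := by
  unfold rFun
  exact Measurable.iSup fun j => by fun_prop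

lemma measurable_vFun {d m : ℕ} (ν : Measure (E d)) [IsProbabilityMeasure ν] (vS : Fin m → E d)
    (aS : Fin m → ℝ) (δ β b : ℝ) : Measurable (vFun ν vS aS δ β b) := by
  have h : MeasurableSet {q : (E d × ℝ) × E d |
      q.2 + q.1.2 • drift d + q.1.1 ∈ b • enlarged vS aS δ β} := by
    have hf : Measurable (fun q : (E d × ℝ) × E d => q.2 + q.1.2 • drift d + q.1.1) := by
      fun_prop
    exact hf (measurableSet_smul_enlarged vS aS δ β b)
  exact (measurable_measure_prodMk_left (ν := ν) h).lintegral_prod_right'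

lemma measurable_kernel_jumpSet {d m : ℕ} (ν : Measure (E d)) [IsProbabilityMeasure ν]
    (vS : Fin m → E d) (aS : Fin m → ℝ) (δ β b a : ℝ) :
    Measurable (fun s => nominalKernel ν s (jumpSet vS aS δ β b a s)) :=
  Kernel.measurable_kernel_prodMk_left (κ := nominalKernel ν)
    (measurableSet_jumpSet vS aS δ β b a)

lemma measurable_mixProb {d m : ℕ} (ν : Measure (E d)) [IsProbabilityMeasure ν]
    (vS : Fin m → E d) (aS : Fin m → ℝ) (θ a δ δ₂ β b : ℝ) :
    Measurable (mixProb ν vS aS θ a δ δ₂ β b) := by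
  refine Measurable.indicator ?_ (measurableSet_le (measurable_rFun ..) measurable_const)
  exact ((((measurable_kernel_jumpSet ν vS aS δ β b a).const_mul _).div
    (measurable_vFun ν vS aS δ β b)).min measurable_const)

lemma measurable_hatDensity {d m : ℕ} (ν : Measure (E d)) [IsProbabilityMeasure ν]
    (vS : Fin m → E d) (aS : Fin m → ℝ) (θ a δ δ₂ β b : ℝ) :
    Measurable (Function.uncurry (hatDensity ν vS aS θ a δ δ₂ β b)) := by
  have hp := (measurable_mixProb ν vS aS θ a δ δ₂ β b).comp
    (measurable_fst : Measurable (Prod.fst : E d × E d → E d))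
  have hk := (measurable_kernel_jumpSet ν vS aS δ β b a).comp
    (measurable_fst : Measurable (Prod.fst : E d × E d → E d))
  have hi : Measurable (fun q : E d × E d =>
      (jumpSet vS aS δ β b a q.1).indicator (1 : E d → ℝ≥0∞) q.2) :=
    (measurable_const (a := (1 : ℝ≥0∞))).indicator (measurableSet_jumpSet vS aS δ β b a)
  exact ((hp.mul hi).div hk).add (measurable_const.sub hp)

instance {d m : ℕ} (ν : Measure (E d)) [IsProbabilityMeasure ν] (vS : Fin m → E d)
    (aS : Fin m → ℝ) (θ a δ δ₂ β b : ℝ) :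
    IsMarkovKernel (hatKernel ν vS aS θ a δ δ₂ β b) := by
  refine ⟨fun s => ⟨?_⟩⟩
  have hA : MeasurableSet (jumpSet vS aS δ β b a s) :=
    measurable_prodMk_left (measurableSet_jumpSet vS aS δ β b a)
  have hp1 : mixProb ν vS aS θ a δ δ₂ β b s ≤ 1 := by
    unfold mixProb
    exact indicator_apply_le' (fun _ => min_le_right _ _) (fun _ => zero_le_one)
  rw [hatKernel, Kernel.withDensity_apply' _ (measurable_hatDensity ν vS aS θ a δ δ₂ β b),
    setLIntegral_univ]
  unfold hatDensity
  rw [lintegral_add_right _ measurable_const, lintegral_const, measure_univ, mul_one]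
  simp_rw [div_eq_mul_inv]
  have hi : Measurable ((jumpSet vS aS δ β b a s).indicator (1 : E d → ℝ≥0∞)) :=
    measurable_one.indicator hA
  rw [lintegral_mul_const _ (hi.const_mul _), lintegral_const_mul _ hi, lintegral_indicator_one hA]
  by_cases h0 : nominalKernel ν s (jumpSet vS aS δ β b a s) = 0
  · have hp : mixProb ν vS aS θ a δ δ₂ β b s = 0 := by
      unfold mixProb
      exact indicator_apply_eq_zero.2 fun _ => by simp [h0]
    simp [hp]
  · rw [mul_assoc, ENNReal.mul_inv_cancel h0 (measure_ne_top _ _), mul_one,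
      add_tsub_cancel_of_le hp1]

/-! ### The approximating path measure -/

/-- The event `T_{bA} ∧ T_{bΓ} > n`, for the states visited up to time `n`. -/
def notStopped {d m : ℕ} (vS : Fin m → E d) (aS : Fin m → ℝ) (δ β γ b : ℝ) (n : ℕ) :
    Set ((i : Finset.Iic n) → (fun _ : ℕ => E d) i) :=
  {S | ∀ i, S i ∉ b • enlarged vS aS δ β ∪ b • farSet d γ}

lemma measurableSet_notStopped {d m : ℕ} (vS : Fin m → E d) (aS : Fin m → ℝ) (δ β γ b : ℝ)
    (n : ℕ) : MeasurableSet (notStopped vS aS δ β γ b n) := by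
  have : notStopped vS aS δ β γ b n = ⋂ i : Finset.Iic n, (fun S => S i) ⁻¹'
      (b • enlarged vS aS δ β ∪ b • farSet d γ)ᶜ := by
    ext; simp [notStopped]
  rw [this]
  exact MeasurableSet.iInter fun i => (measurable_pi_apply i)
    ((measurableSet_smul_enlarged vS aS δ β b).union (measurableSet_smul_farSet γ b)).compl

open Classical in
/-- The transition from time `n` to time `n + 1`, given the states visited up to time `n`:
according to `K̂` if `n < T_{bA} ∧ T_{bΓ}`, and according to `K` otherwise. -/
def hatStep {d m : ℕ} (ν : Measure (E d)) [IsProbabilityMeasure ν] (vS : Fin m → E d)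
    (aS : Fin m → ℝ) (θ a δ δ₂ β γ b : ℝ) (n : ℕ) :
    Kernel ((i : Finset.Iic n) → (fun _ : ℕ => E d) i) (E d) :=
  Kernel.piecewise (measurableSet_notStopped vS aS δ β γ b n)
    ((hatKernel ν vS aS θ a δ δ₂ β b).comap
      (fun S => S ⟨n, Finset.mem_Iic.2 le_rfl⟩) (measurable_pi_apply _))
    ((nominalKernel ν).comap
      (fun S => S ⟨n, Finset.mem_Iic.2 le_rfl⟩) (measurable_pi_apply _))

instance {d m : ℕ} (ν : Measure (E d)) [IsProbabilityMeasure ν] (vS : Fin m → E d)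
    (aS : Fin m → ℝ) (θ a δ δ₂ β γ b : ℝ) (n : ℕ) :
    IsMarkovKernel (hatStep ν vS aS θ a δ δ₂ β γ b n) := by
  unfold hatStep; infer_instance

/-- The path measure `P̂_s`: the law of the process started at `s` with transitions `hatStep`. -/
def hatLaw {d m : ℕ} (ν : Measure (E d)) [IsProbabilityMeasure ν] (vS : Fin m → E d)
    (aS : Fin m → ℝ) (θ a δ δ₂ β γ b : ℝ) (s : E d) : Measure (ℕ → E d) :=
  Kernel.traj (X := fun _ : ℕ => E d) (hatStep ν vS aS θ a δ δ₂ β γ b) 0 (fun _ => s)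

end RuinWalk

end

open RuinWalk

/-!
The walk hits the distant target `b A^*` essentially in one way only. It follows its mean path
`n ↦ n η` up to some time `i ≤ M b`, within distance `ε b`, and is then carried into the target by a
single large increment. Since every normal has inner product `-1` with the drift, the excess
`Z = max_j (⟨X, v_j⟩ - c_j b)` of one increment has to be larger than `i` for this, so the ruin
probability is asymptotically `∑_i P(Z > i) ≈ E[Z⁺]`, the mean `overshoot`, which is of the order
`R = b P(‖X‖ > b)`. Everything else has probability `o(R)`, or at most a small multiple of `R`: two
large increments, a deviation of the walk by `ε b` without large increments (a Chernoff bound for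
truncated variables), a large increment after time `M b`, and an increment that ends near the
boundary of the target. This is `HalfSpaceBounds.exists_ruin_estimates`; the lower bound for the
mean overshoot, where the limit measure enters, is `IsRegularlyVarying.exists_le_overshoot`.

The value function satisfies `v_b(s) = E[(max_j (⟨X + s, v_j⟩ - a_j b))⁺]` for the enlarged family
of half-spaces, since the excess decreases at unit speed along the drift. So `v_b(S_n) ≈ J n` near
the mean path, where `J n = E[(Z - n)⁺]`, and the mixture probability there is about
`P(Z > n) / J n`.
As `J n - J (n + 1) ≈ P(Z > n)`, the likelihood ratio of the approximating process with respect to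
the walk, on a path which jumps at time `i`, telescopes:
`∏_{n < i} (1 - p(S_n)) · θ / J i ≈ J i / J 0 · 1 / J i = 1 / J 0`,
see `ofReal_div_overshoot_le_prod`. The relative errors add up to `O(ω + 1 / b)`, with `ω` small,
because the expected number of `n` with `n - ω b < Z ≤ n + 1` is at most `(ω b + 2) P(Z ≥ -ω b)`.
Moreover `J 0` is close to the ruin probability, because the tilted normals and the high coordinate
half-spaces hardly change the mean overshoot (`HalfSpaceBounds.exists_overshoot_enlarge_le`).

So on an event `G` that makes up most of the ruin event `H`, the approximating measure has a density
of at least about `1 / P(H)` with respect to the law of the walk, which is the density of the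
conditioned law. A one-sided bound between measures of total mass one suffices for total variation
(`abs_sub_cond_le`), so nothing needs to be known about the approximating process off `G`.
-/

namespace RuinWalk

open Preorder

/-! ### Path measures and change of measure -/

/-- The measure `M` on sequences makes transitions according to the kernels `κ`: given the states
visited up to time `N`, the state at time `N + 1` has law `κ N`. -/
def HasTransitions {F : Type*} [MeasurableSpace F]
    (κ : (n : ℕ) → Kernel ((i : Finset.Iic n) → (fun _ : ℕ => F) i) F) (M : Measure (ℕ → F)) :
    Prop :=
  ∀ (N : ℕ) (f : ((i : Finset.Iic N) → (fun _ : ℕ => F) i) × F → ℝ≥0∞), Measurable f →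
    ∫⁻ S, f (frestrictLe (π := fun _ : ℕ => F) N S, S (N + 1)) ∂M =
      ∫⁻ S, ∫⁻ y, f (frestrictLe (π := fun _ : ℕ => F) N S, y)
        ∂(κ N (frestrictLe (π := fun _ : ℕ => F) N S)) ∂M

/-- The Ionescu-Tulcea measure has the transitions it is built from. -/
lemma hasTransitions_traj {F : Type*} [MeasurableSpace F]
    (κ : (n : ℕ) → Kernel ((i : Finset.Iic n) → (fun _ : ℕ => F) i) F)
    [∀ n, IsMarkovKernel (κ n)] (x₀ : (i : Finset.Iic 0) → (fun _ : ℕ => F) i) :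
    HasTransitions κ (Kernel.traj (X := fun _ : ℕ => F) κ 0 x₀) := by
  intro N f hf
  have hm : Measurable fun z : (i : Finset.Iic (N + 1)) → (fun _ : ℕ => F) i =>
      (frestrictLe₂ (π := fun _ : ℕ => F) N.le_succ z, z ⟨N + 1, Finset.mem_Iic.2 le_rfl⟩) :=
    (measurable_frestrictLe₂ (X := fun _ : ℕ => F) N.le_succ).prodMk
          (measurable_pi_apply (X := fun _ : Finset.Iic (N + 1) => F) _)
  have hm2 : Measurable (IicProdIoc (X := fun _ : ℕ => F) N (N + 1)) := measurable_IicProdIoc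
  let φ : ((i : Finset.Iic (N + 1)) → (fun _ : ℕ => F) i) → ℝ≥0∞ := fun z =>
    f (frestrictLe₂ (π := fun _ : ℕ => F) N.le_succ z, z ⟨N + 1, Finset.mem_Iic.2 le_rfl⟩)
  have hm3 : Measurable φ := hf.comp hm
  have hm4 : Measurable fun q => φ (IicProdIoc (X := fun _ : ℕ => F) N (N + 1) q) := hm3.comp hm2
  have hm5 : ∀ z, Measurable fun b => φ (IicProdIoc (X := fun _ : ℕ => F) N (N + 1) (z, b)) :=
    fun z => hm4.comp measurable_prodMk_left
  have e1 : ∫⁻ S, f (frestrictLe (π := fun _ : ℕ => F) N S, S (N + 1))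
        ∂(Kernel.traj (X := fun _ : ℕ => F) κ 0 x₀) =
      ∫⁻ z, φ z ∂(Kernel.partialTraj (X := fun _ : ℕ => F) κ 0 (N + 1) x₀) := by
    rw [← Kernel.traj_map_frestrictLe_apply, lintegral_map hm3 (by fun_prop)]
    rfl
  have e2 : ∫⁻ S, ∫⁻ y, f (frestrictLe (π := fun _ : ℕ => F) N S, y)
        ∂(κ N (frestrictLe (π := fun _ : ℕ => F) N S))
          ∂(Kernel.traj (X := fun _ : ℕ => F) κ 0 x₀) =
      ∫⁻ z, ∫⁻ y, f (z, y) ∂(κ N z)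
        ∂(Kernel.partialTraj (X := fun _ : ℕ => F) κ 0 N x₀) := by
    rw [← Kernel.traj_map_frestrictLe_apply, lintegral_map _ (by fun_prop)]
    exact hf.lintegral_kernel_prod_right'
  rw [e1, e2, Kernel.partialTraj_succ_eq_comp (Nat.zero_le N), Kernel.lintegral_comp _ _ _ hm3]
  refine lintegral_congr fun z => ?_
  rw [Kernel.partialTraj_succ_self, Kernel.lintegral_map _ hm2 _ hm3,
    Kernel.lintegral_id_prod hm4, Kernel.lintegral_map _ (by fun_prop) _ (hm5 z)]
  refine lintegral_congr fun y => ?_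
  simp only [φ]
  congr 2
  · ext i
    have : (i : ℕ) ≤ N := Finset.mem_Iic.1 i.2
    simp [IicProdIoc, this]
  · simp [IicProdIoc, MeasurableEquiv.piSingleton]

/-- The likelihood ratio up to time `N` of two processes whose one-step transitions have the
relative densities `h n`. -/
noncomputable def likelihood {F : Type*}
    (h : (n : ℕ) → ((i : Finset.Iic n) → (fun _ : ℕ => F) i) → F → ℝ≥0∞)
    (N : ℕ) (S : ℕ → F) : ℝ≥0∞ :=
  ∏ n ∈ Finset.range N, h n (frestrictLe (π := fun _ : ℕ => F) n S) (S (n + 1))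

/-- The likelihood ratio up to time `N` is a measurable function of the path up to time `N`. -/
lemma exists_measurable_likelihood_eq {F : Type*} [MeasurableSpace F]
    {h : (n : ℕ) → ((i : Finset.Iic n) → (fun _ : ℕ => F) i) → F → ℝ≥0∞}
    (hh : ∀ n, Measurable (Function.uncurry (h n))) (N : ℕ) :
    ∃ D : ((i : Finset.Iic N) → (fun _ : ℕ => F) i) → ℝ≥0∞, Measurable D ∧
      ∀ S, likelihood h N S = D (frestrictLe (π := fun _ : ℕ => F) N S) := by
  induction N with
  | zero => exact ⟨fun _ => 1, measurable_const, fun S => by simp [likelihood]⟩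
  | succ N ih =>
    obtain ⟨D, hD, hD'⟩ := ih
    refine ⟨fun z => D (frestrictLe₂ (π := fun _ : ℕ => F) N.le_succ z) *
      h N (frestrictLe₂ (π := fun _ : ℕ => F) N.le_succ z) (z ⟨N + 1, Finset.mem_Iic.2 le_rfl⟩),
      ?_, fun S => ?_⟩
    · have h1 : Measurable fun z : (i : Finset.Iic (N + 1)) → (fun _ : ℕ => F) i =>
        (frestrictLe₂ (π := fun _ : ℕ => F) N.le_succ z, z ⟨N + 1, Finset.mem_Iic.2 le_rfl⟩) :=
        (measurable_frestrictLe₂ (X := fun _ : ℕ => F) N.le_succ).prodMk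
          (measurable_pi_apply (X := fun _ : Finset.Iic (N + 1) => F) _)
      exact (hD.comp (measurable_frestrictLe₂ _)).mul ((hh N).comp h1)
    · have := hD' S
      rw [likelihood, Finset.prod_range_succ, ← likelihood, this]
      rfl

/-- Up to a fixed time, the process with the tilted transitions is absolutely continuous with
respect to the original one, with density the likelihood ratio. -/
lemma lintegral_eq_lintegral_likelihood {F : Type*} [MeasurableSpace F]
    {κ κ' : (n : ℕ) → Kernel ((i : Finset.Iic n) → (fun _ : ℕ => F) i) F}
    [∀ n, IsMarkovKernel (κ n)] {P Q : Measure (ℕ → F)}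
    (hP : HasTransitions κ P) (hQ : HasTransitions κ' Q)
    (h0 : P.map (frestrictLe (π := fun _ : ℕ => F) 0) = Q.map (frestrictLe (π := fun _ : ℕ => F) 0))
    {h : (n : ℕ) → ((i : Finset.Iic n) → (fun _ : ℕ => F) i) → F → ℝ≥0∞}
    (hh : ∀ n, Measurable (Function.uncurry (h n)))
    (hκ : ∀ n, κ' n = (κ n).withDensity (h n)) (N : ℕ)
    {f : ((i : Finset.Iic N) → (fun _ : ℕ => F) i) → ℝ≥0∞} (hf : Measurable f) :
    ∫⁻ S, f (frestrictLe (π := fun _ : ℕ => F) N S) ∂Q =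
      ∫⁻ S, f (frestrictLe (π := fun _ : ℕ => F) N S) * likelihood h N S ∂P := by
  induction N with
  | zero =>
    simp only [likelihood, Finset.range_zero, Finset.prod_empty, mul_one]
    rw [← lintegral_map hf (measurable_frestrictLe 0), ← h0,
      lintegral_map hf (measurable_frestrictLe 0)]
  | succ N ih =>
    -- glue a path up to time `N` and a next state
    let g : ((i : Finset.Iic N) → (fun _ : ℕ => F) i) × F →
        ((i : Finset.Iic (N + 1)) → (fun _ : ℕ => F) i) := fun q i =>
      if hi : (i : ℕ) ≤ N then q.1 ⟨i, Finset.mem_Iic.2 hi⟩ else q.2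
    have hg : Measurable g := by
      refine measurable_pi_lambda _ fun i => ?_
      by_cases hi : (i : ℕ) ≤ N
      · simp only [g, hi, dite_true]; fun_prop
      · simp only [g, hi, dite_false]; fun_prop
    have hgS : ∀ S : ℕ → F, g (frestrictLe (π := fun _ : ℕ => F) N S, S (N + 1)) =
        frestrictLe (π := fun _ : ℕ => F) (N + 1) S := by
      intro S
      ext i
      by_cases hi : (i : ℕ) ≤ N
      · simp [g, hi]
      · have : (i : ℕ) = N + 1 := le_antisymm (Finset.mem_Iic.1 i.2) (by omega)
        simp [g, this]
    obtain ⟨D, hD, hD'⟩ := exists_measurable_likelihood_eq hh N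
    have hm : Measurable fun z => ∫⁻ y, f (g (z, y)) ∂(κ' N z) := by
      simp_rw [hκ N]
      have : ∀ z, ∫⁻ y, f (g (z, y)) ∂((κ N).withDensity (h N) z) =
          ∫⁻ y, h N z y * f (g (z, y)) ∂(κ N z) := fun z =>
        Kernel.lintegral_withDensity _ (hh N) _ (by fun_prop)
      simp_rw [this]
      have h2 : Measurable fun q : ((i : Finset.Iic N) → (fun _ : ℕ => F) i) × F =>
          h N q.1 q.2 * f (g (q.1, q.2)) := (hh N).mul (hf.comp hg)
      exact h2.lintegral_kernel_prod_right'
    have h3 := hQ N (fun q => f (g q)) (hf.comp hg)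
    simp only [hgS] at h3
    rw [h3, ih hm]
    have h4 := hP N (fun q => f (g q) * (D q.1 * h N q.1 q.2))
      ((hf.comp hg).mul ((hD.comp measurable_fst).mul (hh N)))
    simp only [hgS, ← hD'] at h4
    have h5 : ∀ S : ℕ → F, likelihood h (N + 1) S =
        likelihood h N S * h N (frestrictLe (π := fun _ : ℕ => F) N S) (S (N + 1)) := fun S => by
      rw [likelihood, Finset.prod_range_succ, ← likelihood]
    simp only [h5]
    rw [h4]
    refine lintegral_congr fun S => ?_
    rw [hκ N, Kernel.lintegral_withDensity _ (hh N) _ (by fun_prop), mul_comm,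
      ← lintegral_const_mul]
    · refine lintegral_congr fun y => ?_
      ring
    · have h2 : Measurable fun q : ((i : Finset.Iic N) → (fun _ : ℕ => F) i) × F =>
          h N q.1 q.2 * f (g (q.1, q.2)) := (hh N).mul (hf.comp hg)
      exact h2.comp measurable_prodMk_left

/-- On an event `G` decided at time `N`, after which the two processes have the same transitions,
the likelihood ratio at time `N` is a density on the whole path space. -/
lemma restrict_eq_withDensity_likelihood {F : Type*} [MeasurableSpace F]
    {κ κ' : (n : ℕ) → Kernel ((i : Finset.Iic n) → (fun _ : ℕ => F) i) F}
    [∀ n, IsMarkovKernel (κ n)] {P Q : Measure (ℕ → F)} [IsFiniteMeasure Q]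
    (hP : HasTransitions κ P) (hQ : HasTransitions κ' Q)
    (h0 : P.map (frestrictLe (π := fun _ : ℕ => F) 0) = Q.map (frestrictLe (π := fun _ : ℕ => F) 0))
    {h : (n : ℕ) → ((i : Finset.Iic n) → (fun _ : ℕ => F) i) → F → ℝ≥0∞}
    (hh : ∀ n, Measurable (Function.uncurry (h n)))
    (hκ : ∀ n, κ' n = (κ n).withDensity (h n)) {N : ℕ}
    {G : Set ((i : Finset.Iic N) → (fun _ : ℕ => F) i)} (hG : MeasurableSet G)
    (hG1 : ∀ S : ℕ → F, frestrictLe (π := fun _ : ℕ => F) N S ∈ G → ∀ n, N ≤ n →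
      h n (frestrictLe (π := fun _ : ℕ => F) n S) (S (n + 1)) = 1) :
    Q.restrict (frestrictLe (π := fun _ : ℕ => F) N ⁻¹' G) =
      (P.restrict (frestrictLe (π := fun _ : ℕ => F) N ⁻¹' G)).withDensity (likelihood h N) := by
  set G' := frestrictLe (π := fun _ : ℕ => F) N ⁻¹' G with hG'
  have hmG : MeasurableSet G' := (measurable_frestrictLe N) hG
  have hL : ∀ S ∈ G', ∀ M, N ≤ M → likelihood h M S = likelihood h N S := by
    intro S hS M hM
    unfold likelihood
    refine (Finset.prod_subset (Finset.range_mono hM) fun n _ hn => ?_).symm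
    exact hG1 S hS n (by simpa using hn)
  have key : ∀ M, N ≤ M → ∀ C : Set ((i : Finset.Iic M) → (fun _ : ℕ => F) i), MeasurableSet C →
      (Q.restrict G') (frestrictLe (π := fun _ : ℕ => F) M ⁻¹' C) =
      ((P.restrict G').withDensity (likelihood h N))
        (frestrictLe (π := fun _ : ℕ => F) M ⁻¹' C) := by
    intro M hM C hC
    have hmC : MeasurableSet (frestrictLe (π := fun _ : ℕ => F) M ⁻¹' C) :=
      (measurable_frestrictLe M) hC
    have hC2 : MeasurableSet (C ∩ frestrictLe₂ (π := fun _ : ℕ => F) hM ⁻¹' G) :=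
      hC.inter (measurable_frestrictLe₂ hM hG)
    have e : frestrictLe (π := fun _ : ℕ => F) M ⁻¹' C ∩ G' =
        frestrictLe (π := fun _ : ℕ => F) M ⁻¹' (C ∩ frestrictLe₂ (π := fun _ : ℕ => F) hM ⁻¹' G) :=
      rfl
    have := lintegral_eq_lintegral_likelihood hP hQ h0 hh hκ M
      (f := (C ∩ frestrictLe₂ (π := fun _ : ℕ => F) hM ⁻¹' G).indicator 1)
      (measurable_one.indicator hC2)
    rw [Measure.restrict_apply hmC, withDensity_apply _ hmC, Measure.restrict_restrict hmC, e,
      ← lintegral_indicator_one ((measurable_frestrictLe M) hC2)]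
    refine this.trans ?_
    rw [← lintegral_indicator ((measurable_frestrictLe M) hC2)]
    refine lintegral_congr fun S => ?_
    by_cases hS : frestrictLe (π := fun _ : ℕ => F) M S ∈
      C ∩ frestrictLe₂ (π := fun _ : ℕ => F) hM ⁻¹' G
    · have hS' : S ∈ frestrictLe (π := fun _ : ℕ => F) M ⁻¹'
        (C ∩ frestrictLe₂ (π := fun _ : ℕ => F) hM ⁻¹' G) := hS
      simp only [indicator_of_mem hS, indicator_of_mem hS', Pi.one_apply, one_mul,
        hL S hS.2 M hM]
    · have hS' : S ∉ frestrictLe (π := fun _ : ℕ => F) M ⁻¹'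
        (C ∩ frestrictLe₂ (π := fun _ : ℕ => F) hM ⁻¹' G) := hS
      simp only [indicator_of_notMem hS, indicator_of_notMem hS', zero_mul]
  -- two measures on path space agree if their finite-dimensional marginals do
  refine IsProjectiveLimit.unique (P := fun J => (Q.restrict G').map J.restrict) (fun J => rfl)
    fun J => ?_
  ext C hC
  obtain ⟨M, hNM, hJM⟩ : ∃ M, N ≤ M ∧ J ⊆ Finset.Iic M :=
    ⟨max N (J.sup id), le_max_left _ _, J.subset_Iic_sup_id.trans
      (Finset.Iic_subset_Iic.2 (le_max_right _ _))⟩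
  rw [Measure.map_apply (by fun_prop) hC, Measure.map_apply (by fun_prop) hC]
  exact (key M hNM (Finset.restrict₂ (π := fun _ : ℕ => F) hJM ⁻¹' C)
    ((Finset.measurable_restrict₂ hJM) hC)).symm

/-! ### The walk and the approximating process -/

/-- The increments are mapped to the path of the walk started at `s`. -/
def walkPath {d : ℕ} (s : E d) (x : ℕ → E d) (n : ℕ) : E d := s + ∑ i ∈ Finset.range n, x i

@[fun_prop]
lemma measurable_walkPath {d : ℕ} (s : E d) : Measurable (walkPath s) := by
  unfold walkPath; fun_prop

lemma walkLaw_eq_map {d : ℕ} (ν : Measure (E d)) [IsProbabilityMeasure ν] (s : E d) :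
    walkLaw ν s = (Measure.infinitePi (fun _ : ℕ => ν)).map (walkPath s) := rfl

instance {d : ℕ} (ν : Measure (E d)) [IsProbabilityMeasure ν] (s : E d) :
    IsProbabilityMeasure (walkLaw ν s) := by
  rw [walkLaw_eq_map]
  exact Measure.isProbabilityMeasure_map (by fun_prop)

/-- The transition of the random walk from time `n` to time `n + 1`, as a kernel on the paths up to
time `n`. -/
noncomputable def nominalStep {d : ℕ} (ν : Measure (E d)) [IsProbabilityMeasure ν] (n : ℕ) :
    Kernel ((i : Finset.Iic n) → (fun _ : ℕ => E d) i) (E d) :=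
  (nominalKernel ν).comap (fun S => S ⟨n, Finset.mem_Iic.2 le_rfl⟩)
    (measurable_pi_apply (X := fun _ : Finset.Iic n => E d) _)

instance {d : ℕ} (ν : Measure (E d)) [IsProbabilityMeasure ν] (n : ℕ) :
    IsMarkovKernel (nominalStep ν n) := by
  unfold nominalStep; infer_instance

/-- The walk is a Markov process: its increments are independent of the past. -/
lemma hasTransitions_walkLaw {d : ℕ} (ν : Measure (E d)) [IsProbabilityMeasure ν] (s : E d) :
    HasTransitions (nominalStep ν) (walkLaw ν s) := by
  intro N f hf
  set U : (ℕ → E d) → ((i : Finset.Iic N) → (fun _ : ℕ => E d) i) :=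
    fun x => frestrictLe (π := fun _ : ℕ => E d) N (walkPath s x) with hU
  have hUm : Measurable U := (measurable_frestrictLe N).comp (measurable_walkPath s)
  have hind : IndepFun U (fun x : ℕ → E d => x N) (Measure.infinitePi (fun _ : ℕ => ν)) := by
    have h1 : iIndepFun (fun (i : ℕ) (x : ℕ → E d) => x i)
        (Measure.infinitePi (fun _ : ℕ => ν)) :=
      iIndepFun_infinitePi (P := fun _ : ℕ => ν) (X := fun _ x => x) (fun _ => measurable_id)
    have h2 := h1.indepFun_finset (Finset.range N) {N} (by simp) (fun i => measurable_pi_apply i)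
    have h3 : Measurable fun (u : Finset.range N → E d) (i : Finset.Iic N) =>
        s + ∑ k : Finset.range N, if (k : ℕ) < i then u k else 0 := by
      refine measurable_pi_lambda _ fun i => ?_
      refine measurable_const.add (Finset.measurable_sum _ fun k _ => ?_)
      split_ifs
      · fun_prop
      · fun_prop
    have h4 : Measurable fun (u : ({N} : Finset ℕ) → E d) =>
        u ⟨N, Finset.mem_singleton_self N⟩ := by
      fun_prop
    have h5 := h2.comp h3 h4
    refine IndepFun.congr h5 (ae_of_all _ fun x => ?_) (ae_of_all _ fun x => rfl)
    ext1 i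
    have hi : (i : ℕ) ≤ N := Finset.mem_Iic.1 i.2
    simp only [hU, frestrictLe_apply, walkPath, Function.comp]
    congr 1
    rw [Finset.sum_coe_sort (Finset.range N) (fun k => if k < (i : ℕ) then x k else 0),
      ← Finset.sum_filter]
    refine Finset.sum_congr ?_ fun _ _ => rfl
    ext k
    simp only [Finset.mem_range, Finset.mem_filter]
    omega
  have hmap := (indepFun_iff_map_prod_eq_prod_map_map hUm.aemeasurable
    (measurable_pi_apply N).aemeasurable).1 hind
  rw [Measure.infinitePi_map_eval] at hmap
  have hg : Measurable fun q : ((i : Finset.Iic N) → (fun _ : ℕ => E d) i) × E d =>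
      f (q.1, q.2 + q.1 ⟨N, Finset.mem_Iic.2 le_rfl⟩) := by
    refine hf.comp (measurable_fst.prodMk (measurable_snd.add ?_))
    exact (measurable_pi_apply (X := fun _ : Finset.Iic N => E d) _).comp measurable_fst
  have hin : ∀ z : (i : Finset.Iic N) → (fun _ : ℕ => E d) i, ∫⁻ y, f (z, y) ∂(nominalStep ν N z) =
      ∫⁻ y, f (z, y + z ⟨N, Finset.mem_Iic.2 le_rfl⟩) ∂ν := by
    intro z
    have : nominalStep ν N z = ν.map (fun x => x + z ⟨N, Finset.mem_Iic.2 le_rfl⟩) := rfl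
    rw [this, lintegral_map (by fun_prop) (by fun_prop)]
  have hfS : Measurable fun S : ℕ → E d =>
      f (frestrictLe (π := fun _ : ℕ => E d) N S, S (N + 1)) := by fun_prop
  have hfS2 : Measurable fun S : ℕ → E d =>
      ∫⁻ y, f (frestrictLe (π := fun _ : ℕ => E d) N S, y)
        ∂(nominalStep ν N (frestrictLe (π := fun _ : ℕ => E d) N S)) := by
    have : Measurable fun z => ∫⁻ y, f (z, y) ∂(nominalStep ν N z) :=
      hf.lintegral_kernel_prod_right'
    exact this.comp (measurable_frestrictLe N)
  rw [walkLaw_eq_map, lintegral_map hfS (by fun_prop), lintegral_map hfS2 (by fun_prop)]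
  have e1 : ∀ x : ℕ → E d, f (frestrictLe (π := fun _ : ℕ => E d) N (walkPath s x),
      walkPath s x (N + 1)) = (fun q : ((i : Finset.Iic N) → (fun _ : ℕ => E d) i) × E d =>
      f (q.1, q.2 + q.1 ⟨N, Finset.mem_Iic.2 le_rfl⟩)) (U x, x N) := by
    intro x
    simp only [hU, frestrictLe_apply]
    congr 2
    rw [walkPath, walkPath, Finset.sum_range_succ]
    abel
  simp_rw [e1]
  rw [← lintegral_map (μ := Measure.infinitePi (fun _ : ℕ => ν)) (g := fun x => (U x, x N)) hg
    (hUm.prodMk (measurable_pi_apply N)), hmap, lintegral_prod _ hg.aemeasurable]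
  rw [lintegral_map _ hUm]
  · refine lintegral_congr fun x => ?_
    rw [hin]
  · exact hg.lintegral_prod_right'

open Classical in
/-- The one-step density of `hatStep` with respect to the transition of the random walk. -/
noncomputable def stepDensity {d m : ℕ} (ν : Measure (E d)) [IsProbabilityMeasure ν]
    (vS : Fin m → E d) (aS : Fin m → ℝ) (θ a δ δ₂ β γ b : ℝ) (n : ℕ)
    (S : (i : Finset.Iic n) → (fun _ : ℕ => E d) i) (y : E d) : ℝ≥0∞ :=
  if S ∈ notStopped vS aS δ β γ b n then
    hatDensity ν vS aS θ a δ δ₂ β b (S ⟨n, Finset.mem_Iic.2 le_rfl⟩) y else 1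

lemma measurable_stepDensity {d m : ℕ} (ν : Measure (E d)) [IsProbabilityMeasure ν]
    (vS : Fin m → E d) (aS : Fin m → ℝ) (θ a δ δ₂ β γ b : ℝ) (n : ℕ) :
    Measurable (Function.uncurry (stepDensity ν vS aS θ a δ δ₂ β γ b n)) := by
  classical
  have hH := measurable_hatDensity ν vS aS θ a δ δ₂ β b
  have h2 : MeasurableSet {q : ((i : Finset.Iic n) → (fun _ : ℕ => E d) i) × E d |
      q.1 ∈ notStopped vS aS δ β γ b n} :=
    measurable_fst (measurableSet_notStopped vS aS δ β γ b n)
  unfold stepDensity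
  generalize hatDensity ν vS aS θ a δ δ₂ β b = H at *
  generalize notStopped vS aS δ β γ b n = T at *
  have h : Measurable fun q : ((i : Finset.Iic n) → (fun _ : ℕ => E d) i) × E d =>
      (q.1 ⟨n, Finset.mem_Iic.2 le_rfl⟩, q.2) :=
    ((measurable_pi_apply (X := fun _ : Finset.Iic n => E d) _).comp measurable_fst).prodMk
      measurable_snd
  have h3 := hH.comp h
  exact Measurable.ite h2 h3 measurable_const

lemma hatStep_eq_withDensity {d m : ℕ} (ν : Measure (E d)) [IsProbabilityMeasure ν]
    (vS : Fin m → E d) (aS : Fin m → ℝ) (θ a δ δ₂ β γ b : ℝ) (n : ℕ) :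
    hatStep ν vS aS θ a δ δ₂ β γ b n =
      (nominalStep ν n).withDensity (stepDensity ν vS aS θ a δ δ₂ β γ b n) := by
  classical
  ext z C hC
  rw [Kernel.withDensity_apply' _ (measurable_stepDensity ν vS aS θ a δ δ₂ β γ b n)]
  rw [hatStep, Kernel.piecewise_apply]
  by_cases hz : z ∈ notStopped vS aS δ β γ b n
  · simp only [hz, if_true, stepDensity]
    rw [Kernel.comap_apply, hatKernel,
      Kernel.withDensity_apply' _ (measurable_hatDensity ν vS aS θ a δ δ₂ β b)]
    rfl
  · simp only [hz, if_false, stepDensity]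
    rw [setLIntegral_one]
    rfl

instance {d m : ℕ} (ν : Measure (E d)) [IsProbabilityMeasure ν] (vS : Fin m → E d)
    (aS : Fin m → ℝ) (θ a δ δ₂ β γ b : ℝ) (s : E d) :
    IsProbabilityMeasure (hatLaw ν vS aS θ a δ δ₂ β γ b s) := by
  unfold hatLaw; infer_instance

/-- A lower bound for the likelihood ratio on an event `G` on which the process first enters the
enlarged target at time `i + 1` gives a lower bound for the approximating path measure on `G`. -/
lemma mul_walkLaw_le_hatLaw {d m : ℕ} (ν : Measure (E d)) [IsProbabilityMeasure ν]
    (vS : Fin m → E d) (aS : Fin m → ℝ) (θ a δ δ₂ β γ b : ℝ) (s : E d) {i : ℕ}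
    {G : Set ((k : Finset.Iic (i + 1)) → (fun _ : ℕ => E d) k)} (hG : MeasurableSet G) {c : ℝ≥0∞}
    (hns : ∀ S : ℕ → E d, frestrictLe (π := fun _ : ℕ => E d) (i + 1) S ∈ G → ∀ n ≤ i,
      S n ∉ b • enlarged vS aS δ β ∪ b • farSet d γ)
    (hst : ∀ S : ℕ → E d, frestrictLe (π := fun _ : ℕ => E d) (i + 1) S ∈ G →
      S (i + 1) ∈ b • enlarged vS aS δ β)
    (hc : ∀ S : ℕ → E d, frestrictLe (π := fun _ : ℕ => E d) (i + 1) S ∈ G →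
      c ≤ ∏ n ∈ Finset.range (i + 1), hatDensity ν vS aS θ a δ δ₂ β b (S n) (S (n + 1)))
    {B : Set (ℕ → E d)} (hB : MeasurableSet B) :
    c * walkLaw ν s (B ∩ frestrictLe (π := fun _ : ℕ => E d) (i + 1) ⁻¹' G) ≤
      hatLaw ν vS aS θ a δ δ₂ β γ b s
        (B ∩ frestrictLe (π := fun _ : ℕ => E d) (i + 1) ⁻¹' G) := by
  have hmG : MeasurableSet (frestrictLe (π := fun _ : ℕ => E d) (i + 1) ⁻¹' G) :=
    (measurable_frestrictLe (i + 1)) hG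
  have h0 : (walkLaw ν s).map (frestrictLe (π := fun _ : ℕ => E d) 0) =
      (hatLaw ν vS aS θ a δ δ₂ β γ b s).map (frestrictLe (π := fun _ : ℕ => E d) 0) := by
    rw [hatLaw, Kernel.traj_map_frestrictLe_apply, Kernel.partialTraj_self, Kernel.id_apply,
      walkLaw_eq_map, Measure.map_map (by fun_prop) (by fun_prop)]
    have : frestrictLe (π := fun _ : ℕ => E d) 0 ∘ walkPath s = fun _ _ => s := by
      ext x k : 2
      have hk : (k : ℕ) = 0 := Nat.le_zero.1 (Finset.mem_Iic.1 k.2)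
      simp [walkPath, hk]
    rw [this, Measure.map_const, measure_univ, one_smul]
  have hlik : ∀ S : ℕ → E d, frestrictLe (π := fun _ : ℕ => E d) (i + 1) S ∈ G →
      likelihood (stepDensity ν vS aS θ a δ δ₂ β γ b) (i + 1) S =
      ∏ n ∈ Finset.range (i + 1), hatDensity ν vS aS θ a δ δ₂ β b (S n) (S (n + 1)) := by
    intro S hS
    refine Finset.prod_congr rfl fun n hn => ?_
    have : frestrictLe (π := fun _ : ℕ => E d) n S ∈ notStopped vS aS δ β γ b n := by
      intro k
      exact hns S hS k ((Finset.mem_Iic.1 k.2).trans (by simpa [Nat.lt_succ_iff] using hn))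
    rw [stepDensity, if_pos this]
    rfl
  have key := restrict_eq_withDensity_likelihood (hasTransitions_walkLaw ν s)
    (hasTransitions_traj (hatStep ν vS aS θ a δ δ₂ β γ b) (fun _ => s)) h0
    (measurable_stepDensity ν vS aS θ a δ δ₂ β γ b)
    (hatStep_eq_withDensity ν vS aS θ a δ δ₂ β γ b) hG (by
      intro S hS n hn
      rw [stepDensity, if_neg]
      intro h
      exact h ⟨i + 1, Finset.mem_Iic.2 hn⟩ (Or.inl (hst S hS)))
  rw [← Measure.restrict_apply hB, ← Measure.restrict_apply hB]
  change _ ≤ (Measure.restrict (Kernel.traj (X := fun _ : ℕ => E d)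
    (hatStep ν vS aS θ a δ δ₂ β γ b) 0 (fun _ => s)) _) B
  rw [key, withDensity_apply _ hB, Measure.restrict_restrict hB, Measure.restrict_apply hB,
    ← setLIntegral_const]
  refine setLIntegral_mono' (hB.inter hmG) fun S hS => ?_
  rw [hlik S hS.2]
  exact hc S hS.2

/-! ### Tails of a regularly varying law -/

/-- The tail `P(‖X‖ > b)` of the norm of a random vector of law `ν`. -/
noncomputable def tail {d : ℕ} (ν : Measure (E d)) (b : ℝ) : ℝ := ν.real {x | b < ‖x‖}

/-- The tail of the norm is positive and regularly varying with index `-α`. -/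
structure HasRegularTail {d : ℕ} (ν : Measure (E d)) (α : ℝ) : Prop where
  pos : ∀ b, 0 < tail ν b
  ratio : ∀ t, 0 < t → Tendsto (fun b => tail ν (t * b) / tail ν b) atTop (𝓝 (t ^ (-α)))

lemma tail_anti {d : ℕ} (ν : Measure (E d)) [IsProbabilityMeasure ν] : Antitone (tail ν) :=
  fun _ _ h => measureReal_mono fun _ hx => lt_of_le_of_lt h hx

lemma IsRegularlyVarying.hasRegularTail {d : ℕ} {ν : Measure (E d)} [IsProbabilityMeasure ν]
    {α : ℝ} {μ : Measure (E d)} (h : IsRegularlyVarying ν α μ) : HasRegularTail ν α := by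
  obtain ⟨L, hL, hV⟩ := h.index
  have hV' : ∀ b, 0 < b → tail ν b = b ^ (-α) * L b := hV
  have hLne : ∀ᶠ b in atTop, L b ≠ 0 := by
    have h1 := hL 1 one_pos
    filter_upwards [h1.eventually (lt_mem_nhds (show (0 : ℝ) < 1 by norm_num))] with b hb h0
    simp [h0] at hb
  refine ⟨fun b => ?_, fun t ht => ?_⟩
  · obtain ⟨b', hb', hb0, hbb⟩ := (hLne.and ((eventually_gt_atTop 0).and
      (eventually_ge_atTop b))).exists
    refine lt_of_lt_of_le ?_ (tail_anti ν hbb)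
    refine lt_of_le_of_ne measureReal_nonneg fun h0 => hb' ?_
    have h1 := hV' b' hb0
    rw [← h0] at h1
    exact (mul_eq_zero.1 h1.symm).resolve_left (Real.rpow_pos_of_pos hb0 _).ne'
  · have h1 : Tendsto (fun b => t ^ (-α) * (L (t * b) / L b)) atTop (𝓝 (t ^ (-α) * 1)) :=
      (hL t ht).const_mul _
    rw [mul_one] at h1
    refine h1.congr' ?_
    filter_upwards [eventually_gt_atTop 0] with b hb
    rw [hV' b hb, hV' _ (mul_pos ht hb), Real.mul_rpow ht.le hb.le]
    have := (Real.rpow_pos_of_pos hb (-α)).ne'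
    field_simp

lemma HasRegularTail.eventually_tail_mul_le {d : ℕ} {ν : Measure (E d)} {α : ℝ}
    (h : HasRegularTail ν α) {t C : ℝ} (ht : 0 < t) (hC : t ^ (-α) < C) :
    ∀ᶠ b in atTop, tail ν (t * b) ≤ C * tail ν b := by
  filter_upwards [(h.ratio t ht).eventually (gt_mem_nhds hC)] with b hb
  exact ((div_lt_iff₀ (h.pos b)).1 hb).le

lemma HasRegularTail.eventually_le_tail_mul {d : ℕ} {ν : Measure (E d)} {α : ℝ}
    (h : HasRegularTail ν α) {t C : ℝ} (ht : 0 < t) (hC : C < t ^ (-α)) :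
    ∀ᶠ b in atTop, C * tail ν b ≤ tail ν (t * b) := by
  filter_upwards [(h.ratio t ht).eventually (lt_mem_nhds hC)] with b hb
  exact ((lt_div_iff₀ (h.pos b)).1 hb).le

/-- Dyadic domination: a vector of norm larger than `b` lies in exactly one dyadic shell. -/
lemma ofReal_norm_rpow_le_tsum {d : ℕ} {p b : ℝ} (hp : 0 ≤ p) (hb : 0 < b) {x : E d}
    (hx : b < ‖x‖) :
    ENNReal.ofReal (‖x‖ ^ p) ≤
      ∑' k : ℕ, {x : E d | 2 ^ k * b < ‖x‖}.indicator
        (fun _ => ENNReal.ofReal ((2 ^ (k + 1) * b) ^ p)) x := by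
  have h1 : 1 ≤ ‖x‖ / b := (one_le_div hb).2 hx.le
  obtain ⟨k, hk⟩ : ∃ k : ℕ, 2 ^ k * b < ‖x‖ ∧ ‖x‖ ≤ 2 ^ (k + 1) * b := by
    have hex : ∃ k : ℕ, ‖x‖ ≤ 2 ^ k * b := by
      obtain ⟨k, hk⟩ := pow_unbounded_of_one_lt (‖x‖ / b) (one_lt_two : (1 : ℝ) < 2)
      exact ⟨k, ((div_lt_iff₀ hb).1 hk).le⟩
    classical
    have hf := Nat.find_spec hex
    have hf' := fun k => Nat.find_min hex (m := k)
    rcases hn : Nat.find hex with _ | k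
    · rw [hn] at hf; simp at hf; linarith
    · exact ⟨k, not_le.1 (hf' k (by omega)), by rw [← hn]; exact hf⟩
  refine le_trans ?_ (ENNReal.le_tsum k)
  rw [indicator_of_mem (show x ∈ {x : E d | 2 ^ k * b < ‖x‖} from hk.1)]
  exact ENNReal.ofReal_le_ofReal (Real.rpow_le_rpow (norm_nonneg _) hk.2 hp)

/-- Karamata-type bound: if doubling the level multiplies the tail by at most `r`, then truncated
moments of order `p` with `2 ^ p * r < 1` are controlled by the tail. -/
lemma lintegral_norm_rpow_le {d : ℕ} {ν : Measure (E d)} [IsProbabilityMeasure ν] {p r b₀ : ℝ}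
    (hp : 0 ≤ p) (hr : 0 ≤ r) (hpr : 2 ^ p * r < 1) (hb₀ : 0 < b₀)
    (h : ∀ b, b₀ ≤ b → tail ν (2 * b) ≤ r * tail ν b) {b : ℝ} (hb : b₀ ≤ b) :
    ∫⁻ x in {x | b < ‖x‖}, ENNReal.ofReal (‖x‖ ^ p) ∂ν ≤
      ENNReal.ofReal (2 ^ p * (1 - 2 ^ p * r)⁻¹ * (b ^ p * tail ν b)) := by
  have hb' : 0 < b := hb₀.trans_le hb
  have hms : ∀ c : ℝ, MeasurableSet {x : E d | c < ‖x‖} := fun c =>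
    measurableSet_lt measurable_const measurable_norm
  have hk : ∀ k : ℕ, tail ν (2 ^ k * b) ≤ r ^ k * tail ν b := by
    intro k
    induction k with
    | zero => simp
    | succ k ih =>
      have h2 : b₀ ≤ 2 ^ k * b := hb.trans (le_mul_of_one_le_left hb'.le (one_le_pow₀ one_le_two))
      calc tail ν (2 ^ (k + 1) * b) = tail ν (2 * (2 ^ k * b)) := by ring_nf
        _ ≤ r * tail ν (2 ^ k * b) := h _ h2
        _ ≤ r * (r ^ k * tail ν b) := mul_le_mul_of_nonneg_left ih hr
        _ = r ^ (k + 1) * tail ν b := by ring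
  have hq0 : 0 ≤ 2 ^ p * r := mul_nonneg (Real.rpow_nonneg zero_le_two p) hr
  calc ∫⁻ x in {x | b < ‖x‖}, ENNReal.ofReal (‖x‖ ^ p) ∂ν
      ≤ ∫⁻ x in {x | b < ‖x‖}, ∑' k : ℕ, {x : E d | 2 ^ k * b < ‖x‖}.indicator
        (fun _ => ENNReal.ofReal ((2 ^ (k + 1) * b) ^ p)) x ∂ν :=
        setLIntegral_mono' (hms b) fun x hx => ofReal_norm_rpow_le_tsum hp hb' hx
    _ ≤ ∫⁻ x, ∑' k : ℕ, {x : E d | 2 ^ k * b < ‖x‖}.indicator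
        (fun _ => ENNReal.ofReal ((2 ^ (k + 1) * b) ^ p)) x ∂ν := setLIntegral_le_lintegral _ _
    _ = ∑' k : ℕ, ENNReal.ofReal ((2 ^ (k + 1) * b) ^ p) * ν {x | 2 ^ k * b < ‖x‖} := by
        rw [lintegral_tsum fun k => (measurable_const.indicator (hms _)).aemeasurable]
        congr with k
        rw [lintegral_indicator_const (hms _)]
    _ ≤ ∑' k : ℕ, ENNReal.ofReal (2 ^ p * (b ^ p * tail ν b) * (2 ^ p * r) ^ k) := by
        refine ENNReal.tsum_le_tsum fun k => ?_
        have e : ν {x | 2 ^ k * b < ‖x‖} = ENNReal.ofReal (tail ν (2 ^ k * b)) := by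
          rw [tail, ofReal_measureReal]
        rw [e, ← ENNReal.ofReal_mul (by positivity)]
        refine ENNReal.ofReal_le_ofReal ?_
        have e2 : ((2 : ℝ) ^ (k + 1) * b) ^ p = 2 ^ p * b ^ p * (2 ^ p) ^ k := by
          rw [Real.mul_rpow (by positivity) hb'.le, ← Real.rpow_natCast,
            ← Real.rpow_mul zero_le_two, ← Real.rpow_natCast ((2 : ℝ) ^ p),
            ← Real.rpow_mul zero_le_two]
          rw [mul_right_comm, ← Real.rpow_add two_pos]
          push_cast
          ring_nf
        rw [e2, mul_pow]
        have := mul_le_mul_of_nonneg_left (hk k)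
          (show (0 : ℝ) ≤ 2 ^ p * b ^ p * (2 ^ p) ^ k by positivity)
        linarith
    _ = ENNReal.ofReal (2 ^ p * (1 - 2 ^ p * r)⁻¹ * (b ^ p * tail ν b)) := by
        have hs := (hasSum_geometric_of_lt_one hq0 hpr).mul_left (2 ^ p * (b ^ p * tail ν b))
        rw [← ENNReal.ofReal_tsum_of_nonneg _ hs.summable, hs.tsum_eq]
        · ring_nf
        · intro k
          have : 0 ≤ tail ν b := measureReal_nonneg
          positivity

/-- The index of regular variation exceeds one, so doubling the level divides the tail by more
than two. -/
lemma HasRegularTail.exists_doubling {d : ℕ} {ν : Measure (E d)} {α : ℝ}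
    (h : HasRegularTail ν α) (hα : 1 < α) :
    ∃ p r b₀ : ℝ, 1 < p ∧ p ≤ 2 ∧ 0 ≤ r ∧ 2 ^ p * r < 1 ∧ 0 < b₀ ∧
      ∀ b, b₀ ≤ b → tail ν (2 * b) ≤ r * tail ν b := by
  set p : ℝ := min 2 ((1 + α) / 2) with hp
  set s : ℝ := (p + α) / 2 with hs
  have hp1 : 1 < p := lt_min one_lt_two (by linarith)
  have hpα : p < α := (min_le_right _ _).trans_lt (by linarith)
  have h1 : (2 : ℝ) ^ (-α) < 2 ^ (-s) :=
    Real.rpow_lt_rpow_of_exponent_lt one_lt_two (by rw [hs]; linarith)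
  obtain ⟨b₀, hb₀⟩ := eventually_atTop.1 (h.eventually_tail_mul_le two_pos h1)
  refine ⟨p, 2 ^ (-s), max b₀ 1, hp1, min_le_left _ _, by positivity, ?_, by positivity,
    fun b hb => hb₀ b ((le_max_left _ _).trans hb)⟩
  rw [← Real.rpow_add two_pos]
  exact Real.rpow_lt_one_of_one_lt_of_neg one_lt_two (by rw [hs]; linarith)

/-- Some moment of order strictly larger than one is finite. -/
lemma HasRegularTail.exists_moment {d : ℕ} {ν : Measure (E d)} [IsProbabilityMeasure ν] {α : ℝ}
    (h : HasRegularTail ν α) (hα : 1 < α) :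
    ∃ p : ℝ, 1 < p ∧ p ≤ 2 ∧ ∫⁻ x, ENNReal.ofReal (‖x‖ ^ p) ∂ν < ∞ := by
  obtain ⟨p, r, b₀, hp1, hp2, hr, hpr, hb₀, hd⟩ := h.exists_doubling hα
  refine ⟨p, hp1, hp2, ?_⟩
  have hms : MeasurableSet {x : E d | b₀ < ‖x‖} := measurableSet_lt measurable_const measurable_norm
  rw [← lintegral_add_compl _ hms]
  refine ENNReal.add_lt_top.2 ⟨(lintegral_norm_rpow_le (by linarith) hr hpr hb₀ hd
    le_rfl).trans_lt ENNReal.ofReal_lt_top, ?_⟩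
  calc ∫⁻ x in {x : E d | b₀ < ‖x‖}ᶜ, ENNReal.ofReal (‖x‖ ^ p) ∂ν
      ≤ ∫⁻ x in {x : E d | b₀ < ‖x‖}ᶜ, ENNReal.ofReal (b₀ ^ p) ∂ν := by
        refine setLIntegral_mono' hms.compl fun x hx => ENNReal.ofReal_le_ofReal ?_
        exact Real.rpow_le_rpow (norm_nonneg _) (not_lt.1 hx) (by linarith)
    _ < ∞ := by
        rw [setLIntegral_const]
        exact ENNReal.mul_lt_top ENNReal.ofReal_lt_top (measure_lt_top _ _)

/-- The truncated first moment `E[‖X‖; ‖X‖ > b]`. -/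
noncomputable def tailMean {d : ℕ} (ν : Measure (E d)) (b : ℝ) : ℝ := ∫ x in {x | b < ‖x‖}, ‖x‖ ∂ν

/-- Karamata's theorem, as an upper bound for the truncated first moment. -/
lemma HasRegularTail.exists_tailMean_le {d : ℕ} {ν : Measure (E d)} [IsProbabilityMeasure ν]
    {α : ℝ} (h : HasRegularTail ν α) (hα : 1 < α) :
    ∃ C : ℝ, 0 < C ∧ ∀ᶠ b in atTop, tailMean ν b ≤ C * (b * tail ν b) := by
  obtain ⟨p, r, b₀, hp1, hp2, hr, hpr, hb₀, hd⟩ := h.exists_doubling hα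
  have hpr1 : (2 : ℝ) ^ (1 : ℝ) * r < 1 := lt_of_le_of_lt (mul_le_mul_of_nonneg_right
    (Real.rpow_le_rpow_of_exponent_le one_le_two hp1.le) hr) hpr
  refine ⟨2 ^ (1 : ℝ) * (1 - 2 ^ (1 : ℝ) * r)⁻¹, ?_, ?_⟩
  · have : 0 < 1 - 2 ^ (1 : ℝ) * r := by linarith
    positivity
  filter_upwards [eventually_ge_atTop b₀] with b hb
  have h1 := lintegral_norm_rpow_le zero_le_one hr hpr1 hb₀ hd hb
  simp only [Real.rpow_one] at h1 ⊢
  rw [tailMean, integral_eq_lintegral_of_nonneg_ae (ae_of_all _ fun x => norm_nonneg x)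
    measurable_norm.aestronglyMeasurable]
  refine ENNReal.toReal_le_of_le_ofReal ?_ h1
  have : 0 < 1 - 2 * r := by simpa using hpr1
  have := (h.pos b).le
  have := hb₀.trans_le hb
  positivity

/-- Truncated first moments at the level `c * b` are of the order of `b * tail ν b`. -/
lemma HasRegularTail.exists_tailMean_mul_le {d : ℕ} {ν : Measure (E d)} [IsProbabilityMeasure ν]
    {α : ℝ} (h : HasRegularTail ν α) (hα : 1 < α) {c : ℝ} (hc : 0 < c) :
    ∃ C : ℝ, 0 < C ∧ ∀ᶠ b in atTop, tailMean ν (c * b) ≤ C * (b * tail ν b) := by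
  obtain ⟨C, hC, hC'⟩ := h.exists_tailMean_le hα
  have h1 : c ^ (-α) < c ^ (-α) + 1 := by linarith
  refine ⟨C * (c * (c ^ (-α) + 1)), by positivity, ?_⟩
  filter_upwards [(tendsto_id.const_mul_atTop hc).eventually hC',
    h.eventually_tail_mul_le hc h1, eventually_gt_atTop 0] with b hb1 hb2 hb0
  refine hb1.trans ?_
  have : C * (c * b) * tail ν (c * b) ≤ C * (c * b) * ((c ^ (-α) + 1) * tail ν b) :=
    mul_le_mul_of_nonneg_left hb2 (by positivity)
  simp only [id]
  linarith

/-- Truncated first moments at the level `c * b` are negligible with respect to `b * tail ν b` when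
`c` is large. -/
lemma HasRegularTail.exists_tailMean_small {d : ℕ} {ν : Measure (E d)} [IsProbabilityMeasure ν]
    {α : ℝ} (h : HasRegularTail ν α) (hα : 1 < α) {t : ℝ} (ht : 0 < t) :
    ∃ c₀ : ℝ, 0 < c₀ ∧ ∀ c, c₀ ≤ c → ∀ᶠ b in atTop, tailMean ν (c * b) ≤ t * (b * tail ν b) := by
  obtain ⟨C, hC, hC'⟩ := h.exists_tailMean_le hα
  have hlim : Tendsto (fun c : ℝ => C * 2 * c ^ (-(α - 1))) atTop (𝓝 0) := by
    have := (tendsto_rpow_neg_atTop (show 0 < α - 1 by linarith)).const_mul (C * 2)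
    simpa using this
  obtain ⟨c₀, hc₀⟩ := eventually_atTop.1
    ((hlim.eventually (gt_mem_nhds ht)).and (eventually_gt_atTop 0))
  refine ⟨max c₀ 1, by positivity, fun c hc => ?_⟩
  obtain ⟨hct, hc0⟩ := hc₀ c ((le_max_left _ _).trans hc)
  have h1 : c ^ (-α) < 2 * c ^ (-α) := by linarith [Real.rpow_pos_of_pos hc0 (-α)]
  filter_upwards [(tendsto_id.const_mul_atTop hc0).eventually hC',
    h.eventually_tail_mul_le hc0 h1, eventually_gt_atTop 0] with b hb1 hb2 hb0
  refine hb1.trans ?_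
  simp only [id]
  have h2 : C * (c * b) * tail ν (c * b) ≤ C * (c * b) * (2 * c ^ (-α) * tail ν b) :=
    mul_le_mul_of_nonneg_left hb2 (by positivity)
  have h3 : c * c ^ (-α) = c ^ (-(α - 1)) := by
    nth_rewrite 1 [← Real.rpow_one c]
    rw [← Real.rpow_add hc0]; ring_nf
  have h4 : C * 2 * c ^ (-(α - 1)) * (b * tail ν b) ≤ t * (b * tail ν b) :=
    mul_le_mul_of_nonneg_right hct.le (mul_nonneg hb0.le (h.pos b).le)
  rw [← h3] at h4
  linarith

/-- The tail decays at most polynomially. -/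
lemma HasRegularTail.exists_rpow_le {d : ℕ} {ν : Measure (E d)} [IsProbabilityMeasure ν]
    {α : ℝ} (h : HasRegularTail ν α) (hα : 1 < α) :
    ∃ q : ℝ, 0 < q ∧ ∀ᶠ b in atTop, b ^ (-q) ≤ tail ν b := by
  have h1 : (2 : ℝ) ^ (-(α + 1)) < 2 ^ (-α) :=
    Real.rpow_lt_rpow_of_exponent_lt one_lt_two (by linarith)
  obtain ⟨b₁, hb₁⟩ := eventually_atTop.1 (h.eventually_le_tail_mul two_pos h1)
  set b₀ := max b₁ 1 with hb₀
  have hb₀pos : 0 < b₀ := lt_of_lt_of_le one_pos (le_max_right _ _)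
  have hk : ∀ k : ℕ, (2 : ℝ) ^ (-(α + 1) * k) * tail ν b₀ ≤ tail ν (2 ^ k * b₀) := by
    intro k
    induction k with
    | zero => simp
    | succ k ih =>
      have h2 : b₁ ≤ 2 ^ k * b₀ := (le_max_left _ _).trans
        (le_mul_of_one_le_left hb₀pos.le (one_le_pow₀ one_le_two))
      calc (2 : ℝ) ^ (-(α + 1) * (k + 1 : ℕ)) * tail ν b₀
          = 2 ^ (-(α + 1)) * (2 ^ (-(α + 1) * k) * tail ν b₀) := by
            rw [← mul_assoc, ← Real.rpow_add two_pos]; push_cast; ring_nf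
        _ ≤ 2 ^ (-(α + 1)) * tail ν (2 ^ k * b₀) := by gcongr
        _ ≤ tail ν (2 * (2 ^ k * b₀)) := hb₁ _ h2
        _ = tail ν (2 ^ (k + 1) * b₀) := by ring_nf
  set c := (2 / b₀) ^ (-(α + 1)) * tail ν b₀ with hc
  have hcpos : 0 < c := mul_pos (Real.rpow_pos_of_pos (by positivity) _) (h.pos _)
  refine ⟨α + 2, by linarith, ?_⟩
  filter_upwards [eventually_ge_atTop b₀, eventually_ge_atTop c⁻¹] with b hb hbc
  have hb0 : 0 < b := hb₀pos.trans_le hb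
  obtain ⟨k, hk1, hk2⟩ := exists_nat_pow_near ((one_le_div hb₀pos).2 hb) one_lt_two
  rw [le_div_iff₀ hb₀pos] at hk1
  rw [div_lt_iff₀ hb₀pos] at hk2
  have h3 : (2 * b / b₀) ^ (-(α + 1)) ≤ (2 : ℝ) ^ (-(α + 1) * (k + 1 : ℕ)) := by
    rw [mul_comm (-(α + 1)), Real.rpow_mul zero_le_two, Real.rpow_natCast]
    refine Real.rpow_le_rpow_of_nonpos (by positivity) ?_ (by linarith)
    rw [le_div_iff₀ hb₀pos, pow_succ]
    linarith
  calc b ^ (-(α + 2)) = b⁻¹ * b ^ (-(α + 1)) := by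
        rw [← Real.rpow_neg_one b, ← Real.rpow_add hb0]; ring_nf
    _ ≤ c * b ^ (-(α + 1)) := by
        gcongr
        exact inv_le_of_inv_le₀ hcpos hbc
    _ = (2 * b / b₀) ^ (-(α + 1)) * tail ν b₀ := by
        rw [hc, mul_right_comm, ← Real.mul_rpow (by positivity) hb0.le]
        ring_nf
    _ ≤ (2 : ℝ) ^ (-(α + 1) * (k + 1 : ℕ)) * tail ν b₀ :=
        mul_le_mul_of_nonneg_right h3 (h.pos _).le
    _ ≤ tail ν (2 ^ (k + 1) * b₀) := hk (k + 1)
    _ ≤ tail ν b := tail_anti ν hk2.le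

/-! ### The excess over a union of half-spaces -/

/-- The excess `max_j (⟨y, v_j⟩ - c_j b)`, positive exactly on `b • ⋃_j {y : ⟨y, v_j⟩ > c_j}`. -/
noncomputable def excess {d : ℕ} {ι : Type} (v : ι → E d) (c : ι → ℝ) (b : ℝ) (y : E d) : ℝ :=
  ⨆ j, (inner ℝ y (v j) - c j * b)

@[fun_prop]
lemma measurable_excess {d : ℕ} {ι : Type} [Finite ι] {v : ι → E d} {c : ι → ℝ} {b : ℝ} :
    Measurable (excess v c b) := by
  have := Finite.to_countable (α := ι)
  unfold excess
  exact Measurable.iSup fun j => by fun_prop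

/-- A family of half-spaces whose normals have norm at most `K` and inner product `-1` with the
drift, and whose levels lie in `[κ, Λ]`. -/
structure HalfSpaceBounds {d : ℕ} {ι : Type} (v : ι → E d) (c : ι → ℝ) (K κ Λ : ℝ) : Prop where
  K_pos : 0 < K
  κ_pos : 0 < κ
  norm_le : ∀ j, ‖v j‖ ≤ K
  le_level : ∀ j, κ ≤ c j
  level_le : ∀ j, c j ≤ Λ
  inner_drift : ∀ j, inner ℝ (drift d) (v j) = -1

section Excess

variable {d : ℕ} {ι : Type} [Finite ι] [Nonempty ι] {v : ι → E d} {c : ι → ℝ}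

lemma lt_excess_iff {b t : ℝ} {y : E d} :
    t < excess v c b y ↔ ∃ j, t < inner ℝ y (v j) - c j * b :=
  lt_ciSup_iff (Set.finite_range _).bddAbove

lemma excess_le_iff {b t : ℝ} {y : E d} :
    excess v c b y ≤ t ↔ ∀ j, inner ℝ y (v j) - c j * b ≤ t :=
  ciSup_le_iff (Set.finite_range _).bddAbove

lemma mem_smul_halfSpaces_iff {b : ℝ} (hb : 0 < b) {y : E d} :
    y ∈ b • halfSpaces v c ↔ 0 < excess v c b y := by
  rw [lt_excess_iff, mem_smul_set_iff_inv_smul_mem₀ hb.ne']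
  simp only [halfSpaces, mem_ofPred_eq, inner_smul_left, map_inv₀, conj_trivial]
  refine exists_congr fun j => ?_
  rw [lt_inv_mul_iff₀ hb, sub_pos, mul_comm]

variable {K κ Λ : ℝ}

/-- Along the drift, the excess decreases at unit speed. -/
lemma HalfSpaceBounds.excess_add_smul_drift (h : HalfSpaceBounds v c K κ Λ) (b t : ℝ) (y : E d) :
    excess v c b (y + t • drift d) = excess v c b y - t := by
  refine eq_of_forall_ge_iff fun r => ?_
  rw [sub_le_iff_le_add, excess_le_iff, excess_le_iff]
  refine forall_congr' fun j => ?_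
  rw [inner_add_left, inner_smul_left, h.inner_drift]
  simp only [conj_trivial]
  constructor <;> intro h <;> linarith

lemma HalfSpaceBounds.excess_add_le (h : HalfSpaceBounds v c K κ Λ) (b : ℝ) (y z : E d) :
    excess v c b (y + z) ≤ excess v c b y + K * ‖z‖ := by
  rw [excess_le_iff]
  intro j
  have h1 := (excess_le_iff (v := v) (c := c) (b := b) (y := y)).1 le_rfl j
  have h2 : inner ℝ z (v j) ≤ K * ‖z‖ := (real_inner_le_norm _ _).trans
    ((mul_comm _ _).trans_le (mul_le_mul_of_nonneg_right (h.norm_le j) (norm_nonneg _)))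
  rw [inner_add_left]
  linarith

lemma HalfSpaceBounds.excess_add_ge (h : HalfSpaceBounds v c K κ Λ) (b : ℝ) (y z : E d) :
    excess v c b y - K * ‖z‖ ≤ excess v c b (y + z) := by
  have := h.excess_add_le b (y + z) (-z)
  rw [add_neg_cancel_right, norm_neg] at this
  linarith

lemma HalfSpaceBounds.excess_le_norm (h : HalfSpaceBounds v c K κ Λ) {b : ℝ} (hb : 0 ≤ b)
    (y : E d) : excess v c b y ≤ K * ‖y‖ - κ * b := by
  rw [excess_le_iff]
  intro j
  have h2 : inner ℝ y (v j) ≤ K * ‖y‖ := (real_inner_le_norm _ _).trans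
    ((mul_comm _ _).trans_le (mul_le_mul_of_nonneg_right (h.norm_le j) (norm_nonneg _)))
  have := mul_le_mul_of_nonneg_right (h.le_level j) hb
  linarith

lemma HalfSpaceBounds.le_norm_of_excess (h : HalfSpaceBounds v c K κ Λ) {b t : ℝ} (hb : 0 ≤ b)
    {y : E d} (hy : t ≤ excess v c b y) : (κ * b + t) / K ≤ ‖y‖ := by
  rw [div_le_iff₀ h.K_pos]
  have := h.excess_le_norm hb y
  linarith

/-- The mean overshoot `E[(max_j (⟨X, v_j⟩ - c_j b) - t)^+]`. -/
noncomputable def overshoot (ν : Measure (E d)) (v : ι → E d) (c : ι → ℝ) (b t : ℝ) : ℝ :=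
  ∫ x, max (excess v c b x - t) 0 ∂ν

lemma HalfSpaceBounds.integrable_overshoot (h : HalfSpaceBounds v c K κ Λ) {ν : Measure (E d)}
    [IsProbabilityMeasure ν] (hν : Integrable (fun x : E d => x) ν) {b : ℝ} (hb : 0 ≤ b) (t : ℝ) :
    Integrable (fun x => max (excess v c b x - t) 0) ν := by
  refine Integrable.mono' ((hν.norm.const_mul K).add (integrable_const |t|))
    (by fun_prop) (ae_of_all _ fun x => ?_)
  rw [Real.norm_of_nonneg (le_max_right _ _)]
  refine max_le ?_ (by have := h.K_pos; simp only [Pi.add_apply]; positivity)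
  have h1 := h.excess_le_norm hb x
  have h2 := mul_nonneg h.κ_pos.le hb
  have h3 := neg_abs_le t
  simp only [Pi.add_apply]
  linarith

end Excess

/-! ### A lower bound for the probability of a jump into the target -/

/-- Test functions on `[-∞, ∞]^d` can thus be chosen to separate sets of `ℝ^d`. -/
lemma isOpenEmbedding_toCompact (d : ℕ) : IsOpenEmbedding (toCompact : E d → Fin d → EReal) := by
  have h1 : IsOpenEmbedding (Pi.map fun _ : Fin d => ((↑) : ℝ → EReal)) :=
    IsOpenEmbedding.piMap fun _ => EReal.isOpenEmbedding_coe
  exact h1.comp (PiLp.homeomorph 2 (fun _ : Fin d => ℝ)).isOpenEmbedding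

/-- Along the normalizing sequence, the tail of the norm is at most of order `1 / n`, and the
probability of hitting the target with one jump is at least of that order. -/
lemma IsRegularlyVarying.exists_normalizing_bounds {d : ℕ} {ι : Type} [Finite ι] [Nonempty ι]
    {ν : Measure (E d)} [IsProbabilityMeasure ν] {α : ℝ} {μ : Measure (E d)}
    (hRV : IsRegularlyVarying ν α μ) {v : ι → E d} {c : ι → ℝ} {K κ Λ : ℝ}
    (h : HalfSpaceBounds v c K κ Λ) (hμ : 0 < μ (halfSpaces v c)) :
    ∃ (a : ℕ → ℝ) (c₁ C₁ : ℝ), 0 < c₁ ∧ 0 < C₁ ∧ (∀ n, 0 < a n) ∧ Monotone a ∧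
      Tendsto a atTop atTop ∧ ∀ᶠ n : ℕ in atTop,
        c₁ ≤ n * ν.real (a n • halfSpaces v c) ∧ n * tail ν (a n) ≤ C₁ := by
  obtain ⟨a, ha0, hamono, hatop, hvague⟩ := hRV.vague
  set A := halfSpaces v c with hA
  have hAo : IsOpen A := isOpen_halfSpaces v c
  set r := κ / K with hr
  have hr0 : 0 < r := div_pos h.κ_pos h.K_pos
  have hAr : ∀ y ∈ A, r ≤ ‖y‖ := by
    intro y hy
    have h1 : 0 < excess v c 1 y := by rwa [← mem_smul_halfSpaces_iff one_pos, one_smul]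
    simpa using h.le_norm_of_excess zero_le_one h1.le
  have hAfin : μ A < ∞ := (measure_mono hAr).trans_lt (hRV.radon r hr0)
  have hemb := isOpenEmbedding_toCompact d
  have hzero : toCompact (0 : E d) = 0 := by ext i; simp [toCompact]
  have hmeas : Measurable (toCompact : E d → Fin d → EReal) :=
    measurable_pi_lambda _ fun i => by unfold toCompact; fun_prop
  -- a lower bound by a test function supported in the target
  have hlow : ∃ c₁ > 0, ∀ᶠ n : ℕ in atTop, c₁ ≤ n * ν.real (a n • A) := by
    have : IsFiniteMeasure (μ.restrict A) := ⟨by simpa using hAfin⟩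
    obtain ⟨k, hkA, hkc, hk0⟩ := hAo.exists_lt_isCompact (μ := μ.restrict A) (r := 0) (by simpa)
    have hkμ : 0 < μ k := hk0.trans_le (Measure.restrict_apply_le _ _)
    obtain ⟨f, hf0, hf1, hf01⟩ := exists_continuous_zero_one_of_isClosed
      (s := (toCompact '' A)ᶜ) (t := toCompact '' k)
      (hemb.isOpenMap A hAo).isClosed_compl (hkc.image hemb.continuous).isClosed
      (disjoint_compl_left_iff.2 (image_mono hkA))
    have hfA : ∀ y : E d, y ∉ A → f (toCompact y) = 0 := fun y hy =>
      hf0 fun ⟨z, hz, hzy⟩ => hy (hemb.injective hzy ▸ hz)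
    have hlim := hvague f (by
      have hn : toCompact '' Metric.ball (0 : E d) r ∈ 𝓝 (0 : Fin d → EReal) :=
        (hemb.isOpenMap _ Metric.isOpen_ball).mem_nhds ⟨0, Metric.mem_ball_self hr0, hzero⟩
      filter_upwards [hn] with y hy
      obtain ⟨z, hz, rfl⟩ := hy
      refine hfA z fun hzA => ?_
      have := hAr z hzA
      rw [mem_ball_zero_iff] at hz
      linarith)
    have hpos : 0 < ∫ y, f (toCompact y) ∂μ := by
      have hkm : MeasurableSet k := hkc.isClosed.measurableSet
      have hint : Integrable (fun y => f (toCompact y)) μ := by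
        have h1 : Integrable (A.indicator fun _ => (1 : ℝ)) μ :=
          (integrable_indicator_iff hAo.measurableSet).2 (integrableOn_const hAfin.ne)
        refine h1.mono' (f.continuous.comp hemb.continuous).aestronglyMeasurable
          (ae_of_all _ fun y => ?_)
        by_cases hy : y ∈ A
        · rw [indicator_of_mem hy, Real.norm_of_nonneg (hf01 _).1]
          exact (hf01 _).2
        · rw [indicator_of_notMem hy, hfA y hy, norm_zero]
      calc 0 < μ.real k := ENNReal.toReal_pos hkμ.ne' ((measure_mono hkA).trans_lt hAfin).ne
        _ = ∫ y, k.indicator 1 y ∂μ := (integral_indicator_one hkm).symm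
        _ ≤ ∫ y, f (toCompact y) ∂μ := by
          refine integral_mono_of_nonneg (ae_of_all _ fun y => indicator_nonneg (by simp) _) hint
            (ae_of_all _ fun y => ?_)
          by_cases hy : y ∈ k
          · simp only [indicator_of_mem hy]
            exact (hf1 ⟨y, hy, rfl⟩).ge
          · simp only [indicator_of_notMem hy]
            exact (hf01 _).1
    refine ⟨(∫ y, f (toCompact y) ∂μ) / 2, by positivity, ?_⟩
    filter_upwards [hlim.eventually (lt_mem_nhds (half_lt_self hpos))] with n hn
    refine hn.le.trans (mul_le_mul_of_nonneg_left ?_ (Nat.cast_nonneg n))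
    have hmA : MeasurableSet (a n • A) := hAo.measurableSet.const_smul₀ _
    rw [← integral_indicator_one hmA]
    refine integral_mono_of_nonneg (ae_of_all _ fun y => (hf01 _).1)
      ((integrable_indicator_iff hmA).2 (integrableOn_const (measure_ne_top _ _)))
      (ae_of_all _ fun y => ?_)
    by_cases hy : y ∈ a n • A
    · simp only [indicator_of_mem hy]
      exact (hf01 _).2
    · simp only [indicator_of_notMem hy]
      rw [mem_smul_set_iff_inv_smul_mem₀ (ha0 n).ne'] at hy
      exact (hfA _ hy).le
  -- an upper bound by a test function equal to one outside the unit ball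
  have hup : ∃ C₁ > 0, ∀ᶠ n : ℕ in atTop, n * tail ν (a n) ≤ C₁ := by
    obtain ⟨f, hf0, hf1, hf01⟩ := exists_continuous_zero_one_of_isClosed
      (s := toCompact '' Metric.closedBall (0 : E d) (1 / 2))
      (t := (toCompact '' Metric.ball (0 : E d) 1)ᶜ)
      ((isCompact_closedBall _ _).image hemb.continuous).isClosed
      (hemb.isOpenMap _ Metric.isOpen_ball).isClosed_compl
      (disjoint_compl_right_iff_subset.2 (image_mono
        (Metric.closedBall_subset_ball (by norm_num))))
    have hlim := hvague f (by
      have hn : toCompact '' Metric.ball (0 : E d) (1 / 2) ∈ 𝓝 (0 : Fin d → EReal) :=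
        (hemb.isOpenMap _ Metric.isOpen_ball).mem_nhds
          ⟨0, Metric.mem_ball_self (by norm_num), hzero⟩
      filter_upwards [hn] with y hy
      exact hf0 (image_mono Metric.ball_subset_closedBall hy))
    set l := ∫ y, f (toCompact y) ∂μ with hl
    refine ⟨|l| + 1, by positivity, ?_⟩
    filter_upwards [hlim.eventually (gt_mem_nhds (show l < |l| + 1 by linarith [le_abs_self l]))]
      with n hn
    refine le_trans (mul_le_mul_of_nonneg_left ?_ (Nat.cast_nonneg n)) hn.le
    have hmA : MeasurableSet {x : E d | a n < ‖x‖} :=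
      measurableSet_lt measurable_const measurable_norm
    rw [tail, ← integral_indicator_one hmA]
    refine integral_mono_of_nonneg (ae_of_all _ fun y => indicator_nonneg (by simp) _) ?_
      (ae_of_all _ fun y => ?_)
    · refine (integrable_const (1 : ℝ)).mono' (f.continuous.measurable.comp (hmeas.comp
        (measurable_const_smul _))).aestronglyMeasurable (ae_of_all _ fun y => ?_)
      rw [Real.norm_of_nonneg (hf01 _).1]
      exact (hf01 _).2
    · by_cases hy : y ∈ {x : E d | a n < ‖x‖}
      · simp only [indicator_of_mem hy]
        refine (hf1 ?_).ge
        rintro ⟨z, hz, hzy⟩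
        rw [hemb.injective hzy, mem_ball_zero_iff, norm_smul, norm_inv,
          Real.norm_of_nonneg (ha0 n).le, inv_mul_lt_iff₀ (ha0 n), mul_one] at hz
        exact lt_asymm hz hy
      · simp only [indicator_of_notMem hy]
        exact (hf01 _).1
  obtain ⟨c₁, hc₁, h1⟩ := hlow
  obtain ⟨C₁, hC₁, h2⟩ := hup
  exact ⟨a, c₁, C₁, hc₁, hC₁, ha0, hamono, hatop, h1.and h2⟩

/-- The probability that one jump falls into `b • A` is of the order of the tail of the norm. -/
lemma IsRegularlyVarying.exists_tail_le_jump {d : ℕ} {ι : Type} [Finite ι] [Nonempty ι]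
    {ν : Measure (E d)} [IsProbabilityMeasure ν] {α : ℝ} {μ : Measure (E d)}
    (hRV : IsRegularlyVarying ν α μ) {v : ι → E d} {c : ι → ℝ} {K κ Λ : ℝ}
    (h : HalfSpaceBounds v c K κ Λ) (hμ : 0 < μ (halfSpaces v c)) :
    ∃ c₁ : ℝ, 0 < c₁ ∧ ∀ᶠ b in atTop, c₁ * tail ν b ≤ ν.real {x | 0 < excess v c b x} := by
  obtain ⟨a, c₁, C₁, hc₁, hC₁, ha0, hamono, hatop, hev⟩ := hRV.exists_normalizing_bounds h hμ
  obtain ⟨N, hN⟩ := eventually_atTop.1 (hev.and (eventually_ge_atTop 1))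
  refine ⟨c₁ / (2 * C₁), by positivity, ?_⟩
  filter_upwards [eventually_ge_atTop (a N)] with b hb
  have hb0 : 0 < b := (ha0 N).trans_le hb
  have hex : ∃ k, b < a k := (hatop.eventually (eventually_gt_atTop b)).exists
  classical
  obtain ⟨n, hn⟩ : ∃ n, Nat.find hex = n + 1 := by
    refine Nat.exists_eq_succ_of_ne_zero fun h0 => ?_
    have := Nat.find_spec hex
    rw [h0] at this
    exact absurd (hb.trans_lt this) (not_lt.2 (hamono (Nat.zero_le N)))
  have hn1 : b < a (n + 1) := hn ▸ Nat.find_spec hex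
  have hn2 : a n ≤ b := not_lt.1 (Nat.find_min hex (by omega))
  have hNn : N ≤ n := by
    by_contra hlt
    exact absurd (hn1.trans_le (hamono (show n + 1 ≤ N by omega))) (not_lt.2 hb)
  obtain ⟨⟨-, h1⟩, hn0⟩ := hN n hNn
  obtain ⟨⟨h2, -⟩, -⟩ := hN (n + 1) (by omega)
  have hnpos : (1 : ℝ) ≤ n := by exact_mod_cast hn0
  have h3 : ν.real (a (n + 1) • halfSpaces v c) ≤ ν.real {x | 0 < excess v c b x} := by
    refine measureReal_mono fun x hx => ?_
    rw [mem_smul_halfSpaces_iff (ha0 _)] at hx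
    obtain ⟨j, hj⟩ := lt_excess_iff.1 hx
    refine lt_excess_iff.2 ⟨j, hj.trans_le (sub_le_sub_left ?_ _)⟩
    exact mul_le_mul_of_nonneg_left hn1.le (h.κ_pos.le.trans (h.le_level j))
  have h4 : n * tail ν b ≤ C₁ :=
    (mul_le_mul_of_nonneg_left (tail_anti ν hn2) (Nat.cast_nonneg n)).trans h1
  push_cast at h2
  have h5 : c₁ ≤ 2 * n * ν.real {x | 0 < excess v c b x} := by
    refine h2.trans (mul_le_mul (by linarith) h3 measureReal_nonneg (by positivity))
  rw [div_mul_eq_mul_div, div_le_iff₀ (by positivity)]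
  have h6 : n * (c₁ * tail ν b) ≤ n * (ν.real {x | 0 < excess v c b x} * (2 * C₁)) := by
    calc n * (c₁ * tail ν b) = c₁ * (n * tail ν b) := by ring
      _ ≤ c₁ * C₁ := mul_le_mul_of_nonneg_left h4 hc₁.le
      _ ≤ 2 * n * ν.real {x | 0 < excess v c b x} * C₁ := mul_le_mul_of_nonneg_right h5 hC₁.le
      _ = _ := by ring
  exact le_of_mul_le_mul_left h6 (by positivity)

/-- The mean overshoot above the level `M b` is of the order of `b * tail ν b`, for every `M`. -/
lemma IsRegularlyVarying.exists_le_overshoot {d : ℕ} {ι : Type} [Finite ι] [Nonempty ι]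
    {ν : Measure (E d)} [IsProbabilityMeasure ν] {α : ℝ} {μ : Measure (E d)}
    (hRV : IsRegularlyVarying ν α μ) (hν : Integrable (fun x : E d => x) ν)
    {v : ι → E d} {c : ι → ℝ} {K κ Λ : ℝ}
    (h : HalfSpaceBounds v c K κ Λ) (hμ : 0 < μ (halfSpaces v c)) {M : ℝ} (hM : 0 ≤ M) :
    ∃ c₁ : ℝ, 0 < c₁ ∧ ∀ᶠ b in atTop, c₁ * (b * tail ν b) ≤ overshoot ν v c b (M * b) := by
  obtain ⟨c₁, hc₁, hev⟩ := hRV.exists_tail_le_jump h hμ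
  have hκ := h.κ_pos
  set l := 1 + (M + κ) / κ with hl
  have hl0 : 0 < l := by positivity
  have hlα : l ^ (-α) / 2 < l ^ (-α) := half_lt_self (Real.rpow_pos_of_pos hl0 _)
  refine ⟨κ * (c₁ * (l ^ (-α) / 2)), by positivity, ?_⟩
  filter_upwards [(tendsto_id.const_mul_atTop hl0).eventually hev,
    hRV.hasRegularTail.eventually_le_tail_mul hl0 hlα, eventually_gt_atTop 0] with b h1 h2 hb
  simp only [id] at h1
  have hm : MeasurableSet {x : E d | 0 < excess v c (l * b) x} :=
    measurableSet_lt measurable_const measurable_excess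
  calc κ * (c₁ * (l ^ (-α) / 2)) * (b * tail ν b)
      = κ * b * (c₁ * (l ^ (-α) / 2 * tail ν b)) := by ring
    _ ≤ κ * b * (c₁ * tail ν (l * b)) := by gcongr
    _ ≤ κ * b * ν.real {x | 0 < excess v c (l * b) x} := by gcongr
    _ = ∫ x, {x : E d | 0 < excess v c (l * b) x}.indicator (fun _ => κ * b) x ∂ν := by
      rw [integral_indicator_const _ hm, smul_eq_mul, mul_comm]
    _ ≤ overshoot ν v c b (M * b) := by
      refine integral_mono_of_nonneg (ae_of_all _ fun y => indicator_nonneg (fun _ _ => by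
        positivity) _) (h.integrable_overshoot hν hb.le _) (ae_of_all _ fun x => ?_)
      by_cases hx : x ∈ {x : E d | 0 < excess v c (l * b) x}
      · simp only [indicator_of_mem hx]
        refine le_max_of_le_left ?_
        obtain ⟨j, hj⟩ := lt_excess_iff.1 hx
        have h3 : κ * b + M * b < excess v c b x := by
          refine lt_excess_iff.2 ⟨j, ?_⟩
          have h4 : (M + κ) * b ≤ c j * (((M + κ) / κ) * b) := by
            calc (M + κ) * b = κ * (((M + κ) / κ) * b) := by field_simp
              _ ≤ _ := mul_le_mul_of_nonneg_right (h.le_level j) (by positivity)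
          have h5 : c j * (l * b) = c j * b + c j * (((M + κ) / κ) * b) := by rw [hl]; ring
          rw [h5] at hj
          linarith
        linarith
      · simp only [indicator_of_notMem hx]
        exact le_max_right _ _

/-! ### Deviations of the walk without large jumps -/

/-- The law of the sequence of increments. -/
noncomputable abbrev incLaw {d : ℕ} (ν : Measure (E d)) [IsProbabilityMeasure ν] :
    Measure (ℕ → E d) := Measure.infinitePi (fun _ : ℕ => ν)

lemma iIndepFun_eval {d : ℕ} (ν : Measure (E d)) [IsProbabilityMeasure ν] :
    iIndepFun (fun (i : ℕ) (x : ℕ → E d) => x i) (incLaw ν) :=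
  iIndepFun_infinitePi (P := fun _ : ℕ => ν) (X := fun _ x => x) (fun _ => measurable_id)

lemma incLaw_eval_preimage {d : ℕ} (ν : Measure (E d)) [IsProbabilityMeasure ν] (i : ℕ)
    {B : Set (E d)} (hB : MeasurableSet B) : incLaw ν {x | x i ∈ B} = ν B := by
  have h := congrArg (fun m : Measure (E d) => m B)
    (Measure.infinitePi_map_eval (fun _ : ℕ => ν) i)
  beta_reduce at h
  rw [Measure.map_apply (measurable_pi_apply i) hB] at h
  exact h

/-- Second order bound for the exponential in terms of a power `p ∈ [1, 2]`, for variables without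
finite variance. -/
lemma exp_sub_one_sub_le {p u : ℝ} (hp1 : 1 ≤ p) (hp2 : p ≤ 2) :
    Real.exp u - 1 - u ≤ |u| ^ p * Real.exp (max u 0) := by
  have he : 1 ≤ Real.exp (max u 0) := Real.one_le_exp (le_max_right _ _)
  have hnn : 0 ≤ |u| ^ p := Real.rpow_nonneg (abs_nonneg u) p
  rcases le_total |u| 1 with h | h
  · have h1 := (le_abs_self _).trans (Real.abs_exp_sub_one_sub_id_le h)
    have h2 : u ^ 2 ≤ |u| ^ p := by
      rw [← sq_abs, ← Real.rpow_natCast]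
      rcases (abs_nonneg u).eq_or_lt with h0 | h0
      · rw [← h0, Real.zero_rpow (by norm_num), Real.zero_rpow (by linarith)]
      · exact Real.rpow_le_rpow_of_exponent_ge h0 h (by exact_mod_cast hp2)
    exact (h1.trans h2).trans (le_mul_of_one_le_right hnn he)
  · have h2 : |u| ≤ |u| ^ p := by
      simpa using Real.rpow_le_rpow_of_exponent_le h hp1
    rcases le_total 0 u with h0 | h0
    · rw [abs_of_nonneg h0] at h h2 ⊢
      rw [max_eq_left h0]
      have h3 : Real.exp u ≤ u * Real.exp u := le_mul_of_one_le_left (Real.exp_pos u).le h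
      have h4 : u * Real.exp u ≤ u ^ p * Real.exp u :=
        mul_le_mul_of_nonneg_right h2 (Real.exp_pos u).le
      linarith
    · have h3 : Real.exp u ≤ 1 := Real.exp_le_one_iff.2 h0
      have h4 : |u| = -u := abs_of_nonpos h0
      have h5 : |u| ^ p ≤ |u| ^ p * Real.exp (max u 0) := le_mul_of_one_le_right hnn he
      linarith

/-- Exponential moment of a centred variable truncated from above. -/
lemma mgf_truncation_le {Ω : Type*} [MeasurableSpace Ω] {P : Measure Ω} [IsProbabilityMeasure P]
    {Y : Ω → ℝ} (hYm : Measurable Y) {p h R : ℝ} (hp1 : 1 ≤ p) (hp2 : p ≤ 2) (hh : 0 ≤ h)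
    (hR : 0 ≤ R) (hY : Integrable Y P) (hY0 : ∫ ω, Y ω ∂P = 0)
    (hYp : Integrable (fun ω => |Y ω| ^ p) P) :
    Integrable (fun ω => Real.exp (h * (if Y ω ≤ R then Y ω else 0))) P ∧
    mgf (fun ω => if Y ω ≤ R then Y ω else 0) P h ≤
      Real.exp (h ^ p * Real.exp (h * R) * ∫ ω, |Y ω| ^ p ∂P) := by
  set Z : Ω → ℝ := fun ω => if Y ω ≤ R then Y ω else 0 with hZ
  have hZm : Measurable Z := Measurable.ite (measurableSet_le hYm measurable_const) hYm
    measurable_const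
  have hZR : ∀ ω, Z ω ≤ R := fun ω => by simp only [hZ]; split_ifs <;> assumption
  have hZY : ∀ ω, Z ω ≤ Y ω := fun ω => by
    simp only [hZ]; split_ifs with h1
    · exact le_rfl
    · exact hR.trans (not_le.1 h1).le
  have hZabs : ∀ ω, |Z ω| ≤ |Y ω| := fun ω => by
    simp only [hZ]; split_ifs
    · exact le_rfl
    · simp
  have hZi : Integrable Z P := hY.mono hZm.aestronglyMeasurable (ae_of_all _ hZabs)
  have hint : Integrable (fun ω => Real.exp (h * Z ω)) P := by
    refine (integrable_const (Real.exp (h * R))).mono' (by fun_prop) (ae_of_all _ fun ω => ?_)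
    rw [Real.norm_of_nonneg (Real.exp_pos _).le]
    exact Real.exp_le_exp.2 (mul_le_mul_of_nonneg_left (hZR ω) hh)
  refine ⟨hint, ?_⟩
  have hpt : ∀ ω, Real.exp (h * Z ω) ≤ 1 + h * Z ω + h ^ p * Real.exp (h * R) * |Y ω| ^ p := by
    intro ω
    have h1 := exp_sub_one_sub_le (u := h * Z ω) hp1 hp2
    have h2 : |h * Z ω| ^ p ≤ h ^ p * |Y ω| ^ p := by
      rw [abs_mul, abs_of_nonneg hh, ← Real.mul_rpow hh (abs_nonneg _)]
      exact Real.rpow_le_rpow (by positivity) (mul_le_mul_of_nonneg_left (hZabs ω) hh)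
        (by linarith)
    have h3 : Real.exp (max (h * Z ω) 0) ≤ Real.exp (h * R) :=
      Real.exp_le_exp.2 (max_le (mul_le_mul_of_nonneg_left (hZR ω) hh) (by positivity))
    have h4 : |h * Z ω| ^ p * Real.exp (max (h * Z ω) 0) ≤
        h ^ p * |Y ω| ^ p * Real.exp (h * R) :=
      mul_le_mul h2 h3 (Real.exp_pos _).le (by positivity)
    linarith
  calc mgf Z P h = ∫ ω, Real.exp (h * Z ω) ∂P := rfl
    _ ≤ ∫ ω, (1 + h * Z ω + h ^ p * Real.exp (h * R) * |Y ω| ^ p) ∂P :=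
        integral_mono hint (((integrable_const 1).add (hZi.const_mul h)).add
          (hYp.const_mul _)) hpt
    _ = 1 + h * ∫ ω, Z ω ∂P + h ^ p * Real.exp (h * R) * ∫ ω, |Y ω| ^ p ∂P := by
        have i1 : Integrable (fun ω => 1 + h * Z ω) P :=
          (integrable_const 1).add (hZi.const_mul h)
        rw [integral_add i1 (hYp.const_mul _),
          integral_add (integrable_const 1) (hZi.const_mul h), integral_const_mul,
          integral_const_mul]
        simp
    _ ≤ 1 + h ^ p * Real.exp (h * R) * ∫ ω, |Y ω| ^ p ∂P := by
        have : ∫ ω, Z ω ∂P ≤ 0 := hY0 ▸ integral_mono hZi hY hZY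
        have := mul_nonpos_of_nonneg_of_nonpos hh this
        linarith
    _ ≤ _ := by
        have := Real.add_one_le_exp (h ^ p * Real.exp (h * R) * ∫ ω, |Y ω| ^ p ∂P)
        linarith

/-- Chernoff bound for sums of centred increments on the event that no increment exceeds `R`. -/
lemma incLaw_sum_ge_le {d : ℕ} {ν : Measure (E d)} [IsProbabilityMeasure ν]
    {Y : E d → ℝ} (hYm : Measurable Y) {p h R : ℝ} (hp1 : 1 ≤ p) (hp2 : p ≤ 2) (hh : 0 ≤ h)
    (hR : 0 ≤ R) (hY : Integrable Y ν) (hY0 : ∫ x, Y x ∂ν = 0)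
    (hYp : Integrable (fun x => |Y x| ^ p) ν) (s : Finset ℕ) (t : ℝ) :
    (incLaw ν).real {x | t ≤ ∑ i ∈ s, Y (x i) ∧ ∀ i ∈ s, Y (x i) ≤ R} ≤
      Real.exp (-h * t + s.card * (h ^ p * Real.exp (h * R) * ∫ x, |Y x| ^ p ∂ν)) := by
  set T : ℝ → ℝ := fun y => if y ≤ R then y else 0 with hT
  have hTm : Measurable T := Measurable.ite (measurableSet_le measurable_id measurable_const)
    measurable_id measurable_const
  have hTY : Measurable fun x => T (Y x) := hTm.comp hYm
  obtain ⟨hint, hmgf⟩ := mgf_truncation_le hYm hp1 hp2 hh hR hY hY0 hYp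
  set Z : ℕ → (ℕ → E d) → ℝ := fun i x => T (Y (x i)) with hZ
  have hZm : ∀ i, Measurable (Z i) := fun i => hTY.comp (measurable_pi_apply i)
  have hind : iIndepFun Z (incLaw ν) := (iIndepFun_eval ν).comp (fun _ x => T (Y x)) fun _ => hTY
  have hexp : Measurable fun x => Real.exp (h * T (Y x)) := by
    exact Real.measurable_exp.comp (hTY.const_mul h)
  have hZint : ∀ i, Integrable (fun x => Real.exp (h * Z i x)) (incLaw ν) := fun i =>
    ((measurePreserving_eval_infinitePi (fun _ : ℕ => ν) i).integrable_comp
      (g := fun x => Real.exp (h * T (Y x))) hexp.aestronglyMeasurable).2 hint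
  have hZmgf : ∀ i, mgf (Z i) (incLaw ν) h = mgf (fun x => T (Y x)) ν h := by
    intro i
    simp only [mgf, hZ]
    have := (measurePreserving_eval_infinitePi (fun _ : ℕ => ν) i).map_eq
    nth_rewrite 2 [← this]
    rw [integral_map (measurable_pi_apply i).aemeasurable hexp.aestronglyMeasurable]
  calc (incLaw ν).real {x | t ≤ ∑ i ∈ s, Y (x i) ∧ ∀ i ∈ s, Y (x i) ≤ R}
      ≤ (incLaw ν).real {x | t ≤ (∑ i ∈ s, Z i) x} := by
        refine measureReal_mono fun x hx => ?_
        obtain ⟨h1, h2⟩ := hx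
        refine h1.trans (le_of_eq ?_)
        rw [Finset.sum_apply]
        refine Finset.sum_congr rfl fun i hi => ?_
        simp only [hZ, hT, if_pos (h2 i hi)]
    _ ≤ Real.exp (-h * t) * mgf (∑ i ∈ s, Z i) (incLaw ν) h :=
        measure_ge_le_exp_mul_mgf t hh (hind.integrable_exp_mul_sum hZm fun i _ => hZint i)
    _ = Real.exp (-h * t) * (mgf (fun x => T (Y x)) ν h) ^ s.card := by
        rw [hind.mgf_sum hZm, Finset.prod_congr rfl fun i _ => hZmgf i, Finset.prod_const]
    _ ≤ Real.exp (-h * t) *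
        (Real.exp (h ^ p * Real.exp (h * R) * ∫ x, |Y x| ^ p ∂ν)) ^ s.card := by
        gcongr
        exact mgf_nonneg
    _ = _ := by
        rw [← Real.exp_nat_mul, ← Real.exp_add]

lemma integrable_norm_rpow {d : ℕ} {ν : Measure (E d)} {p : ℝ}
    (h : ∫⁻ x, ENNReal.ofReal (‖x‖ ^ p) ∂ν < ∞) :
    Integrable (fun x : E d => ‖x‖ ^ p) ν := by
  refine ⟨(measurable_norm.pow_const p).aestronglyMeasurable, ?_⟩
  rw [hasFiniteIntegral_iff_ofReal (ae_of_all _ fun x => Real.rpow_nonneg (norm_nonneg x) p)]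
  exact h

/-- Polynomial decay, of any prescribed order, of the probability that a linear functional of the
centred walk deviates by `ε N` within `N` steps of size at most `κ N`. The exponential rate is
`h = (q / ε) log N / N`. -/
lemma exists_incLaw_inner_ge_le {d : ℕ} {ν : Measure (E d)} [IsProbabilityMeasure ν] {p : ℝ}
    (hp1 : 1 < p) (hp2 : p ≤ 2) (hp : ∫⁻ x, ENNReal.ofReal (‖x‖ ^ p) ∂ν < ∞)
    (hν : Integrable (fun x : E d => x) ν) (hMean : ∫ x, x ∂ν = drift d)
    (w : E d) (hw : ‖w‖ ≤ 1) {ε q : ℝ} (hε : 0 < ε) (hq : 0 < q) :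
    ∃ κ : ℝ, 0 < κ ∧ ∀ᶠ N : ℝ in atTop, ∀ s : Finset ℕ, (s.card : ℝ) ≤ N →
      (incLaw ν).real {x | ε * N ≤ inner ℝ (∑ i ∈ s, (x i - drift d)) w ∧
        ∀ i ∈ s, ‖x i‖ ≤ κ * N} ≤ Real.exp 1 * N ^ (-q) := by
  set Y : E d → ℝ := fun x => inner ℝ (x - drift d) w with hYdef
  have hYm : Measurable Y := by fun_prop
  have hYle : ∀ x, |Y x| ≤ ‖x‖ + ‖drift d‖ := fun x => by
    refine (abs_real_inner_le_norm _ _).trans ?_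
    refine (mul_le_of_le_one_right (norm_nonneg _) hw).trans (norm_sub_le _ _)
  have hY : Integrable Y ν := (hν.sub (integrable_const (drift d))).inner_const w
  have hY0 : ∫ x, Y x ∂ν = 0 := by
    have h1 : ∫ x, Y x ∂ν = inner ℝ w (∫ x, (x - drift d) ∂ν) := by
      have hsub : Integrable (fun x => x - drift d) ν := hν.sub (integrable_const (drift d))
      rw [← integral_inner hsub w]
      exact integral_congr_ae (ae_of_all _ fun x => real_inner_comm _ _)
    rw [h1, integral_sub hν (integrable_const _), hMean]
    simp
  have hYp : Integrable (fun x => |Y x| ^ p) ν := by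
    have h1 : Integrable (fun x : E d => (2 : ℝ) ^ p * (‖x‖ ^ p + ‖drift d‖ ^ p)) ν :=
      ((integrable_norm_rpow hp).add (integrable_const _)).const_mul _
    refine h1.mono' (hYm.abs.pow_const p).aestronglyMeasurable (ae_of_all _ fun x => ?_)
    rw [Real.norm_of_nonneg (Real.rpow_nonneg (abs_nonneg _) _)]
    have h2 : |Y x| ≤ 2 * max ‖x‖ ‖drift d‖ := by
      linarith [hYle x, le_max_left ‖x‖ ‖drift d‖, le_max_right ‖x‖ ‖drift d‖]
    refine (Real.rpow_le_rpow (abs_nonneg _) h2 (by linarith)).trans ?_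
    rw [Real.mul_rpow zero_le_two (le_max_of_le_left (norm_nonneg _))]
    refine mul_le_mul_of_nonneg_left ?_ (by positivity)
    have h3 : 0 ≤ ‖x‖ ^ p := by positivity
    have h4 : 0 ≤ ‖drift d‖ ^ p := by positivity
    rcases max_cases ‖x‖ ‖drift d‖ with h | h <;> rw [h.1] <;> linarith
  set m := ∫ x, |Y x| ^ p ∂ν with hm
  have hm0 : 0 ≤ m := integral_nonneg fun x => Real.rpow_nonneg (abs_nonneg _) _
  set c := q / ε with hc
  have hc0 : 0 < c := by positivity
  set κ := (p - 1) / (4 * c) with hκ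
  have hκ0 : 0 < κ := by have : 0 < p - 1 := by linarith
                         positivity
  refine ⟨κ, hκ0, ?_⟩
  -- the exponent is bounded because `(log N) ^ p` is negligible with respect to powers of `N`
  have hlim : Tendsto (fun N : ℝ => m * c ^ p * (Real.log N ^ p / N ^ ((p - 1) / 2))) atTop
      (𝓝 0) := by
    have h1 := (isLittleO_log_rpow_rpow_atTop p
      (show 0 < (p - 1) / 2 by linarith)).tendsto_div_nhds_zero
    simpa using h1.const_mul (m * c ^ p)
  filter_upwards [hlim.eventually (gt_mem_nhds zero_lt_one), eventually_gt_atTop 1,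
    eventually_ge_atTop (‖drift d‖ / κ)] with N hN1 hN2 hN3 s hs
  have hN0 : 0 < N := by linarith
  have hlog : 0 < Real.log N := Real.log_pos hN2
  set h := c * Real.log N / N with hh
  have hh0 : 0 ≤ h := by positivity
  have hb := incLaw_sum_ge_le hYm hp1.le hp2 hh0 (show 0 ≤ 2 * κ * N by positivity) hY hY0 hYp s
    (ε * N)
  have hexp : s.card * (h ^ p * Real.exp (h * (2 * κ * N)) * m) ≤ 1 := by
    have e1 : h * (2 * κ * N) = Real.log N * ((p - 1) / 2) := by
      rw [hh, hκ]; field_simp; ring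
    have e2 : Real.exp (h * (2 * κ * N)) = N ^ ((p - 1) / 2) := by
      rw [e1, ← Real.rpow_def_of_pos hN0]
    have e3 : h ^ p = c ^ p * Real.log N ^ p * (N ^ p)⁻¹ := by
      rw [hh, Real.div_rpow (by positivity) hN0.le, Real.mul_rpow hc0.le hlog.le, div_eq_mul_inv]
    have e4 : N * ((N ^ p)⁻¹ * N ^ ((p - 1) / 2)) = (N ^ ((p - 1) / 2))⁻¹ := by
      rw [← Real.rpow_neg hN0.le, ← Real.rpow_neg hN0.le, ← Real.rpow_add hN0]
      nth_rewrite 1 [← Real.rpow_one N]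
      rw [← Real.rpow_add hN0]
      ring_nf
    calc s.card * (h ^ p * Real.exp (h * (2 * κ * N)) * m)
        ≤ N * (h ^ p * Real.exp (h * (2 * κ * N)) * m) := by gcongr
      _ = m * c ^ p * Real.log N ^ p * (N * ((N ^ p)⁻¹ * N ^ ((p - 1) / 2))) := by
          rw [e2, e3]; ring
      _ = m * c ^ p * (Real.log N ^ p / N ^ ((p - 1) / 2)) := by rw [e4]; ring
      _ ≤ 1 := hN1.le
  calc (incLaw ν).real {x | ε * N ≤ inner ℝ (∑ i ∈ s, (x i - drift d)) w ∧
        ∀ i ∈ s, ‖x i‖ ≤ κ * N}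
      ≤ (incLaw ν).real {x | ε * N ≤ ∑ i ∈ s, Y (x i) ∧ ∀ i ∈ s, Y (x i) ≤ 2 * κ * N} := by
        refine measureReal_mono fun x hx => ⟨?_, fun i hi => ?_⟩
        · have := hx.1
          rwa [sum_inner] at this
        · have h1 := (le_abs_self _).trans (hYle (x i))
          have h2 := hx.2 i hi
          have h3 := (div_le_iff₀ hκ0).1 hN3
          linarith
    _ ≤ _ := hb
    _ ≤ Real.exp (-h * (ε * N) + 1) := Real.exp_le_exp.2 (by linarith)
    _ = Real.exp 1 * N ^ (-q) := by
        have e1 : -h * (ε * N) = Real.log N * (-q) := by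
          rw [hh, hc]; field_simp
        rw [Real.exp_add, e1, ← Real.rpow_def_of_pos hN0, mul_comm]

/-- A vector of large norm has a large component along some `±e_k`; the denominator `d + 1` avoids
the case distinction `d = 0`. -/
lemma exists_coord_of_lt_norm {d : ℕ} {y : E d} {r : ℝ} (hr : 0 ≤ r) (hy : r < ‖y‖) :
    ∃ k : Fin d, ∃ σ : ℝ, |σ| = 1 ∧ r / (d + 1) ≤ inner ℝ y (σ • EuclideanSpace.single k 1) := by
  by_contra! hcon
  have hk : ∀ k, |y k| ≤ r / (d + 1) := by
    intro k
    refine abs_le'.2 ⟨?_, ?_⟩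
    · have := hcon k 1 (by simp)
      simp [EuclideanSpace.inner_single_right] at this
      exact this.le
    · have := hcon k (-1) (by simp)
      simp [EuclideanSpace.inner_single_right] at this
      exact this.le
  have h1 : ‖y‖ ≤ ∑ k, |y k| := by
    have : y = ∑ k, EuclideanSpace.single k (y k) := by
      ext i
      simp [Finset.sum_apply, Pi.single_apply]
    calc ‖y‖ = ‖∑ k, EuclideanSpace.single k (y k)‖ := by rw [← this]
      _ ≤ ∑ k, ‖(EuclideanSpace.single k (y k) : E d)‖ := norm_sum_le _ _
      _ = ∑ k, |y k| := by simp
  have h2 : ∑ k : Fin d, |y k| ≤ d * (r / (d + 1)) := by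
    refine (Finset.sum_le_card_nsmul _ _ _ fun k _ => hk k).trans ?_
    simp
  have h3 : d * (r / (d + 1)) ≤ r := by
    rw [mul_div_assoc', div_le_iff₀ (by positivity)]
    nlinarith
  linarith

/-- Polynomial decay of the probability that the centred walk deviates in norm by `ε N` within `N`
steps of size at most `κ N`. -/
lemma exists_incLaw_norm_gt_le {d : ℕ} {ν : Measure (E d)} [IsProbabilityMeasure ν] {p : ℝ}
    (hp1 : 1 < p) (hp2 : p ≤ 2) (hp : ∫⁻ x, ENNReal.ofReal (‖x‖ ^ p) ∂ν < ∞)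
    (hν : Integrable (fun x : E d => x) ν) (hMean : ∫ x, x ∂ν = drift d)
    {ε q : ℝ} (hε : 0 < ε) (hq : 0 < q) :
    ∃ κ C : ℝ, 0 < κ ∧ 0 < C ∧ ∀ᶠ N : ℝ in atTop, ∀ s : Finset ℕ, (s.card : ℝ) ≤ N →
      (incLaw ν).real {x | ε * N < ‖∑ i ∈ s, (x i - drift d)‖ ∧ ∀ i ∈ s, ‖x i‖ ≤ κ * N} ≤
        C * N ^ (-q) := by
  have hε' : 0 < ε / (d + 1) := by positivity
  have hw : ∀ (k : Fin d) (σ : ℝ), |σ| = 1 → ‖σ • (EuclideanSpace.single k 1 : E d)‖ ≤ 1 := by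
    intro k σ hσ
    rw [norm_smul, Real.norm_eq_abs, hσ]
    simp
  have hchoose : ∀ k : Fin d, ∃ κ : ℝ, 0 < κ ∧ ∀ σ : ℝ, |σ| = 1 → ∀ᶠ N : ℝ in atTop,
      ∀ s : Finset ℕ, (s.card : ℝ) ≤ N →
      (incLaw ν).real {x | ε / (d + 1) * N ≤ inner ℝ (∑ i ∈ s, (x i - drift d))
        (σ • EuclideanSpace.single k 1) ∧ ∀ i ∈ s, ‖x i‖ ≤ κ * N} ≤ Real.exp 1 * N ^ (-q) := by
    intro k
    obtain ⟨κ₁, h1, h1'⟩ := exists_incLaw_inner_ge_le hp1 hp2 hp hν hMean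
      ((1 : ℝ) • (EuclideanSpace.single k 1 : E d)) (hw k 1 (by simp)) hε' hq
    obtain ⟨κ₂, h2, h2'⟩ := exists_incLaw_inner_ge_le hp1 hp2 hp hν hMean
      ((-1 : ℝ) • (EuclideanSpace.single k 1 : E d)) (hw k (-1) (by simp)) hε' hq
    refine ⟨min κ₁ κ₂, lt_min h1 h2, fun σ hσ => ?_⟩
    rcases eq_or_eq_neg_of_abs_eq hσ with rfl | rfl
    · filter_upwards [h1', eventually_ge_atTop 0] with N hN hN0 s hs
      refine le_trans (measureReal_mono fun x (hx : _ ∧ _) => And.intro hx.1 fun i hi =>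
        (hx.2 i hi).trans (mul_le_mul_of_nonneg_right (min_le_left _ _) hN0)) (hN s hs)
    · filter_upwards [h2', eventually_ge_atTop 0] with N hN hN0 s hs
      refine le_trans (measureReal_mono fun x (hx : _ ∧ _) => And.intro hx.1 fun i hi =>
        (hx.2 i hi).trans (mul_le_mul_of_nonneg_right (min_le_right _ _) hN0)) (hN s hs)
  choose κ hκ hκ' using hchoose
  obtain ⟨κ₀, hκ₀, hκ₀'⟩ : ∃ κ₀ > 0, ∀ k, κ₀ ≤ κ k := by
    have : ∀ᶠ z in 𝓝[>] (0 : ℝ), ∀ k, z ≤ κ k := by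
      refine eventually_all.2 fun k => ?_
      filter_upwards [mem_nhdsWithin_of_mem_nhds (Iio_mem_nhds (hκ k))] with z hz using hz.le
    obtain ⟨z, hz1, hz2⟩ := (this.and self_mem_nhdsWithin).exists
    exact ⟨z, hz2, hz1⟩
  refine ⟨κ₀, 2 * d * Real.exp 1 + 1, hκ₀, by positivity, ?_⟩
  have hall : ∀ᶠ N : ℝ in atTop, ∀ k, ∀ b : Bool, ∀ s : Finset ℕ, (s.card : ℝ) ≤ N →
      (incLaw ν).real {x | ε / (d + 1) * N ≤ inner ℝ (∑ i ∈ s, (x i - drift d))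
        ((if b then 1 else -1 : ℝ) • EuclideanSpace.single k 1) ∧ ∀ i ∈ s, ‖x i‖ ≤ κ k * N} ≤
          Real.exp 1 * N ^ (-q) :=
    eventually_all.2 fun k => eventually_all.2 fun b => hκ' k _ (by cases b <;> simp)
  filter_upwards [hall, eventually_gt_atTop 0] with N hN hN0 s hs
  have hsub : {x : ℕ → E d | ε * N < ‖∑ i ∈ s, (x i - drift d)‖ ∧ ∀ i ∈ s, ‖x i‖ ≤ κ₀ * N} ⊆
      ⋃ z : Fin d × Bool, {x | ε / (d + 1) * N ≤ inner ℝ (∑ i ∈ s, (x i - drift d))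
        ((if z.2 then 1 else -1 : ℝ) • EuclideanSpace.single z.1 1) ∧
          ∀ i ∈ s, ‖x i‖ ≤ κ z.1 * N} := by
    intro x hx
    obtain ⟨k, σ, hσ, hk⟩ := exists_coord_of_lt_norm (by positivity) hx.1
    rw [mul_div_right_comm] at hk
    have hκx : ∀ i ∈ s, ‖x i‖ ≤ κ k * N := fun i hi =>
      (hx.2 i hi).trans (mul_le_mul_of_nonneg_right (hκ₀' k) hN0.le)
    rcases eq_or_eq_neg_of_abs_eq hσ with rfl | rfl
    · exact mem_iUnion.2 ⟨(k, true), by simpa using hk, hκx⟩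
    · exact mem_iUnion.2 ⟨(k, false), by simpa using hk, hκx⟩
  have hN0' : 0 ≤ N ^ (-q) := Real.rpow_nonneg hN0.le _
  calc (incLaw ν).real _ ≤ (incLaw ν).real _ := measureReal_mono hsub
    _ ≤ ∑ z : Fin d × Bool, (incLaw ν).real {x | ε / (d + 1) * N ≤
        inner ℝ (∑ i ∈ s, (x i - drift d)) ((if z.2 then 1 else -1 : ℝ) •
          EuclideanSpace.single z.1 1) ∧ ∀ i ∈ s, ‖x i‖ ≤ κ z.1 * N} :=
        measureReal_iUnion_fintype_le _
    _ ≤ ∑ z : Fin d × Bool, Real.exp 1 * N ^ (-q) :=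
        Finset.sum_le_sum fun z _ => hN z.1 z.2 s hs
    _ = 2 * d * Real.exp 1 * N ^ (-q) := by
        simp [Fintype.card_prod]; ring
    _ ≤ (2 * d * Real.exp 1 + 1) * N ^ (-q) := by linarith

/-- The event that, after the removal of at most one increment, the centred walk deviates by more
than `ε (b + n)` at some time `n` although none of the remaining increments is large. -/
def deviation {d : ℕ} (ε κ b : ℝ) : Set (ℕ → E d) :=
  {x | ∃ n : ℕ, ∃ k ≤ n, (∀ i ∈ (Finset.range n).erase k, ‖x i‖ ≤ κ * (b + i)) ∧
    ε * (b + n) < ‖∑ i ∈ (Finset.range n).erase k, (x i - drift d)‖}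

/-- Deviations without large increments are negligible: their probability decays faster than the
power of `b` that bounds the tail from below. -/
lemma exists_incLaw_deviation_le {d : ℕ} {ν : Measure (E d)} [IsProbabilityMeasure ν] {α : ℝ}
    (h : HasRegularTail ν α) (hα : 1 < α)
    (hν : Integrable (fun x : E d => x) ν) (hMean : ∫ x, x ∂ν = drift d) {ε : ℝ} (hε : 0 < ε) :
    ∃ κ₀ : ℝ, 0 < κ₀ ∧ ∀ κ, 0 < κ → κ ≤ κ₀ → ∀ t, 0 < t → ∀ᶠ b in atTop,
      (incLaw ν).real (deviation ε κ b) ≤ t * (b * tail ν b) := by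
  obtain ⟨p, hp1, hp2, hp⟩ := h.exists_moment hα
  obtain ⟨q₀, hq₀, hq⟩ := h.exists_rpow_le hα
  obtain ⟨κ₀, C, hκ₀, hC, hev⟩ := exists_incLaw_norm_gt_le hp1 hp2 hp hν hMean hε
    (show 0 < q₀ + 3 by linarith)
  refine ⟨κ₀, hκ₀, fun κ hκ hκκ t ht => ?_⟩
  have hsum : Summable fun n : ℕ => ((n : ℝ) + 1) ^ (-2 : ℝ) := by
    have := (summable_nat_add_iff 1).2 (Real.summable_nat_rpow.2 (show (-2 : ℝ) < -1 by norm_num))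
    simpa using this
  set τ := ∑' n : ℕ, ((n : ℝ) + 1) ^ (-2 : ℝ) with hτ
  have hτ0 : 0 ≤ τ := tsum_nonneg fun n => by positivity
  obtain ⟨N₀, hN₀⟩ := eventually_atTop.1 hev
  filter_upwards [eventually_ge_atTop N₀, eventually_ge_atTop 1, hq,
    eventually_ge_atTop (C * τ / t)] with b hb hb1 hbq hbt
  have hb0 : 0 < b := by linarith
  set D : ℕ → ℕ → Set (ℕ → E d) := fun n k =>
    {x | ε * (b + n) < ‖∑ i ∈ (Finset.range n).erase k, (x i - drift d)‖ ∧
      ∀ i ∈ (Finset.range n).erase k, ‖x i‖ ≤ κ₀ * (b + n)} with hD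
  have hsub : deviation ε κ b ⊆ ⋃ n : ℕ, ⋃ k ∈ Finset.range (n + 1), D n k := by
    rintro x ⟨n, k, hk, h1, h2⟩
    refine mem_iUnion.2 ⟨n, mem_iUnion₂.2 ⟨k, Finset.mem_range.2 (by omega), h2, fun i hi => ?_⟩⟩
    have hin : (i : ℝ) ≤ n := by
      exact_mod_cast (Finset.mem_range.1 (Finset.mem_of_mem_erase hi)).le
    calc ‖x i‖ ≤ κ * (b + i) := h1 i hi
      _ ≤ κ₀ * (b + n) := by gcongr
  have hDle : ∀ n k, incLaw ν (D n k) ≤ ENNReal.ofReal (C * (b + n) ^ (-(q₀ + 3))) := by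
    intro n k
    have := hN₀ (b + n) (by have := Nat.cast_nonneg (α := ℝ) n; linarith)
      ((Finset.range n).erase k) (by
        have h1 : ((Finset.range n).erase k).card ≤ n :=
          (Finset.card_erase_le).trans (Finset.card_range n).le
        have h2 : (((Finset.range n).erase k).card : ℝ) ≤ n := by exact_mod_cast h1
        linarith)
    rw [← ofReal_measureReal]
    exact ENNReal.ofReal_le_ofReal this
  have hpt : ∀ n : ℕ, ((n : ℝ) + 1) * (C * (b + n) ^ (-(q₀ + 3))) ≤
      C * b ^ (-q₀) * ((n : ℝ) + 1) ^ (-2 : ℝ) := by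
    intro n
    have hbn : 0 < b + n := by positivity
    have e : (b + n) ^ (-(q₀ + 3)) = (b + n) ^ (-q₀) * (b + n) ^ (-2 : ℝ) * (b + n)⁻¹ := by
      rw [← Real.rpow_neg_one, ← Real.rpow_add hbn, ← Real.rpow_add hbn]; ring_nf
    have h1 : (b + n) ^ (-q₀) ≤ b ^ (-q₀) :=
      Real.rpow_le_rpow_of_nonpos hb0 (by simp) (by linarith)
    have h2 : (b + n) ^ (-2 : ℝ) ≤ ((n : ℝ) + 1) ^ (-2 : ℝ) :=
      Real.rpow_le_rpow_of_nonpos (by positivity) (by linarith) (by norm_num)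
    have h3 : ((n : ℝ) + 1) * (b + n)⁻¹ ≤ 1 := by
      rw [← div_eq_mul_inv, div_le_one hbn]; linarith
    calc ((n : ℝ) + 1) * (C * (b + n) ^ (-(q₀ + 3)))
        = C * ((b + n) ^ (-q₀) * (b + n) ^ (-2 : ℝ)) * (((n : ℝ) + 1) * (b + n)⁻¹) := by
          rw [e]; ring
      _ ≤ C * (b ^ (-q₀) * ((n : ℝ) + 1) ^ (-2 : ℝ)) * 1 := by gcongr
      _ = _ := by ring
  have hmain : incLaw ν (deviation ε κ b) ≤ ENNReal.ofReal (C * b ^ (-q₀) * τ) := by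
    calc incLaw ν (deviation ε κ b) ≤ incLaw ν (⋃ n : ℕ, ⋃ k ∈ Finset.range (n + 1), D n k) :=
          measure_mono hsub
      _ ≤ ∑' n : ℕ, incLaw ν (⋃ k ∈ Finset.range (n + 1), D n k) := measure_iUnion_le _
      _ ≤ ∑' n : ℕ, ENNReal.ofReal (C * b ^ (-q₀) * ((n : ℝ) + 1) ^ (-2 : ℝ)) := by
          refine ENNReal.tsum_le_tsum fun n => ?_
          refine (measure_biUnion_finset_le _ _).trans ?_
          refine (Finset.sum_le_sum fun k _ => hDle n k).trans ?_
          rw [Finset.sum_const, Finset.card_range, nsmul_eq_mul, ← ENNReal.ofReal_natCast,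
            ← ENNReal.ofReal_mul (by positivity)]
          refine ENNReal.ofReal_le_ofReal ?_
          push_cast
          exact hpt n
      _ = ENNReal.ofReal (C * b ^ (-q₀) * τ) := by
          rw [← ENNReal.ofReal_tsum_of_nonneg (fun n => by positivity) (hsum.mul_left _),
            tsum_mul_left]
  have h1 : (incLaw ν).real (deviation ε κ b) ≤ C * b ^ (-q₀) * τ :=
    ENNReal.toReal_le_of_le_ofReal (by positivity) hmain
  refine h1.trans ?_
  rw [div_le_iff₀ ht] at hbt
  calc C * b ^ (-q₀) * τ = C * τ * b ^ (-q₀) := by ring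
    _ ≤ b * t * tail ν b := mul_le_mul hbt hbq (by positivity) (by positivity)
    _ = t * (b * tail ν b) := by ring

/-! ### Counting jumps -/

/-- A real interval of length `w - u` contains at most `w - u + 1` natural numbers. -/
lemma tsum_indicator_one_le {s : Set ℕ} {u w : ℝ} (hs : ∀ i ∈ s, u ≤ i ∧ (i : ℝ) ≤ w) :
    ∑' i, s.indicator (1 : ℕ → ℝ≥0∞) i ≤ ENNReal.ofReal (w - u + 1) := by
  classical
  rcases s.eq_empty_or_nonempty with rfl | ⟨i₀, hi₀⟩
  · simp
  have hw : 0 ≤ w := (Nat.cast_nonneg i₀).trans (hs i₀ hi₀).2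
  have hsub : s ⊆ (Finset.Icc ⌈u⌉₊ ⌊w⌋₊ : Finset ℕ) := fun i hi => by
    rw [Finset.coe_Icc]
    exact ⟨Nat.ceil_le.2 (hs i hi).1, Nat.le_floor (hs i hi).2⟩
  have hle : ⌈u⌉₊ ≤ ⌊w⌋₊ := by
    have := Finset.mem_Icc.1 (hsub hi₀)
    exact this.1.trans this.2
  calc ∑' i, s.indicator (1 : ℕ → ℝ≥0∞) i
      ≤ ∑' i, ((Finset.Icc ⌈u⌉₊ ⌊w⌋₊ : Finset ℕ) : Set ℕ).indicator (1 : ℕ → ℝ≥0∞) i := by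
        refine ENNReal.tsum_le_tsum fun i => indicator_le_indicator_of_subset ?_ (by simp) i
        exact hsub
    _ = ((Finset.Icc ⌈u⌉₊ ⌊w⌋₊).card : ℝ≥0∞) := by
        rw [tsum_eq_sum (s := Finset.Icc ⌈u⌉₊ ⌊w⌋₊)]
        · rw [Finset.sum_congr rfl fun i hi => indicator_of_mem (Finset.mem_coe.2 hi) _]
          simp
        · intro i hi
          exact indicator_of_notMem (by simpa using hi) _
    _ ≤ ENNReal.ofReal (w - u + 1) := by
        rw [Nat.card_Icc, ← ENNReal.ofReal_natCast]
        refine ENNReal.ofReal_le_ofReal ?_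
        rw [Nat.cast_sub (by omega)]
        have h1 := Nat.floor_le hw
        have h2 := Nat.le_ceil u
        push_cast
        linarith

/-- Expected number of integers in a window around a random level. -/
lemma tsum_measure_window_le {d : ℕ} {ν : Measure (E d)} {Z : E d → ℝ} (hZ : Measurable Z)
    (u w : ℝ) :
    ∑' i : ℕ, ν {x | Z x - u ≤ i ∧ (i : ℝ) ≤ Z x + w} ≤
      ENNReal.ofReal (u + w + 1) * ν {x | -w ≤ Z x} := by
  have hm : ∀ i : ℕ, MeasurableSet {x | Z x - u ≤ i ∧ (i : ℝ) ≤ Z x + w} := fun i => by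
    have h1 : MeasurableSet {x | Z x - u ≤ i} := measurableSet_le (by fun_prop) measurable_const
    have h2 : MeasurableSet {x | (i : ℝ) ≤ Z x + w} :=
      measurableSet_le measurable_const (by fun_prop)
    exact h1.inter h2
  have hm2 : MeasurableSet {x | -w ≤ Z x} := measurableSet_le measurable_const hZ
  simp_rw [← lintegral_indicator_one (hm _)]
  rw [← lintegral_tsum fun i => (measurable_one.indicator (hm i)).aemeasurable,
    ← lintegral_indicator_const hm2]
  refine lintegral_mono fun x => ?_
  have h1 := tsum_indicator_one_le (s := {i : ℕ | Z x - u ≤ i ∧ (i : ℝ) ≤ Z x + w})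
    (u := Z x - u) (w := Z x + w) fun i hi => hi
  by_cases hx : x ∈ {x | -w ≤ Z x}
  · rw [indicator_of_mem hx]
    refine h1.trans (le_of_eq ?_)
    congr 1; ring
  · rw [indicator_of_notMem hx]
    refine le_of_eq (ENNReal.tsum_eq_zero.2 fun i => indicator_of_notMem (fun hi => hx ?_) _)
    have h2 : (0 : ℝ) ≤ i := Nat.cast_nonneg i
    have h3 : (i : ℝ) ≤ Z x + w := hi.2
    show -w ≤ Z x
    linarith

/-- Expected number of jumps above the growing level `c₀ (b + i)` after time `M b`. -/
lemma tsum_measure_jump_le {d : ℕ} {ν : Measure (E d)} [IsProbabilityMeasure ν]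
    (hν : Integrable (fun x : E d => x) ν) {c₀ M b : ℝ} (hc₀ : 0 < c₀) (hb : 0 < b) :
    ∑' i : ℕ, ν {x | M * b ≤ i ∧ c₀ * (b + i) < ‖x‖} ≤
      ENNReal.ofReal (tail ν (c₀ * (1 + M) * b) + tailMean ν (c₀ * (1 + M) * b) / c₀) := by
  set l := c₀ * (1 + M) * b with hl
  have hm : ∀ i : ℕ, MeasurableSet {x : E d | M * b ≤ i ∧ c₀ * (b + i) < ‖x‖} := fun i =>
    (MeasurableSet.const _).inter (measurableSet_lt measurable_const measurable_norm)
  have hm2 : MeasurableSet {x : E d | l < ‖x‖} := measurableSet_lt measurable_const measurable_norm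
  simp_rw [← lintegral_indicator_one (hm _)]
  rw [← lintegral_tsum fun i => (measurable_one.indicator (hm i)).aemeasurable]
  have hpt : ∀ x : E d, ∑' i : ℕ, {x : E d | M * b ≤ i ∧ c₀ * (b + i) < ‖x‖}.indicator
      (1 : E d → ℝ≥0∞) x ≤ {x : E d | l < ‖x‖}.indicator
        (fun x => ENNReal.ofReal (1 + ‖x‖ / c₀)) x := by
    intro x
    have h1 := tsum_indicator_one_le (s := {i : ℕ | M * b ≤ i ∧ c₀ * (b + i) < ‖x‖})
      (u := 0) (w := ‖x‖ / c₀) fun i hi => ⟨Nat.cast_nonneg i, by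
        rw [le_div_iff₀ hc₀]
        have h2 : c₀ * (b + i) < ‖x‖ := hi.2
        nlinarith⟩
    by_cases hx : x ∈ {x : E d | l < ‖x‖}
    · rw [indicator_of_mem hx]
      refine h1.trans (le_of_eq ?_)
      congr 1; ring
    · rw [indicator_of_notMem hx]
      refine le_of_eq (ENNReal.tsum_eq_zero.2 fun i => indicator_of_notMem (fun hi => hx ?_) _)
      obtain ⟨h2, h3⟩ : M * b ≤ i ∧ c₀ * (b + i) < ‖x‖ := hi
      show l < ‖x‖
      have : c₀ * (M * b) ≤ c₀ * i := mul_le_mul_of_nonneg_left h2 hc₀.le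
      rw [hl]; linarith
  refine (lintegral_mono hpt).trans ?_
  rw [lintegral_indicator hm2, ← ofReal_integral_eq_lintegral_ofReal]
  · refine ENNReal.ofReal_le_ofReal (le_of_eq ?_)
    rw [integral_add (integrable_const 1) (hν.norm.div_const c₀).integrableOn, integral_div]
    simp [tail, tailMean]
  · exact (integrable_const 1).add (hν.norm.div_const c₀).integrableOn
  · exact ae_of_all _ fun x => by positivity

lemma tail_le_tailMean_div {d : ℕ} {ν : Measure (E d)} [IsProbabilityMeasure ν]
    (hν : Integrable (fun x : E d => x) ν) {l : ℝ} (hl : 0 < l) : tail ν l ≤ tailMean ν l / l := by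
  rw [le_div_iff₀ hl]
  have hm2 : MeasurableSet {x : E d | l < ‖x‖} := measurableSet_lt measurable_const measurable_norm
  calc tail ν l * l = ∫ x in {x : E d | l < ‖x‖}, l ∂ν := by simp [tail]
    _ ≤ tailMean ν l := setIntegral_mono_on (integrableOn_const (measure_ne_top _ _))
        hν.norm.integrableOn hm2 fun x hx => le_of_lt hx

/-! ### Negligible and small events -/

/-- The event that two increments are large. -/
def twoJumps {d : ℕ} (κ b : ℝ) : Set (ℕ → E d) :=
  {x | ∃ i k, i ≠ k ∧ κ * (b + i) < ‖x i‖ ∧ κ * (b + k) < ‖x k‖}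

/-- The event that some increment after time `M b` is large. -/
def lateJump {d : ℕ} (c₀ M b : ℝ) : Set (ℕ → E d) :=
  {x | ∃ i : ℕ, M * b ≤ i ∧ c₀ * (b + i) < ‖x i‖}

/-- The event that some increment nearly reaches the boundary of the target, seen from the mean
path. -/
def nearBoundary {d : ℕ} {ι : Type} (v : ι → E d) (c : ι → ℝ) (ω b : ℝ) : Set (ℕ → E d) :=
  {x | ∃ i : ℕ, excess v c b (x i) - ω * b ≤ i ∧ (i : ℝ) ≤ excess v c b (x i) + ω * b}

lemma measurableSet_jump {d : ℕ} (r : ℝ) : MeasurableSet {x : E d | r < ‖x‖} :=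
  measurableSet_lt measurable_const measurable_norm

/-- The expected number of large increments is of the order `b * tail ν b`. -/
lemma HasRegularTail.exists_tsum_jump_le {d : ℕ} {ν : Measure (E d)} [IsProbabilityMeasure ν]
    {α : ℝ} (h : HasRegularTail ν α) (hα : 1 < α) (hν : Integrable (fun x : E d => x) ν)
    {κ : ℝ} (hκ : 0 < κ) :
    ∃ C : ℝ, 0 < C ∧ ∀ᶠ b in atTop,
      ∑' i : ℕ, ν {x | κ * (b + i) < ‖x‖} ≤ ENNReal.ofReal (C * (b * tail ν b)) := by
  obtain ⟨C, hC, hev⟩ := h.exists_tailMean_mul_le hα hκ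
  refine ⟨C / κ + C / κ, by positivity, ?_⟩
  filter_upwards [hev, eventually_ge_atTop 1] with b h1 hb
  have hb0 : 0 < b := by linarith
  have h2 := tsum_measure_jump_le (M := 0) hν hκ hb0
  have e : ∀ i : ℕ, ((0 : ℝ) * b ≤ i) := fun i => by simp
  simp only [e, true_and, add_zero, mul_one] at h2
  refine h2.trans (ENNReal.ofReal_le_ofReal ?_)
  have h3 : tailMean ν (κ * b) / κ ≤ C / κ * (b * tail ν b) := by
    rw [div_mul_eq_mul_div]; gcongr
  have h4 : tail ν (κ * b) ≤ tailMean ν (κ * b) / κ := by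
    refine (tail_le_tailMean_div hν (by positivity)).trans ?_
    have : 0 ≤ tailMean ν (κ * b) := integral_nonneg fun x => norm_nonneg x
    gcongr
    exact le_mul_of_one_le_right hκ.le hb
  linarith

lemma exists_incLaw_twoJumps_le {d : ℕ} {ν : Measure (E d)} [IsProbabilityMeasure ν]
    {α : ℝ} (h : HasRegularTail ν α) (hα : 1 < α) (hν : Integrable (fun x : E d => x) ν)
    {κ : ℝ} (hκ : 0 < κ) :
    ∃ C : ℝ, 0 < C ∧ ∀ᶠ b in atTop, (incLaw ν).real (twoJumps κ b) ≤ C * (b * tail ν b) ^ 2 := by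
  obtain ⟨C, hC, hev⟩ := h.exists_tsum_jump_le hα hν hκ
  refine ⟨C ^ 2, by positivity, ?_⟩
  filter_upwards [hev, eventually_ge_atTop 0] with b hb hb0
  have hR : 0 ≤ b * tail ν b := mul_nonneg hb0 (h.pos b).le
  rw [← mul_pow]
  refine ENNReal.toReal_le_of_le_ofReal (by positivity) ?_
  have hsub : twoJumps κ b ⊆ ⋃ i : ℕ, ⋃ k : ℕ,
      {x : ℕ → E d | i ≠ k ∧ κ * (b + i) < ‖x i‖ ∧ κ * (b + k) < ‖x k‖} := by
    rintro x ⟨i, k, hx⟩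
    exact mem_iUnion₂.2 ⟨i, k, hx⟩
  have hpair : ∀ i k : ℕ, incLaw ν
      {x : ℕ → E d | i ≠ k ∧ κ * (b + i) < ‖x i‖ ∧ κ * (b + k) < ‖x k‖} ≤
      ν {x | κ * (b + i) < ‖x‖} * ν {x | κ * (b + k) < ‖x‖} := by
    intro i k
    by_cases hik : i = k
    · simp [hik]
    · have h1 := (iIndepFun_eval ν).indepFun hik
      have h2 := h1.measure_inter_preimage_eq_mul _ _ (measurableSet_jump (κ * (b + i)))
        (measurableSet_jump (κ * (b + k)))
      have e1 := incLaw_eval_preimage ν i (measurableSet_jump (κ * (b + i)))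
      have e2 := incLaw_eval_preimage ν k (measurableSet_jump (κ * (b + k)))
      rw [← e1, ← e2]
      refine le_trans (measure_mono fun x hx => ?_) h2.le
      exact hx.2
  calc incLaw ν (twoJumps κ b) ≤ _ := measure_mono hsub
    _ ≤ ∑' i : ℕ, ∑' k : ℕ, ν {x | κ * (b + i) < ‖x‖} * ν {x | κ * (b + k) < ‖x‖} := by
        refine (measure_iUnion_le _).trans (ENNReal.tsum_le_tsum fun i => ?_)
        exact (measure_iUnion_le _).trans (ENNReal.tsum_le_tsum fun k => hpair i k)
    _ = (∑' i : ℕ, ν {x | κ * (b + i) < ‖x‖}) * ∑' k : ℕ, ν {x | κ * (b + k) < ‖x‖} := by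
        simp_rw [ENNReal.tsum_mul_left, ENNReal.tsum_mul_right]
    _ ≤ ENNReal.ofReal (C * (b * tail ν b)) * ENNReal.ofReal (C * (b * tail ν b)) :=
        mul_le_mul' hb hb
    _ = ENNReal.ofReal ((C * (b * tail ν b)) ^ 2) := by
        rw [← ENNReal.ofReal_mul (by positivity), sq]

/-- `P(‖X‖ > b) = o(1 / b)`, since the norm is integrable. -/
lemma HasRegularTail.tendsto_mul_tail {d : ℕ} {ν : Measure (E d)} [IsProbabilityMeasure ν]
    {α : ℝ} (h : HasRegularTail ν α) (hν : Integrable (fun x : E d => x) ν) :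
    Tendsto (fun b => b * tail ν b) atTop (𝓝 0) := by
  have h1 : Tendsto (fun b : ℝ => tailMean ν b) atTop (𝓝 0) := by
    have h2 : Tendsto (fun b : ℝ => ∫ x, {x : E d | b < ‖x‖}.indicator (fun x => ‖x‖) x ∂ν) atTop
        (𝓝 (∫ x : E d, (0 : ℝ) ∂ν)) := by
      refine tendsto_integral_filter_of_dominated_convergence (fun x => ‖x‖)
        (Eventually.of_forall fun b => (measurable_norm.indicator
          (measurableSet_jump b)).aestronglyMeasurable)
        (Eventually.of_forall fun b => ae_of_all _ fun x => ?_) hν.norm (ae_of_all _ fun x => ?_)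
      · by_cases hx : x ∈ {x : E d | b < ‖x‖}
        · simp only [indicator_of_mem hx, norm_norm, le_refl]
        · simp only [indicator_of_notMem hx, norm_zero, norm_nonneg]
      · refine tendsto_const_nhds.congr' ?_
        filter_upwards [eventually_ge_atTop ‖x‖] with b hb
        have hx : x ∉ {x : E d | b < ‖x‖} := not_lt.2 hb
        rw [indicator_of_notMem hx]
    simp only [integral_zero] at h2
    refine h2.congr fun b => ?_
    rw [integral_indicator (measurableSet_jump b), tailMean]
  refine tendsto_of_tendsto_of_tendsto_of_le_of_le' tendsto_const_nhds h1 ?_ ?_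
  · filter_upwards [eventually_ge_atTop 0] with b hb using mul_nonneg hb (h.pos b).le
  · filter_upwards [eventually_gt_atTop 0] with b hb
    have := tail_le_tailMean_div hν hb
    rw [le_div_iff₀ hb] at this
    linarith

lemma eventually_incLaw_twoJumps_le {d : ℕ} {ν : Measure (E d)} [IsProbabilityMeasure ν]
    {α : ℝ} (h : HasRegularTail ν α) (hα : 1 < α) (hν : Integrable (fun x : E d => x) ν)
    {κ t : ℝ} (hκ : 0 < κ) (ht : 0 < t) :
    ∀ᶠ b in atTop, (incLaw ν).real (twoJumps κ b) ≤ t * (b * tail ν b) := by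
  obtain ⟨C, hC, hev⟩ := exists_incLaw_twoJumps_le h hα hν hκ
  filter_upwards [hev, eventually_ge_atTop 0,
    (h.tendsto_mul_tail hν).eventually (gt_mem_nhds (show 0 < t / C by positivity))]
    with b h1 hb h2
  refine h1.trans ?_
  rw [lt_div_iff₀ hC] at h2
  have hR : 0 ≤ b * tail ν b := mul_nonneg hb (h.pos b).le
  nlinarith

/-- Large increments after time `M b` are rare when `M` is large. -/
lemma exists_incLaw_lateJump_le {d : ℕ} {ν : Measure (E d)} [IsProbabilityMeasure ν]
    {α : ℝ} (h : HasRegularTail ν α) (hα : 1 < α) (hν : Integrable (fun x : E d => x) ν)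
    {c₀ t : ℝ} (hc₀ : 0 < c₀) (ht : 0 < t) :
    ∃ M₀ : ℝ, 0 < M₀ ∧ ∀ M, M₀ ≤ M → ∀ᶠ b in atTop,
      (incLaw ν).real (lateJump c₀ M b) ≤ t * (b * tail ν b) := by
  obtain ⟨l₀, hl₀, hl⟩ := h.exists_tailMean_small hα (show 0 < t * c₀ / 2 by positivity)
  refine ⟨l₀ / c₀, by positivity, fun M hM => ?_⟩
  have hM0 : 0 < M := lt_of_lt_of_le (by positivity) hM
  rw [div_le_iff₀ hc₀] at hM
  filter_upwards [hl (c₀ * (1 + M)) (by linarith), eventually_ge_atTop 1] with b h1 hb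
  have hb0 : 0 < b := by linarith
  have hR : 0 ≤ b * tail ν b := mul_nonneg hb0.le (h.pos b).le
  refine ENNReal.toReal_le_of_le_ofReal (by positivity) ?_
  have hsub : lateJump c₀ M b ⊆ ⋃ i : ℕ,
      {x : ℕ → E d | x i ∈ {y : E d | M * b ≤ i ∧ c₀ * (b + i) < ‖y‖}} := by
    rintro x ⟨i, hx⟩
    exact mem_iUnion.2 ⟨i, hx⟩
  refine (measure_mono hsub).trans ((measure_iUnion_le _).trans ?_)
  have hm : ∀ i : ℕ, MeasurableSet {x : E d | M * b ≤ i ∧ c₀ * (b + i) < ‖x‖} := fun i =>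
    (MeasurableSet.const _).inter (measurableSet_jump _)
  simp_rw [fun i => incLaw_eval_preimage ν i (hm i)]
  refine (tsum_measure_jump_le hν hc₀ hb0).trans (ENNReal.ofReal_le_ofReal ?_)
  have h2 : 0 ≤ tailMean ν (c₀ * (1 + M) * b) := integral_nonneg fun x => norm_nonneg x
  have h3 : tail ν (c₀ * (1 + M) * b) ≤ tailMean ν (c₀ * (1 + M) * b) / c₀ := by
    refine (tail_le_tailMean_div hν (by positivity)).trans ?_
    gcongr
    rw [mul_assoc]
    exact le_mul_of_one_le_right hc₀.le (by nlinarith)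
  have h4 : tailMean ν (c₀ * (1 + M) * b) / c₀ ≤ t / 2 * (b * tail ν b) := by
    rw [div_le_iff₀ hc₀]; linarith
  linarith

section Boundary

variable {d : ℕ} {ι : Type} [Finite ι] [Nonempty ι] {v : ι → E d} {c : ι → ℝ} {K κ Λ : ℝ}

/-- The probability that the excess is not very negative is of the order of the tail. -/
lemma HalfSpaceBounds.exists_measure_excess_ge_le (h : HalfSpaceBounds v c K κ Λ)
    {ν : Measure (E d)} [IsProbabilityMeasure ν] {α : ℝ} (hT : HasRegularTail ν α) :
    ∃ C : ℝ, 0 < C ∧ ∀ᶠ b in atTop,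
      ν.real {x | -(κ / 2) * b ≤ excess v c b x} ≤ C * tail ν b := by
  have hK := h.K_pos
  have hκ := h.κ_pos
  have hl : 0 < κ / (4 * K) := by positivity
  refine ⟨(κ / (4 * K)) ^ (-α) + 1, by positivity, ?_⟩
  filter_upwards [hT.eventually_tail_mul_le hl (lt_add_one _), eventually_gt_atTop 0] with b h1 hb
  refine le_trans (measureReal_mono fun x hx => ?_) h1
  have h2 := h.le_norm_of_excess hb.le (t := -(κ / 2) * b) hx
  refine lt_of_lt_of_le ?_ h2
  rw [div_mul_eq_mul_div, div_lt_div_iff₀ (by positivity) hK]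
  have : 0 < κ * b * K := by positivity
  linarith

/-- At time `i` the boundary is at excess `i`, so a given increment is close to it at `O(ω b)` times
only. -/
lemma HalfSpaceBounds.exists_incLaw_nearBoundary_le (h : HalfSpaceBounds v c K κ Λ)
    {ν : Measure (E d)} [IsProbabilityMeasure ν] {α : ℝ} (hT : HasRegularTail ν α) :
    ∃ C : ℝ, 0 < C ∧ ∀ ω, 0 < ω → ω ≤ κ / 2 → ∀ᶠ b in atTop,
      (incLaw ν).real (nearBoundary v c ω b) ≤ C * ω * (b * tail ν b) := by
  obtain ⟨C, hC, hev⟩ := h.exists_measure_excess_ge_le hT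
  refine ⟨3 * C, by positivity, fun ω hω hωκ => ?_⟩
  filter_upwards [hev, eventually_ge_atTop (1 / ω), eventually_gt_atTop 0] with b h1 hb hb0
  have hR : 0 ≤ b * tail ν b := mul_nonneg hb0.le (hT.pos b).le
  refine ENNReal.toReal_le_of_le_ofReal (by positivity) ?_
  have hsub : nearBoundary v c ω b ⊆ ⋃ i : ℕ, {x : ℕ → E d | x i ∈
      {y : E d | excess v c b y - ω * b ≤ i ∧ (i : ℝ) ≤ excess v c b y + ω * b}} := by
    rintro x ⟨i, hx⟩
    exact mem_iUnion.2 ⟨i, hx⟩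
  refine (measure_mono hsub).trans ((measure_iUnion_le _).trans ?_)
  have hm : ∀ i : ℕ, MeasurableSet
      {y : E d | excess v c b y - ω * b ≤ i ∧ (i : ℝ) ≤ excess v c b y + ω * b} := fun i => by
    have h1 : MeasurableSet {y : E d | excess v c b y - ω * b ≤ i} :=
      measurableSet_le (by fun_prop) measurable_const
    have h2 : MeasurableSet {y : E d | (i : ℝ) ≤ excess v c b y + ω * b} :=
      measurableSet_le measurable_const (by fun_prop)
    exact h1.inter h2
  simp_rw [fun i => incLaw_eval_preimage ν i (hm i)]
  refine (tsum_measure_window_le measurable_excess (ω * b) (ω * b)).trans ?_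
  have h2 : ν {x | -(ω * b) ≤ excess v c b x} ≤ ENNReal.ofReal (C * tail ν b) := by
    rw [← ofReal_measureReal]
    refine ENNReal.ofReal_le_ofReal (le_trans (measureReal_mono fun x hx => ?_) h1)
    refine le_trans ?_ (show -(ω * b) ≤ excess v c b x from hx)
    nlinarith
  refine (mul_le_mul_right h2 _).trans ?_
  rw [← ENNReal.ofReal_mul (by positivity)]
  refine ENNReal.ofReal_le_ofReal ?_
  rw [div_le_iff₀ hω] at hb
  have h3 : ω * b + ω * b + 1 ≤ 3 * (ω * b) := by linarith
  calc (ω * b + ω * b + 1) * (C * tail ν b) ≤ 3 * (ω * b) * (C * tail ν b) :=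
        mul_le_mul_of_nonneg_right h3 (mul_nonneg hC.le (hT.pos b).le)
    _ = _ := by ring

end Boundary

/-! ### The single big jump -/

/-- Increments whose walk follows the mean path up to some time `i ≤ M b`, within `ε b`, and then
enters the target with one step. -/
def jumpIn {d : ℕ} {ι : Type} (v : ι → E d) (c : ι → ℝ) (M ε b : ℝ) : Set (ℕ → E d) :=
  {S | ∃ i : ℕ, (i : ℝ) ≤ M * b ∧ (∀ n ≤ i, ‖S n - (n : ℝ) • drift d‖ ≤ ε * b) ∧
    0 < excess v c b (S (i + 1))}

/-- Outside the events `twoJumps` and `deviation`, either the walk stays close to its mean for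
ever, or it does so once its only large increment is removed. -/
lemma exists_single_jump {d : ℕ} {ε κ b : ℝ} {x : ℕ → E d}
    (h2 : x ∉ twoJumps κ b) (hD : x ∉ deviation ε κ b) :
    ((∀ i : ℕ, ‖x i‖ ≤ κ * (b + i)) ∧
      ∀ n : ℕ, ‖walkPath 0 x n - (n : ℝ) • drift d‖ ≤ ε * (b + n)) ∨
    ∃ k : ℕ, (∀ i : ℕ, i ≠ k → ‖x i‖ ≤ κ * (b + i)) ∧
      (∀ n : ℕ, n ≤ k → ‖walkPath 0 x n - (n : ℝ) • drift d‖ ≤ ε * (b + n)) ∧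
      ∀ n : ℕ, k ≤ n → ‖walkPath 0 x (n + 1) - x k - (n : ℝ) • drift d‖ ≤ ε * (b + n + 1) := by
  have hdev : ∀ n : ℕ, (∀ i < n, ‖x i‖ ≤ κ * (b + i)) →
      ‖walkPath 0 x n - (n : ℝ) • drift d‖ ≤ ε * (b + n) := by
    intro n hn
    by_contra hcon
    refine hD ⟨n, n, le_rfl, fun i hi => hn i (Finset.mem_range.1 (Finset.mem_of_mem_erase hi)), ?_⟩
    rw [Finset.erase_eq_of_notMem (by simp), Finset.sum_sub_distrib, Finset.sum_const,
      Finset.card_range, ← Nat.cast_smul_eq_nsmul ℝ]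
    simpa [walkPath] using hcon
  by_cases hbig : ∃ k, κ * (b + k) < ‖x k‖
  · obtain ⟨k, hk⟩ := hbig
    have hne : ∀ i : ℕ, i ≠ k → ‖x i‖ ≤ κ * (b + i) := fun i hi =>
      not_lt.1 fun hlt => h2 ⟨i, k, hi, hlt, hk⟩
    refine Or.inr ⟨k, hne, fun n hn => hdev n fun i hi => hne i (by omega), fun n hn => ?_⟩
    by_contra hcon
    refine hD ⟨n + 1, k, by omega, fun i hi => hne i (Finset.ne_of_mem_erase hi), ?_⟩
    have hmem : k ∈ Finset.range (n + 1) := Finset.mem_range.2 (by omega)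
    rw [Finset.sum_sub_distrib, Finset.sum_const, Finset.card_erase_of_mem hmem, Finset.card_range,
      Nat.add_sub_cancel, ← Nat.cast_smul_eq_nsmul ℝ, Finset.sum_erase_eq_sub hmem]
    push_cast
    have := not_le.1 hcon
    simp only [walkPath, zero_add] at this
    rwa [← add_assoc]
  · push Not at hbig
    exact Or.inl ⟨hbig, fun n => hdev n fun i _ => hbig i⟩

section

variable {d : ℕ} {ι : Type} [Finite ι] [Nonempty ι] {v : ι → E d} {c : ι → ℝ} {K κ Λ : ℝ}

lemma HalfSpaceBounds.excess_walk_le (h : HalfSpaceBounds v c K κ Λ) (b r t : ℝ) (y z : E d)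
    (hz : ‖z - y - t • drift d‖ ≤ r) : excess v c b z ≤ excess v c b y - t + K * r := by
  have h1 := h.excess_add_le b (y + t • drift d) (z - y - t • drift d)
  rw [h.excess_add_smul_drift, show y + t • drift d + (z - y - t • drift d) = z by abel] at h1
  have := mul_le_mul_of_nonneg_left hz h.K_pos.le
  linarith

lemma HalfSpaceBounds.excess_walk_ge (h : HalfSpaceBounds v c K κ Λ) (b r t : ℝ) (y z : E d)
    (hz : ‖z - y - t • drift d‖ ≤ r) : excess v c b y - t - K * r ≤ excess v c b z := by
  have h1 := h.excess_add_ge b (y + t • drift d) (z - y - t • drift d)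
  rw [h.excess_add_smul_drift, show y + t • drift d + (z - y - t • drift d) = z by abel] at h1
  have := mul_le_mul_of_nonneg_left hz h.K_pos.le
  linarith

/-- Near the mean path the excess is negative. -/
lemma HalfSpaceBounds.excess_mean_le (h : HalfSpaceBounds v c K κ Λ) {b : ℝ} (hb : 0 ≤ b)
    {r t : ℝ} {z : E d} (hz : ‖z - t • drift d‖ ≤ r) :
    excess v c b z ≤ -(κ * b) - t + K * r := by
  have h1 := h.excess_walk_le b r t 0 z (by simpa using hz)
  have h2 := h.excess_le_norm hb 0
  simp at h2
  linarith

/-- If the target is hit, then outside of the exceptional events it is entered with a single big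
jump from the neighbourhood of the mean path. -/
lemma HalfSpaceBounds.mem_jumpIn_of_hit (h : HalfSpaceBounds v c K κ Λ) {M ε b ω κ' c₀ : ℝ}
    (hb : 1 ≤ b) (hM : 0 ≤ M) (hε : 0 < ε) (hK1 : 8 * (K * ε) ≤ 1) (hKκ : 8 * (K * ε) ≤ κ)
    (hc₀ : c₀ = min κ 1 / (4 * K)) (hω : ω = 2 * (K * (ε * (1 + M)))) {x : ℕ → E d}
    (h2 : x ∉ twoJumps κ' b) (hD : x ∉ deviation ε κ' b) (hL : x ∉ lateJump c₀ M b)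
    (hB : x ∉ nearBoundary v c ω b) (hhit : ∃ n, 0 < excess v c b (walkPath 0 x n)) :
    walkPath 0 x ∈ jumpIn v c M (ε * (1 + M)) b := by
  have hb0 : 0 < b := by linarith
  have hK := h.K_pos
  have hκ := h.κ_pos
  -- near the mean path the excess is negative
  have hneg : ∀ n : ℕ, ‖walkPath 0 x n - (n : ℝ) • drift d‖ ≤ ε * (b + n) →
      excess v c b (walkPath 0 x n) ≤ 0 := by
    intro n hn
    have h1 := h.excess_mean_le hb0.le hn
    have h3 : 8 * (K * ε) * b ≤ κ * b := mul_le_mul_of_nonneg_right hKκ hb0.le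
    have h4 : 8 * (K * ε) * n ≤ 1 * n := mul_le_mul_of_nonneg_right hK1 (Nat.cast_nonneg n)
    have h5 : 0 ≤ κ * b := by positivity
    have h6 : (0 : ℝ) ≤ n := Nat.cast_nonneg n
    linarith
  obtain ⟨n, hn⟩ := hhit
  rcases exists_single_jump h2 hD with ⟨-, hno⟩ | ⟨k, -, hpre, hpost⟩
  · exact absurd (hneg n (hno n)) (not_le.2 hn)
  have hkn : k < n := by
    by_contra hle
    exact absurd (hneg n (hpre n (not_lt.1 hle))) (not_le.2 hn)
  obtain ⟨l, rfl⟩ : ∃ l, n = l + 1 := ⟨n - 1, by omega⟩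
  have hkl : k ≤ l := by omega
  have hkl' : (k : ℝ) ≤ l := by exact_mod_cast hkl
  have hk0 : (0 : ℝ) ≤ k := Nat.cast_nonneg k
  -- lower bound for the excess of the big jump
  have hlow : (k : ℝ) - 2 * (K * ε) * (b + k) ≤ excess v c b (x k) := by
    have h1 := h.excess_walk_le b (ε * (b + l + 1)) l (x k) (walkPath 0 x (l + 1)) (hpost l hkl)
    have h3 : 0 ≤ (1 - K * ε) * (l - k) := mul_nonneg (by linarith [mul_pos hK hε]) (by linarith)
    have h4 : 0 ≤ K * ε * (b - 1) := mul_nonneg (mul_pos hK hε).le (by linarith)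
    have h5 : 0 ≤ K * ε * k := mul_nonneg (mul_pos hK hε).le hk0
    nlinarith
  have hkM : (k : ℝ) < M * b := by
    by_contra hge
    refine hL ⟨k, not_lt.1 hge, ?_⟩
    have h1 := h.le_norm_of_excess hb0.le hlow
    refine lt_of_lt_of_le ?_ h1
    rw [hc₀, div_mul_eq_mul_div, div_lt_div_iff₀ (by positivity) hK]
    have h3 : min κ 1 * (b + k) ≤ κ * b + k := by
      have h31 : min κ 1 * b ≤ κ * b := mul_le_mul_of_nonneg_right (min_le_left _ _) hb0.le
      have h32 : min κ 1 * k ≤ 1 * k := mul_le_mul_of_nonneg_right (min_le_right _ _) hk0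
      linarith
    have h4 : 8 * (K * ε) * b ≤ κ * b := mul_le_mul_of_nonneg_right hKκ hb0.le
    have h5 : 8 * (K * ε) * k ≤ 1 * k := mul_le_mul_of_nonneg_right hK1 hk0
    have h6 : 0 < κ * b := by positivity
    have h7 : min κ 1 * (b + k) < 4 * (κ * b + (k - 2 * (K * ε) * (b + k))) := by linarith
    calc min κ 1 * (b + k) * K < 4 * (κ * b + (k - 2 * (K * ε) * (b + k))) * K :=
          mul_lt_mul_of_pos_right h7 hK
      _ = _ := by ring
  have hpre' : ∀ n ≤ k, ‖walkPath 0 x n - (n : ℝ) • drift d‖ ≤ ε * (1 + M) * b := by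
    intro n hn
    refine (hpre n hn).trans ?_
    have h1 : (n : ℝ) ≤ k := by exact_mod_cast hn
    rw [mul_assoc]
    exact mul_le_mul_of_nonneg_left (by linarith) hε.le
  refine ⟨k, hkM.le, hpre', ?_⟩
  by_contra hcon
  refine hB ⟨k, ?_, ?_⟩
  · have hstep : walkPath 0 x (k + 1) = walkPath 0 x k + x k := by
      simp [walkPath, Finset.sum_range_succ]
    have h1 := h.excess_walk_ge b (ε * (1 + M) * b) k (x k) (walkPath 0 x (k + 1)) (by
      rw [hstep, add_sub_cancel_right]
      exact hpre' k le_rfl)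
    have h3 : 0 ≤ K * (ε * (1 + M)) * b := by positivity
    rw [hω]
    linarith [not_lt.1 hcon]
  · have h3 : K * ε * k ≤ K * ε * (M * b) :=
      mul_le_mul_of_nonneg_left hkM.le (mul_pos hK hε).le
    rw [hω]
    nlinarith

/-- Conversely, one big jump well inside the target from the mean path hits the target. -/
lemma HalfSpaceBounds.hit_of_jump (h : HalfSpaceBounds v c K κ Λ) {M ε b κ' : ℝ}
    (hb : 0 < b) (hM : 0 ≤ M) (hε : 0 < ε) (hκ' : κ' ≤ min κ 1 / (2 * K)) {x : ℕ → E d}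
    (h2 : x ∉ twoJumps κ' b) (hD : x ∉ deviation ε κ' b) {i : ℕ} (hi : (i : ℝ) ≤ M * b)
    (hx : (i : ℝ) + K * (ε * (1 + M)) * b < excess v c b (x i)) :
    ∃ n, 0 < excess v c b (walkPath 0 x n) := by
  have hK := h.K_pos
  have hκ := h.κ_pos
  have hi0 : (0 : ℝ) ≤ i := Nat.cast_nonneg i
  have hbig : κ' * (b + i) < ‖x i‖ := by
    have h0 : 0 ≤ K * (ε * (1 + M)) * b := by positivity
    refine lt_of_lt_of_le ?_ (h.le_norm_of_excess hb.le (show (i : ℝ) ≤ _ by linarith))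
    refine lt_of_le_of_lt (mul_le_mul_of_nonneg_right hκ' (by linarith)) ?_
    rw [div_mul_eq_mul_div, div_lt_div_iff₀ (by positivity) hK]
    have h31 : min κ 1 * b ≤ κ * b := mul_le_mul_of_nonneg_right (min_le_left _ _) hb.le
    have h32 : min κ 1 * i ≤ 1 * i := mul_le_mul_of_nonneg_right (min_le_right _ _) hi0
    have h6 : 0 < κ * b := by positivity
    calc min κ 1 * (b + i) * K < (2 * (κ * b + i)) * K :=
          mul_lt_mul_of_pos_right (by linarith) hK
      _ = _ := by ring
  rcases exists_single_jump h2 hD with ⟨hno, -⟩ | ⟨k, hk, hpre, -⟩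
  · exact absurd (hno i) (not_le.2 hbig)
  have hik : i = k := by
    by_contra hne
    exact absurd (hk i hne) (not_le.2 hbig)
  refine ⟨i + 1, ?_⟩
  have hstep : walkPath 0 x (i + 1) = walkPath 0 x i + x i := by
    simp [walkPath, Finset.sum_range_succ]
  have h1 := h.excess_walk_ge b (ε * (1 + M) * b) i (x i) (walkPath 0 x (i + 1)) (by
    rw [hstep, add_sub_cancel_right]
    refine (hpre i hik.le).trans ?_
    rw [mul_assoc]
    exact mul_le_mul_of_nonneg_left (by linarith) hε.le)
  linarith

end

/-! ### Asymptotics of the ruin probability -/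

/-- Bonferroni-type bound: if `A i ⊆ B i`, then the events `X i ∈ A i` are disjoint up to the
simultaneous occurrence of two of the events `X i ∈ B i`. -/
lemma sum_measure_le_incLaw_add {d : ℕ} {ν : Measure (E d)} [IsProbabilityMeasure ν]
    {A B : ℕ → Set (E d)} (hA : ∀ i, MeasurableSet (A i)) (hB : ∀ i, MeasurableSet (B i))
    (hAB : ∀ i, A i ⊆ B i) (N : ℕ) :
    ∑ i ∈ Finset.range N, ν (A i) ≤
      incLaw ν {x | ∃ i < N, x i ∈ A i} + (∑' i, ν (B i)) * ∑' i, ν (B i) := by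
  set T : ℕ → Set (ℕ → E d) := fun i => {x | ∃ k, i ≠ k ∧ x k ∈ B k} with hT
  set H : ℕ → Set (ℕ → E d) := fun i => {x | x i ∈ A i} with hH
  have hHm : ∀ i, MeasurableSet (H i) := fun i => measurable_pi_apply i (hA i)
  have hTm : ∀ i, MeasurableSet (T i) := by
    intro i
    have : T i = ⋃ k, ⋃ (_ : i ≠ k), {x | x k ∈ B k} := by
      ext x; simp [hT]
    rw [this]
    exact MeasurableSet.iUnion fun k => MeasurableSet.iUnion fun _ => measurable_pi_apply k (hB k)
  have h1 : ∀ i, ν (A i) ≤ incLaw ν (H i \ T i) + ν (B i) * ∑' k, ν (B k) := by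
    intro i
    rw [← incLaw_eval_preimage ν i (hA i)]
    have h2 : incLaw ν (H i ∩ T i) ≤ ν (B i) * ∑' k, ν (B k) := by
      have hsub : H i ∩ T i ⊆ ⋃ k, {x | i ≠ k ∧ x i ∈ B i ∧ x k ∈ B k} := by
        rintro x ⟨hx, k, hik, hxk⟩
        exact mem_iUnion.2 ⟨k, hik, hAB i hx, hxk⟩
      rw [← ENNReal.tsum_mul_left]
      refine (measure_mono hsub).trans ((measure_iUnion_le _).trans
        (ENNReal.tsum_le_tsum fun k => ?_))
      by_cases hik : i = k
      · simp [hik]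
      · have h3 := ((iIndepFun_eval ν).indepFun hik).measure_inter_preimage_eq_mul _ _ (hB i) (hB k)
        have e1 := incLaw_eval_preimage ν i (hB i)
        have e2 := incLaw_eval_preimage ν k (hB k)
        rw [← e1, ← e2]
        refine le_trans (measure_mono fun x hx => ?_) h3.le
        exact hx.2
    calc incLaw ν (H i) = incLaw ν (H i \ T i) + incLaw ν (H i ∩ T i) :=
          (measure_sdiff_add_inter _ (hTm i)).symm
      _ ≤ _ := by gcongr
  calc ∑ i ∈ Finset.range N, ν (A i)
      ≤ ∑ i ∈ Finset.range N, (incLaw ν (H i \ T i) + ν (B i) * ∑' k, ν (B k)) :=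
        Finset.sum_le_sum fun i _ => h1 i
    _ = incLaw ν (⋃ i ∈ Finset.range N, H i \ T i) +
        (∑ i ∈ Finset.range N, ν (B i)) * ∑' k, ν (B k) := by
        rw [Finset.sum_add_distrib, ← Finset.sum_mul, measure_biUnion_finset]
        · intro i _ k _ hik
          refine disjoint_left.2 fun x hx hx' => ?_
          exact hx'.2 ⟨i, hik.symm, hAB i hx.1⟩
        · exact fun i _ => (hHm i).diff (hTm i)
    _ ≤ _ := by
        gcongr
        · intro x hx
          simp only [mem_iUnion, Finset.mem_range] at hx
          obtain ⟨i, hi, hx⟩ := hx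
          exact ⟨i, hi, hx.1⟩
        · exact ENNReal.sum_le_tsum _

/-- Pointwise comparison of `z⁺` with the number of `i < N` such that `i + w < z`. -/
lemma max_zero_le_sum_indicator {z w L : ℝ} {N : ℕ} (hw : 0 ≤ w) (hL : L ≤ N) :
    max z 0 ≤ ∑ i ∈ Finset.range N, (if (i : ℝ) + w < z then 1 else 0) +
      w * (if 0 < z then 1 else 0) + max (z - L) 0 := by
  have hsum : (0 : ℝ) ≤ ∑ i ∈ Finset.range N, (if (i : ℝ) + w < z then (1 : ℝ) else 0) :=
    Finset.sum_nonneg fun i _ => by split_ifs <;> norm_num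
  rcases le_or_gt z 0 with hz | hz
  · rw [max_eq_right hz, if_neg (not_lt.2 hz)]
    have := le_max_right (z - L) 0
    linarith
  · rw [max_eq_left hz.le, if_pos hz]
    rcases le_or_gt (N : ℝ) (z - w) with hN | hN
    · have h1 : ∑ i ∈ Finset.range N, (if (i : ℝ) + w < z then (1 : ℝ) else 0) = N := by
        rw [Finset.sum_congr rfl fun i hi => if_pos ?_]
        · simp
        · have : (i : ℝ) < N := by exact_mod_cast Finset.mem_range.1 hi
          linarith
      have := le_max_left (z - L) 0
      rw [h1]
      linarith
    · have h1 : (⌈z - w⌉₊ : ℝ) ≤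
          ∑ i ∈ Finset.range N, (if (i : ℝ) + w < z then (1 : ℝ) else 0) := by
        have hsub : Finset.range ⌈z - w⌉₊ ⊆ Finset.range N :=
          Finset.range_mono (Nat.ceil_le.2 hN.le)
        calc (⌈z - w⌉₊ : ℝ) = ∑ i ∈ Finset.range ⌈z - w⌉₊,
              (if (i : ℝ) + w < z then (1 : ℝ) else 0) := by
              rw [Finset.sum_congr rfl fun i hi => if_pos ?_]
              · simp
              · have := Nat.lt_ceil.1 (Finset.mem_range.1 hi)
                linarith
          _ ≤ _ := Finset.sum_le_sum_of_subset_of_nonneg hsub fun i _ _ => by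
              split_ifs <;> norm_num
      have h2 := Nat.le_ceil (z - w)
      have := le_max_right (z - L) 0
      linarith

lemma measurableSet_excess {d : ℕ} {ι : Type} [Finite ι] {v : ι → E d} {c : ι → ℝ}
    (b r : ℝ) : MeasurableSet {x : E d | r < excess v c b x} :=
  measurableSet_lt measurable_const measurable_excess

section

variable {d : ℕ} {ι : Type} [Finite ι] [Nonempty ι] {v : ι → E d} {c : ι → ℝ} {K κ Λ : ℝ}

/-- The mean overshoot is at most the sum of the jump probabilities `P(excess > i + w)`, up to an
error from the shift `w` and one from the truncation at `L`. -/
lemma HalfSpaceBounds.overshoot_le_sum (h : HalfSpaceBounds v c K κ Λ) {ν : Measure (E d)}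
    [IsProbabilityMeasure ν] (hν : Integrable (fun x : E d => x) ν) {b w L : ℝ} {N : ℕ}
    (hb : 0 ≤ b) (hw : 0 ≤ w) (hL : L ≤ N) :
    overshoot ν v c b 0 ≤ ∑ i ∈ Finset.range N, ν.real {x | (i : ℝ) + w < excess v c b x} +
      w * ν.real {x | 0 < excess v c b x} + overshoot ν v c b L := by
  have hind : ∀ r : ℝ, ∫ x, (if r < excess v c b x then (1 : ℝ) else 0) ∂ν =
      ν.real {x | r < excess v c b x} := by
    intro r
    rw [← integral_indicator_one (measurableSet_excess b r)]
    exact integral_congr_ae (ae_of_all _ fun x => by simp [indicator])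
  have hint : ∀ r : ℝ, Integrable (fun x => if r < excess v c b x then (1 : ℝ) else 0) ν := by
    intro r
    refine (integrable_const (1 : ℝ)).mono' (Measurable.ite (measurableSet_excess b r)
      measurable_const measurable_const).aestronglyMeasurable (ae_of_all _ fun x => ?_)
    split_ifs <;> simp
  have i1 : Integrable (fun x => ∑ i ∈ Finset.range N,
      (if (i : ℝ) + w < excess v c b x then (1 : ℝ) else 0)) ν :=
    integrable_finsetSum _ fun i _ => hint _
  have i2 : Integrable (fun x => w * (if 0 < excess v c b x then (1 : ℝ) else 0)) ν :=
    (hint 0).const_mul w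
  have i12 : Integrable (fun x => ∑ i ∈ Finset.range N,
      (if (i : ℝ) + w < excess v c b x then (1 : ℝ) else 0) +
        w * (if 0 < excess v c b x then (1 : ℝ) else 0)) ν := i1.add i2
  have i3 := h.integrable_overshoot hν hb L
  calc overshoot ν v c b 0 ≤ ∫ x, (∑ i ∈ Finset.range N,
      (if (i : ℝ) + w < excess v c b x then (1 : ℝ) else 0) +
      w * (if 0 < excess v c b x then (1 : ℝ) else 0) + max (excess v c b x - L) 0) ∂ν := by
        refine integral_mono (h.integrable_overshoot hν hb 0) (i12.add i3) fun x => ?_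
        have := max_zero_le_sum_indicator (z := excess v c b x) hw hL
        simpa using this
    _ = _ := by
        rw [integral_add i12 i3, integral_add i1 i2, integral_finsetSum _ fun i _ => hint _,
          integral_const_mul, hind]
        simp_rw [hind]
        rfl

/-- The mean overshoot above `M b` is negligible with respect to `b * tail ν b` when `M` is
large. -/
lemma HalfSpaceBounds.exists_overshoot_small (h : HalfSpaceBounds v c K κ Λ)
    {ν : Measure (E d)} [IsProbabilityMeasure ν] {α : ℝ} (hT : HasRegularTail ν α) (hα : 1 < α)
    (hν : Integrable (fun x : E d => x) ν) {t : ℝ} (ht : 0 < t) :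
    ∃ M₀ : ℝ, 0 < M₀ ∧ ∀ M, M₀ ≤ M → ∀ᶠ b in atTop,
      overshoot ν v c b (M * b) ≤ t * (b * tail ν b) := by
  have hK := h.K_pos
  have hκ := h.κ_pos
  obtain ⟨l₀, hl₀, hl⟩ := hT.exists_tailMean_small hα (show 0 < t / K by positivity)
  refine ⟨l₀ * K, by positivity, fun M hM => ?_⟩
  have hM0 : 0 < M := lt_of_lt_of_le (by positivity) hM
  filter_upwards [hl (M / K) ((le_div_iff₀ hK).2 hM), eventually_gt_atTop 0] with b h1 hb
  have hm := measurableSet_jump (d := d) (M / K * b)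
  have h2 : overshoot ν v c b (M * b) ≤ K * tailMean ν (M / K * b) := by
    rw [tailMean, ← integral_const_mul, ← integral_indicator hm]
    refine integral_mono (h.integrable_overshoot hν hb.le _)
      ((integrable_indicator_iff hm).2 (hν.norm.const_mul K).integrableOn) fun x => ?_
    have h3 := h.excess_le_norm hb.le x
    have h4 : 0 < κ * b := by positivity
    have h5 : 0 < M * b := by positivity
    by_cases hx : x ∈ {x : E d | M / K * b < ‖x‖}
    · simp only [indicator_of_mem hx]
      exact max_le (by linarith) (by positivity)
    · simp only [indicator_of_notMem hx]
      refine max_le ?_ le_rfl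
      have h6 : ‖x‖ ≤ M / K * b := not_lt.1 hx
      have h7 : K * ‖x‖ ≤ M * b := by
        calc K * ‖x‖ ≤ K * (M / K * b) := mul_le_mul_of_nonneg_left h6 hK.le
          _ = M * b := by field_simp
      linarith
  calc overshoot ν v c b (M * b) ≤ K * (t / K * (b * tail ν b)) :=
        h2.trans (mul_le_mul_of_nonneg_left h1 hK.le)
    _ = _ := by field_simp

set_option maxHeartbeats 1000000 in
/-- The target is hit essentially only through a single big jump, and the ruin probability is at
least asymptotically the mean overshoot. -/
lemma HalfSpaceBounds.exists_ruin_estimates (h : HalfSpaceBounds v c K κ Λ)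
    {ν : Measure (E d)} [IsProbabilityMeasure ν] {α : ℝ} (hT : HasRegularTail ν α) (hα : 1 < α)
    (hν : Integrable (fun x : E d => x) ν) (hMean : ∫ x, x ∂ν = drift d) {t : ℝ} (ht : 0 < t) :
    ∃ M ε₀ : ℝ, 0 < M ∧ 0 < ε₀ ∧ ∀ ε, 0 < ε → ε ≤ ε₀ → ∀ᶠ b in atTop,
      (incLaw ν).real {x | (∃ n, 0 < excess v c b (walkPath 0 x n)) ∧
        walkPath 0 x ∉ jumpIn v c M ε b} ≤ t * (b * tail ν b) ∧
      overshoot ν v c b 0 - t * (b * tail ν b) ≤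
        (incLaw ν).real {x | ∃ n, 0 < excess v c b (walkPath 0 x n)} := by
  have hK := h.K_pos
  have hκ := h.κ_pos
  set c₀ := min κ 1 / (4 * K) with hc₀
  have hmin : 0 < min κ 1 := lt_min hκ one_pos
  have hc₀0 : 0 < c₀ := by positivity
  have ht5 : 0 < t / 5 := by positivity
  obtain ⟨M₁, hM₁, hL⟩ := exists_incLaw_lateJump_le hT hα hν hc₀0 ht5
  obtain ⟨M₂, hM₂, hO⟩ := h.exists_overshoot_small hT hα hν ht5
  obtain ⟨C₁, hC₁, hnear⟩ := h.exists_incLaw_nearBoundary_le hT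
  obtain ⟨C₂, hC₂, hge⟩ := h.exists_measure_excess_ge_le hT
  set M := max M₁ M₂ with hM
  have hM0 : 0 < M := lt_max_of_lt_left hM₁
  refine ⟨M, min (min 1 κ / (8 * K)) (min (t / (10 * C₁ * K)) (t / (5 * C₂ * K))), hM0,
    by positivity, fun ε₁ hε₁ hle => ?_⟩
  have hle1 : ε₁ * (8 * K) ≤ min 1 κ :=
    (le_div_iff₀ (by positivity)).1 (hle.trans (min_le_left _ _))
  have hle2 : ε₁ * (10 * C₁ * K) ≤ t := (le_div_iff₀ (by positivity)).1
    (hle.trans ((min_le_right _ _).trans (min_le_left _ _)))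
  have hle3 : ε₁ * (5 * C₂ * K) ≤ t := (le_div_iff₀ (by positivity)).1
    (hle.trans ((min_le_right _ _).trans (min_le_right _ _)))
  set ε := ε₁ / (1 + M) with hε
  have hε0 : 0 < ε := by positivity
  have hεε : ε * (1 + M) = ε₁ := by rw [hε]; field_simp
  have hεle : ε ≤ ε₁ := by nlinarith
  set ω := 2 * (K * (ε * (1 + M))) with hω
  have hω0 : 0 < ω := by positivity
  obtain ⟨κ₀, hκ₀, hdev⟩ := exists_incLaw_deviation_le hT hα hν hMean hε0
  set κ' := min κ₀ (min κ 1 / (2 * K)) with hκ'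
  have hκ'0 : 0 < κ' := by positivity
  obtain ⟨C₃, hC₃, htsum⟩ := hT.exists_tsum_jump_le hα hν hκ'0
  have hR0 := (hT.tendsto_mul_tail hν).eventually
    (gt_mem_nhds (show 0 < t / 5 / C₃ ^ 2 by positivity))
  filter_upwards [hL M (le_max_left _ _), hO M (le_max_right _ _),
    hnear ω hω0 (by rw [hω, hεε]; linarith [min_le_right 1 κ]), hge,
    hdev κ' hκ'0 (min_le_left _ _) _ ht5, eventually_incLaw_twoJumps_le hT hα hν hκ'0 ht5,
    htsum, hR0, eventually_ge_atTop 1] with b bL bO bnear bge bdev btwo btsum bR hb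
  have hb0 : 0 < b := by linarith
  set R := b * tail ν b with hR
  have hRpos : 0 < R := mul_pos hb0 (hT.pos b)
  constructor
  · -- `t / 5` is spent on each of four exceptional events
    have hsub : {x | (∃ n, 0 < excess v c b (walkPath 0 x n)) ∧
        walkPath 0 x ∉ jumpIn v c M ε₁ b} ⊆
        twoJumps κ' b ∪ (deviation ε κ' b ∪ (lateJump c₀ M b ∪ nearBoundary v c ω b)) := by
      rintro x ⟨hhit, hnot⟩
      by_contra hcon
      simp only [mem_union, not_or] at hcon
      refine hnot ?_
      have := h.mem_jumpIn_of_hit hb hM0.le hε0 ?_ ?_ hc₀ hω hcon.1 hcon.2.1 hcon.2.2.1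
        hcon.2.2.2 hhit
      · rwa [hεε] at this
      · calc 8 * (K * ε) ≤ 8 * (K * ε₁) := by gcongr
          _ ≤ 1 := by linarith [min_le_left 1 κ]
      · calc 8 * (K * ε) ≤ 8 * (K * ε₁) := by gcongr
          _ ≤ κ := by linarith [min_le_right 1 κ]
    have h1 : C₁ * ω * R ≤ t / 5 * R := by
      refine mul_le_mul_of_nonneg_right ?_ hRpos.le
      rw [hω, hεε]; linarith
    calc _ ≤ (incLaw ν).real (twoJumps κ' b) + ((incLaw ν).real (deviation ε κ' b) +
          ((incLaw ν).real (lateJump c₀ M b) + (incLaw ν).real (nearBoundary v c ω b))) := by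
          refine (measureReal_mono hsub).trans ((measureReal_union_le _ _).trans ?_)
          gcongr
          refine (measureReal_union_le _ _).trans ?_
          gcongr
          exact measureReal_union_le _ _
      _ ≤ t / 5 * R + (t / 5 * R + (t / 5 * R + C₁ * ω * R)) := by gcongr
      _ ≤ t * R := by nlinarith
  · -- a jump at time `i` by more than `i + w` hits the target, and such jumps are nearly disjoint
    set N := ⌊M * b⌋₊ + 1 with hN
    set w := K * (ε * (1 + M)) * b with hw
    have hw0 : 0 ≤ w := by positivity
    have hNM : M * b ≤ N := by
      rw [hN]; push_cast; exact (Nat.lt_floor_add_one _).le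
    have h1 := h.overshoot_le_sum hν hb0.le hw0 hNM
    set A : ℕ → Set (E d) := fun i => {x | (i : ℝ) + w < excess v c b x} with hA
    set B : ℕ → Set (E d) := fun i => {x | κ' * (b + i) < ‖x‖} with hB
    have hAB : ∀ i, A i ⊆ B i := by
      intro i x hx
      have hx' : (i : ℝ) + w < excess v c b x := hx
      have hi0 : (0 : ℝ) ≤ i := Nat.cast_nonneg i
      refine lt_of_lt_of_le ?_ (h.le_norm_of_excess hb0.le (show (i : ℝ) ≤ _ by linarith))
      refine lt_of_le_of_lt (mul_le_mul_of_nonneg_right (min_le_right _ _) (by linarith)) ?_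
      rw [div_mul_eq_mul_div, div_lt_div_iff₀ (by positivity) hK]
      have h31 : min κ 1 * b ≤ κ * b := mul_le_mul_of_nonneg_right (min_le_left _ _) hb0.le
      have h32 : min κ 1 * i ≤ 1 * i := mul_le_mul_of_nonneg_right (min_le_right _ _) hi0
      have h6 : 0 < κ * b := by positivity
      calc min κ 1 * (b + i) * K < (2 * (κ * b + i)) * K :=
            mul_lt_mul_of_pos_right (by linarith) hK
        _ = _ := by ring
    have h2 := sum_measure_le_incLaw_add (ν := ν) (fun i => measurableSet_excess b (i + w))
      (fun i => measurableSet_jump (κ' * (b + i))) hAB N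
    have h3 : ∑ i ∈ Finset.range N, ν.real (A i) ≤
        (incLaw ν).real {x | ∃ i < N, x i ∈ A i} + C₃ ^ 2 * R ^ 2 := by
      have e1 : ∑ i ∈ Finset.range N, ν.real (A i) =
          (∑ i ∈ Finset.range N, ν (A i)).toReal := by
        rw [ENNReal.toReal_sum fun i _ => measure_ne_top _ _]; rfl
      rw [e1]
      have h4 : ∑ i ∈ Finset.range N, ν (A i) ≤ incLaw ν {x | ∃ i < N, x i ∈ A i} +
          ENNReal.ofReal (C₃ ^ 2 * R ^ 2) := by
        refine h2.trans (by
          gcongr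
          refine (mul_le_mul' btsum btsum).trans (le_of_eq ?_)
          rw [← ENNReal.ofReal_mul (by positivity)]
          congr 1; ring)
      refine (ENNReal.toReal_mono (ENNReal.add_ne_top.2 ⟨measure_ne_top _ _,
        ENNReal.ofReal_ne_top⟩) h4).trans (le_of_eq ?_)
      rw [ENNReal.toReal_add (measure_ne_top _ _) ENNReal.ofReal_ne_top,
        ENNReal.toReal_ofReal (by positivity)]
      rfl
    have hsub : {x : ℕ → E d | ∃ i < N, x i ∈ A i} ⊆
        {x | ∃ n, 0 < excess v c b (walkPath 0 x n)} ∪ (twoJumps κ' b ∪ deviation ε κ' b) := by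
      rintro x ⟨i, hiN, hx⟩
      by_contra hcon
      simp only [mem_union, not_or] at hcon
      have hiM : (i : ℝ) ≤ M * b :=
        (Nat.le_floor_iff (by positivity)).1 (Nat.lt_succ_iff.1 hiN)
      exact hcon.1 (h.hit_of_jump hb0 hM0.le hε0 (min_le_right _ _) hcon.2.1 hcon.2.2 hiM hx)
    have h5 : (incLaw ν).real {x | ∃ i < N, x i ∈ A i} ≤
        (incLaw ν).real {x | ∃ n, 0 < excess v c b (walkPath 0 x n)} + (t / 5 * R + t / 5 * R) := by
      refine (measureReal_mono hsub).trans ((measureReal_union_le _ _).trans ?_)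
      gcongr
      refine (measureReal_union_le _ _).trans ?_
      gcongr
    have h6 : C₃ ^ 2 * R ^ 2 ≤ t / 5 * R := by
      have h61 : C₃ ^ 2 * R ≤ t / 5 := by
        rw [lt_div_iff₀ (by positivity)] at bR
        linarith
      nlinarith
    have h7 : w * ν.real {x | 0 < excess v c b x} ≤ t / 5 * R := by
      have h71 : ν.real {x | 0 < excess v c b x} ≤ C₂ * tail ν b := by
        refine le_trans (measureReal_mono fun x (hx : 0 < excess v c b x) => ?_) bge
        have : 0 < κ / 2 * b := by positivity
        show -(κ / 2) * b ≤ excess v c b x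
        linarith
      calc w * ν.real {x | 0 < excess v c b x} ≤ w * (C₂ * tail ν b) := by gcongr
        _ = K * ε₁ * C₂ * R := by rw [hw, hεε, hR]; ring
        _ ≤ t / 5 * R := mul_le_mul_of_nonneg_right (by linarith) hRpos.le
    linarith

end

/-! ### The enlarged target -/

section

variable {d m : ℕ} {vS : Fin m → E d} {aS : Fin m → ℝ} {K κ Λ δ β : ℝ}

lemma exists_halfSpaceBounds [Nonempty (Fin m)] (haS : ∀ j, 0 < aS j)
    (hvS : ∀ j, inner ℝ (drift d) (vS j) = -1) :
    ∃ K κ Λ : ℝ, HalfSpaceBounds vS aS K κ Λ := by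
  obtain ⟨K, hK⟩ := (Set.finite_range fun j => ‖vS j‖).bddAbove
  obtain ⟨Λ, hΛ⟩ := (Set.finite_range aS).bddAbove
  obtain ⟨j₀, hj₀⟩ := Finite.exists_min aS
  exact ⟨max K 1, aS j₀, Λ, lt_max_of_lt_right one_pos, haS j₀,
    fun j => (hK ⟨j, rfl⟩).trans (le_max_left _ _), hj₀, fun j => hΛ ⟨j, rfl⟩, hvS⟩

lemma HalfSpaceBounds.drift_ne_zero [Nonempty (Fin m)] (h : HalfSpaceBounds vS aS K κ Λ) :
    drift d ≠ 0 := by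
  intro h0
  have := h.inner_drift (Classical.arbitrary _)
  simp [h0] at this

lemma norm_smul_drift_div_le (hδ : 0 ≤ δ) :
    ‖(δ / ‖drift d‖ ^ 2) • drift d‖ = δ * ‖drift d‖⁻¹ := by
  rw [norm_smul, Real.norm_of_nonneg (by positivity)]
  rcases eq_or_ne ‖drift d‖ 0 with h | h
  · simp [h]
  · field_simp

lemma HalfSpaceBounds.norm_normal_sub_le (h : HalfSpaceBounds vS aS K κ Λ)
    (hδ : 0 ≤ δ) (hδ2 : δ ≤ 1 / 2) (j : Fin m) :
    ‖normal vS δ (.inr (.inl j)) - vS j‖ ≤ 2 * (K + ‖drift d‖⁻¹) * δ := by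
  have h1 : 0 < 1 - δ := by linarith
  have e : normal vS δ (.inr (.inl j)) - vS j =
      (1 - δ)⁻¹ • (δ • vS j + (δ / ‖drift d‖ ^ 2) • drift d) := by
    have h2 : vS j = (1 - δ)⁻¹ • ((1 - δ) • vS j) := by
      rw [smul_smul, inv_mul_cancel₀ h1.ne', one_smul]
    change (1 - δ)⁻¹ • (vS j + (δ / ‖drift d‖ ^ 2) • drift d) - vS j = _
    nth_rewrite 2 [h2]
    rw [← smul_sub]
    congr 1
    rw [sub_smul, one_smul]
    abel
  have h3 : (1 - δ)⁻¹ ≤ 2 := by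
    rw [inv_le_comm₀ h1 two_pos]; linarith
  have h4 : ‖δ • vS j + (δ / ‖drift d‖ ^ 2) • drift d‖ ≤ δ * K + δ * ‖drift d‖⁻¹ := by
    refine (norm_add_le _ _).trans (add_le_add ?_ (norm_smul_drift_div_le hδ).le)
    rw [norm_smul, Real.norm_of_nonneg hδ]
    exact mul_le_mul_of_nonneg_left (h.norm_le j) hδ
  rw [e, norm_smul, Real.norm_of_nonneg (inv_nonneg.2 h1.le)]
  calc _ ≤ 2 * (δ * K + δ * ‖drift d‖⁻¹) := mul_le_mul h3 h4 (norm_nonneg _) (by norm_num)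
    _ = _ := by ring

lemma HalfSpaceBounds.norm_normal_le (h : HalfSpaceBounds vS aS K κ Λ)
    (hδ : 0 ≤ δ) (hδ2 : δ ≤ 1 / 2) (j : Fin m) :
    ‖normal vS δ (.inr (.inl j))‖ ≤ 2 * (K + ‖drift d‖⁻¹) := by
  have h1 := h.norm_normal_sub_le hδ hδ2 j
  have h2 : ‖normal vS δ (.inr (.inl j))‖ ≤ ‖normal vS δ (.inr (.inl j)) - vS j‖ + ‖vS j‖ := by
    simpa using norm_add_le (normal vS δ (.inr (.inl j)) - vS j) (vS j)
  have h3 := h.norm_le j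
  have h4 : 0 ≤ ‖drift d‖⁻¹ := by positivity
  have h5 : 2 * (K + ‖drift d‖⁻¹) * δ ≤ 2 * (K + ‖drift d‖⁻¹) * (1 / 2) :=
    mul_le_mul_of_nonneg_left hδ2 (by have := h.K_pos; positivity)
  linarith

/-- The half-spaces of the enlarged target satisfy the same kind of bounds; in particular all the
normals have inner product `-1` with the drift. -/
lemma HalfSpaceBounds.enlarge [Nonempty (Fin m)] (h : HalfSpaceBounds vS aS K κ Λ)
    (hδ : 0 ≤ δ) (hδ2 : δ ≤ 1 / 2) (hβ : κ ≤ β) :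
    HalfSpaceBounds (normal vS δ) (level aS β) (2 * (K + ‖drift d‖⁻¹) + 1) κ (max Λ β) := by
  have hK := h.K_pos
  have h0 : 0 ≤ ‖drift d‖⁻¹ := by positivity
  refine ⟨by positivity, h.κ_pos, ?_, ?_, ?_, ?_⟩
  · rintro (j | j | i)
    · have := h.norm_le j
      change ‖vS j‖ ≤ _
      linarith
    · have := h.norm_normal_le hδ hδ2 j
      linarith
    · change ‖EuclideanSpace.single i (1 : ℝ)‖ ≤ _
      rw [PiLp.norm_single, norm_one]
      linarith
  · rintro (j | j | i)
    · exact h.le_level j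
    · exact h.le_level j
    · exact hβ
  · rintro (j | j | i)
    · exact (h.level_le j).trans (le_max_left _ _)
    · exact (h.level_le j).trans (le_max_left _ _)
    · exact le_max_right _ _
  · rintro (j | j | i)
    · exact h.inner_drift j
    · change inner ℝ (drift d) ((1 - δ)⁻¹ • (vS j + (δ / ‖drift d‖ ^ 2) • drift d)) = -1
      have hne : ‖drift d‖ ≠ 0 := norm_ne_zero_iff.2 h.drift_ne_zero
      have h1 : 1 - δ ≠ 0 := by linarith
      rw [inner_smul_right, inner_add_right, inner_smul_right, h.inner_drift,
        real_inner_self_eq_norm_sq, div_mul_cancel₀ _ (pow_ne_zero 2 hne)]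
      field_simp
      ring
    · change inner ℝ (drift d) (EuclideanSpace.single i (1 : ℝ)) = -1
      rw [EuclideanSpace.inner_single_right]
      simp [drift]

lemma excess_le_excess_enlarge [Nonempty (Fin m)] (b : ℝ) (y : E d) :
    excess vS aS b y ≤ excess (normal vS δ) (level aS β) b y :=
  excess_le_iff.2 fun j =>
    (excess_le_iff (v := normal vS δ) (c := level aS β) (b := b) (y := y)).1 le_rfl (.inl j)

/-- The additional half-spaces matter only for a vector that is large: the tilted normals are
within `O(δ)` of the original ones, and the coordinate levels are at height `β b`. -/
lemma HalfSpaceBounds.excess_enlarge_le [Nonempty (Fin m)] (h : HalfSpaceBounds vS aS K κ Λ)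
    (hδ : 0 ≤ δ) (hδ2 : δ ≤ 1 / 2) (hβ : 0 ≤ β) {b : ℝ} (hb : 0 ≤ b) (x : E d) :
    max (excess (normal vS δ) (level aS β) b x) 0 ≤ max (excess vS aS b x) 0 +
      2 * (K + ‖drift d‖⁻¹) * δ *
        {x : E d | κ / (2 * (K + ‖drift d‖⁻¹) + 1) * b < ‖x‖}.indicator (fun x => ‖x‖) x +
      {x : E d | β * b < ‖x‖}.indicator (fun x => ‖x‖) x := by
  have hK := h.K_pos
  have h0 : 0 ≤ ‖drift d‖⁻¹ := by positivity
  set K' := 2 * (K + ‖drift d‖⁻¹) with hK'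
  have hK'0 : 0 < K' := by positivity
  have i1 : 0 ≤ K' * δ *
        {x : E d | κ / (K' + 1) * b < ‖x‖}.indicator (fun x => ‖x‖) x :=
    mul_nonneg (by positivity) (indicator_nonneg (fun _ _ => norm_nonneg _) _)
  have i2 : 0 ≤ {x : E d | β * b < ‖x‖}.indicator (fun x => ‖x‖) x :=
    indicator_nonneg (fun _ _ => norm_nonneg _) _
  have hm := le_max_right (excess vS aS b x) 0
  have hj : ∀ j, inner ℝ x (vS j) - aS j * b ≤ max (excess vS aS b x) 0 := fun j =>
    ((excess_le_iff (v := vS) (c := aS) (b := b) (y := x)).1 le_rfl j).trans (le_max_left _ _)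
  refine max_le (excess_le_iff.2 ?_) (by linarith)
  rintro (j | j | i)
  · have := hj j
    change inner ℝ x (vS j) - aS j * b ≤ _
    linarith
  · change inner ℝ x (normal vS δ (.inr (.inl j))) - aS j * b ≤ _
    by_cases hx : x ∈ {x : E d | κ / (K' + 1) * b < ‖x‖}
    · have h1 : inner ℝ x (normal vS δ (.inr (.inl j)) - vS j) ≤ ‖x‖ * (K' * δ) :=
        (real_inner_le_norm _ _).trans
          (mul_le_mul_of_nonneg_left (h.norm_normal_sub_le hδ hδ2 j) (norm_nonneg _))
      rw [inner_sub_right] at h1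
      have := hj j
      rw [indicator_of_mem hx]
      linarith
    · have h1 : inner ℝ x (normal vS δ (.inr (.inl j))) ≤ ‖x‖ * (K' + 1) :=
        (real_inner_le_norm _ _).trans (mul_le_mul_of_nonneg_left
          ((h.norm_normal_le hδ hδ2 j).trans (by linarith)) (norm_nonneg _))
      have h2 : ‖x‖ ≤ κ / (K' + 1) * b := not_lt.1 hx
      have h3 : ‖x‖ * (K' + 1) ≤ κ * b := by
        calc ‖x‖ * (K' + 1) ≤ κ / (K' + 1) * b * (K' + 1) := by gcongr
          _ = κ * b := by field_simp
      have h4 := mul_le_mul_of_nonneg_right (h.le_level j) hb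
      linarith
  · change inner ℝ x (EuclideanSpace.single i (1 : ℝ)) - β * b ≤ _
    have h1 : inner ℝ x (EuclideanSpace.single i (1 : ℝ)) ≤ ‖x‖ := by
      refine (real_inner_le_norm _ _).trans ?_
      rw [PiLp.norm_single, norm_one, mul_one]
    have h3 := mul_nonneg hβ hb
    by_cases hx : x ∈ {x : E d | β * b < ‖x‖}
    · rw [indicator_of_mem hx]
      linarith
    · have h2 : ‖x‖ ≤ β * b := not_lt.1 hx
      linarith

/-- For `δ` small and `β` large, the enlargement of the target hardly increases the mean
overshoot. -/
lemma HalfSpaceBounds.exists_overshoot_enlarge_le [Nonempty (Fin m)]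
    (h : HalfSpaceBounds vS aS K κ Λ) {ν : Measure (E d)} [IsProbabilityMeasure ν] {α : ℝ}
    (hT : HasRegularTail ν α) (hα : 1 < α) (hν : Integrable (fun x : E d => x) ν) {t : ℝ}
    (ht : 0 < t) :
    ∃ δ₀ β₀ : ℝ, 0 < δ₀ ∧ δ₀ ≤ 1 / 2 ∧ κ ≤ β₀ ∧ ∀ δ, 0 ≤ δ → δ ≤ δ₀ → ∀ β, β₀ ≤ β → ∀ᶠ b in atTop,
      overshoot ν (normal vS δ) (level aS β) b 0 ≤ overshoot ν vS aS b 0 + t * (b * tail ν b) := by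
  have hK := h.K_pos
  have hκ := h.κ_pos
  have h0 : 0 ≤ ‖drift d‖⁻¹ := by positivity
  set K' := 2 * (K + ‖drift d‖⁻¹) with hK'
  have hK'0 : 0 < K' := by positivity
  obtain ⟨C, hC, h1⟩ := hT.exists_tailMean_mul_le hα (show 0 < κ / (K' + 1) by positivity)
  obtain ⟨β₀, hβ₀, h2⟩ := hT.exists_tailMean_small hα (half_pos ht)
  refine ⟨min (1 / 2) (t / (2 * K' * C)), max κ β₀, by positivity, min_le_left _ _, le_max_left _ _,
    fun δ hδ hδ₀ β hβ => ?_⟩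
  have hδ2 : δ ≤ 1 / 2 := hδ₀.trans (min_le_left _ _)
  have hδ3 : δ * (2 * K' * C) ≤ t := (le_div_iff₀ (by positivity)).1 (hδ₀.trans (min_le_right _ _))
  have hκβ : κ ≤ β := (le_max_left _ _).trans hβ
  have he := h.enlarge hδ hδ2 hκβ
  filter_upwards [h1, h2 β ((le_max_right _ _).trans hβ), eventually_gt_atTop 0] with b b1 b2 hb
  have hR : 0 < b * tail ν b := mul_pos hb (hT.pos b)
  have hm := fun r : ℝ => measurableSet_jump (d := d) r
  have hi : ∀ r : ℝ, Integrable (fun x => {x : E d | r < ‖x‖}.indicator (fun x => ‖x‖) x) ν :=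
    fun r => (integrable_indicator_iff (hm r)).2 hν.norm.integrableOn
  have hi0 := h.integrable_overshoot hν hb.le 0
  have hi1 := (hi (κ / (K' + 1) * b)).const_mul (K' * δ)
  have hi01 : Integrable (fun x => max (excess vS aS b x - 0) 0 + K' * δ *
      {x : E d | κ / (K' + 1) * b < ‖x‖}.indicator (fun x => ‖x‖) x) ν := hi0.add hi1
  calc overshoot ν (normal vS δ) (level aS β) b 0
      ≤ ∫ x, (max (excess vS aS b x - 0) 0 + K' * δ *
        {x : E d | κ / (K' + 1) * b < ‖x‖}.indicator (fun x => ‖x‖) x +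
        {x : E d | β * b < ‖x‖}.indicator (fun x => ‖x‖) x) ∂ν := by
        refine integral_mono (he.integrable_overshoot hν hb.le 0) (hi01.add (hi (β * b)))
          fun x => ?_
        simpa using h.excess_enlarge_le hδ hδ2 (hκ.le.trans hκβ) hb.le x
    _ = overshoot ν vS aS b 0 + K' * δ * tailMean ν (κ / (K' + 1) * b) + tailMean ν (β * b) := by
        rw [integral_add hi01 (hi _), integral_add hi0 hi1, integral_const_mul,
          integral_indicator (hm _), integral_indicator (hm _)]
        rfl
    _ ≤ overshoot ν vS aS b 0 + K' * δ * (C * (b * tail ν b)) + t / 2 * (b * tail ν b) := by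
        gcongr
    _ ≤ _ := by
        have := mul_le_mul_of_nonneg_right hδ3 hR.le
        linarith

end

/-! ### The value function of the approximation -/

lemma integral_ite_excess {d : ℕ} {ι : Type} [Finite ι] {v : ι → E d} {c : ι → ℝ}
    {ν : Measure (E d)} {b : ℝ} (t r : ℝ) :
    ∫ x, (if t < excess v c b x then r else 0) ∂ν = r * ν.real {x | t < excess v c b x} := by
  have : (fun x => if t < excess v c b x then r else 0) =
      {x | t < excess v c b x}.indicator fun _ => r := by
    ext x; simp [indicator]
  rw [this, integral_indicator_const _ (measurableSet_excess b t), smul_eq_mul, mul_comm]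

lemma integrable_ite_excess {d : ℕ} {ι : Type} [Finite ι] {v : ι → E d} {c : ι → ℝ}
    {ν : Measure (E d)} [IsProbabilityMeasure ν] {b : ℝ} (t r : ℝ) :
    Integrable (fun x => if t < excess v c b x then r else 0) ν := by
  have : (fun x => if t < excess v c b x then r else 0) =
      {x | t < excess v c b x}.indicator fun _ => r := by
    ext x; simp [indicator]
  rw [this]
  exact (integrable_indicator_iff (measurableSet_excess b t)).2
    (integrableOn_const (measure_ne_top _ _))

section

variable {d : ℕ} {ι : Type} [Finite ι] [Nonempty ι] {v : ι → E d} {c : ι → ℝ} {K κ Λ : ℝ}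
  {ν : Measure (E d)} {b : ℝ}

lemma HalfSpaceBounds.overshoot_anti [IsProbabilityMeasure ν] (h : HalfSpaceBounds v c K κ Λ)
    (hν : Integrable (fun x : E d => x) ν) (hb : 0 ≤ b) : Antitone (overshoot ν v c b) :=
  fun s t hst => integral_mono (h.integrable_overshoot hν hb t) (h.integrable_overshoot hν hb s)
    fun x => max_le_max_right 0 (by linarith)

lemma HalfSpaceBounds.overshoot_sub_le [IsProbabilityMeasure ν] (h : HalfSpaceBounds v c K κ Λ)
    (hν : Integrable (fun x : E d => x) ν) (hb : 0 ≤ b) (t u : ℝ) :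
    overshoot ν v c b t - overshoot ν v c b (t + u) ≤ u * ν.real {x | t < excess v c b x} := by
  rw [← integral_ite_excess, overshoot, overshoot, ← integral_sub
    (h.integrable_overshoot hν hb t) (h.integrable_overshoot hν hb (t + u))]
  refine integral_mono ((h.integrable_overshoot hν hb t).sub
    (h.integrable_overshoot hν hb (t + u))) (integrable_ite_excess t u) fun x => ?_
  have h1 := le_max_left (excess v c b x - (t + u)) 0
  have h2 := le_max_right (excess v c b x - (t + u)) 0
  split_ifs with hx
  · rw [max_eq_left (by linarith : (0 : ℝ) ≤ excess v c b x - t)]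
    linarith
  · rw [max_eq_right (by linarith : excess v c b x - t ≤ 0)]
    linarith

lemma HalfSpaceBounds.le_overshoot_sub [IsProbabilityMeasure ν] (h : HalfSpaceBounds v c K κ Λ)
    (hν : Integrable (fun x : E d => x) ν) (hb : 0 ≤ b) (t : ℝ) :
    ν.real {x | t + 1 < excess v c b x} ≤ overshoot ν v c b t - overshoot ν v c b (t + 1) := by
  rw [← one_mul (ν.real _), ← integral_ite_excess, overshoot, overshoot, ← integral_sub
    (h.integrable_overshoot hν hb t) (h.integrable_overshoot hν hb (t + 1))]
  refine integral_mono (integrable_ite_excess _ _) ((h.integrable_overshoot hν hb t).sub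
    (h.integrable_overshoot hν hb (t + 1))) fun x => ?_
  split_ifs with hx
  · rw [max_eq_left (by linarith : (0 : ℝ) ≤ excess v c b x - t),
      max_eq_left (by linarith : (0 : ℝ) ≤ excess v c b x - (t + 1))]
    linarith
  · have : max (excess v c b x - (t + 1)) 0 ≤ max (excess v c b x - t) 0 :=
      max_le_max_right 0 (by linarith)
    linarith

/-- Layer-cake formula for the expected overshoot of the walk after one step from `s`. -/
lemma HalfSpaceBounds.lintegral_hit_eq (h : HalfSpaceBounds v c K κ Λ) (hb : 0 < b) (s : E d) :
    ∫⁻ t in Ioi (0 : ℝ), ν {x | x + t • drift d + s ∈ b • halfSpaces v c} =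
      ∫⁻ x, ENNReal.ofReal (max (excess v c b (x + s)) 0) ∂ν := by
  rw [lintegral_eq_lintegral_meas_lt (f := fun x => max (excess v c b (x + s)) 0) ν
    (ae_of_all _ fun x => le_max_right _ _) (by fun_prop)]
  refine setLIntegral_congr_fun measurableSet_Ioi fun t (ht : 0 < t) => ?_
  congr 1
  ext x
  simp only [mem_ofPred_eq]
  rw [mem_smul_halfSpaces_iff hb, add_right_comm, h.excess_add_smul_drift, sub_pos, lt_max_iff]
  exact ⟨Or.inl, fun h => h.resolve_right (not_lt.2 ht.le)⟩

/-- The value function near a point of the mean path, in terms of the mean overshoot. -/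
lemma HalfSpaceBounds.lintegral_hit_bounds [IsProbabilityMeasure ν] (h : HalfSpaceBounds v c K κ Λ)
    (hν : Integrable (fun x : E d => x) ν) (hb : 0 < b) {s : E d} {t r : ℝ}
    (hs : ‖s - t • drift d‖ ≤ r) :
    ENNReal.ofReal (overshoot ν v c b (t + K * r)) ≤
      ∫⁻ t in Ioi (0 : ℝ), ν {x | x + t • drift d + s ∈ b • halfSpaces v c} ∧
    ∫⁻ t in Ioi (0 : ℝ), ν {x | x + t • drift d + s ∈ b • halfSpaces v c} ≤
      ENNReal.ofReal (overshoot ν v c b (t - K * r)) := by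
  have hz : ∀ x : E d, ‖x + s - x - t • drift d‖ ≤ r := fun x => by
    rwa [add_sub_cancel_left]
  rw [h.lintegral_hit_eq hb, overshoot, overshoot,
    ofReal_integral_eq_lintegral_ofReal (h.integrable_overshoot hν hb.le _)
      (ae_of_all _ fun x => le_max_right _ _),
    ofReal_integral_eq_lintegral_ofReal (h.integrable_overshoot hν hb.le _)
      (ae_of_all _ fun x => le_max_right _ _)]
  constructor
  · refine lintegral_mono fun x => ENNReal.ofReal_le_ofReal (max_le_max_right 0 ?_)
    have := h.excess_walk_ge b r t x (x + s) (hz x)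
    linarith
  · refine lintegral_mono fun x => ENNReal.ofReal_le_ofReal (max_le_max_right 0 ?_)
    have := h.excess_walk_le b r t x (x + s) (hz x)
    linarith

end

/-! ### The likelihood ratio along a single big jump -/

/-- If `J (n + 1) ≤ J n * f n` up to an error `x n`, then `∏ f n` telescopes to a ratio of values
of `J` up to the sum of the relative errors. -/
lemma div_mul_le_prod {J f x : ℕ → ℝ} {c : ℝ} (hc : 0 < c) {N : ℕ} (hJ : ∀ n ≤ N, c ≤ J n)
    (hf : ∀ n < N, 0 ≤ f n) (hx : ∀ n < N, 0 ≤ x n) (hstep : ∀ n < N, J (n + 1) - x n ≤ J n * f n) :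
    J N / J 0 * (1 - (∑ n ∈ Finset.range N, x n) / c) ≤ ∏ n ∈ Finset.range N, f n := by
  induction N with
  | zero => simp [div_self (hc.trans_le (hJ 0 le_rfl)).ne']
  | succ N ih =>
    have ih' := ih (fun n hn => hJ n (by omega)) (fun n hn => hf n (by omega))
      (fun n hn => hx n (by omega)) fun n hn => hstep n (by omega)
    have h0 : 0 < J 0 := hc.trans_le (hJ 0 (by omega))
    have hN : 0 < J N := hc.trans_le (hJ N (by omega))
    have hN1 : 0 < J (N + 1) := hc.trans_le (hJ (N + 1) le_rfl)
    have hs : 0 ≤ (∑ n ∈ Finset.range N, x n) / c := div_nonneg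
      (Finset.sum_nonneg fun n hn => hx n ((Finset.mem_range.1 hn).trans (by omega))) hc.le
    have hxN : 0 ≤ x N / c := div_nonneg (hx N (by omega)) hc.le
    rw [Finset.sum_range_succ, add_div, Finset.prod_range_succ]
    set s := (∑ n ∈ Finset.range N, x n) / c with hs'
    rcases le_or_gt (1 - s) 0 with h | h
    · refine le_trans (mul_nonpos_of_nonneg_of_nonpos (by positivity) (by linarith)) ?_
      exact mul_nonneg (Finset.prod_nonneg fun n hn =>
        hf n ((Finset.mem_range.1 hn).trans (by omega))) (hf N (by omega))
    · have h1 : J (N + 1) * (1 - x N / c) ≤ J (N + 1) - x N := by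
        have : x N ≤ J (N + 1) * (x N / c) := by
          calc x N = c * (x N / c) := by field_simp
            _ ≤ _ := mul_le_mul_of_nonneg_right (hJ _ le_rfl) hxN
        linarith
      calc J (N + 1) / J 0 * (1 - (s + x N / c))
          ≤ J (N + 1) / J 0 * ((1 - x N / c) * (1 - s)) := by
            refine mul_le_mul_of_nonneg_left ?_ (by positivity)
            have := mul_nonneg hs hxN
            linarith
        _ = J (N + 1) * (1 - x N / c) * ((1 - s) / J 0) := by ring
        _ ≤ J N * f N * ((1 - s) / J 0) :=
            mul_le_mul_of_nonneg_right (h1.trans (hstep N (by omega))) (by positivity)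
        _ = J N / J 0 * (1 - s) * f N := by ring
        _ ≤ _ := mul_le_mul_of_nonneg_right ih' (hf N (by omega))

/-- The sum of the probabilities that the excess lies in `(n - w, n + 1]`, bounded through the
expected number of such `n`. -/
lemma sum_measure_sub_le {d : ℕ} {ι : Type} [Finite ι] {v : ι → E d} {c : ι → ℝ}
    {ν : Measure (E d)} [IsProbabilityMeasure ν] {b w : ℝ} (hw : 0 ≤ w) (N : ℕ) :
    ∑ n ∈ Finset.range N, (ν.real {x | (n : ℝ) - w < excess v c b x} -
      ν.real {x | (n : ℝ) + 1 < excess v c b x}) ≤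
      (w + 2) * ν.real {x | -w ≤ excess v c b x} := by
  have h1 : ∀ n : ℕ, ν.real {x | (n : ℝ) - w < excess v c b x} -
      ν.real {x | (n : ℝ) + 1 < excess v c b x} ≤
      (ν {x | excess v c b x - 1 ≤ n ∧ (n : ℝ) ≤ excess v c b x + w}).toReal := by
    intro n
    rw [sub_le_iff_le_add]
    refine le_trans (measureReal_mono fun x (hx : (n : ℝ) - w < excess v c b x) => ?_)
      (measureReal_union_le _ _)
    rcases lt_or_ge ((n : ℝ) + 1) (excess v c b x) with h | h
    · exact Or.inr h
    · exact Or.inl ⟨by linarith, by linarith⟩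
  refine (Finset.sum_le_sum fun n _ => h1 n).trans ?_
  rw [← ENNReal.toReal_sum fun n _ => measure_ne_top _ _]
  refine ENNReal.toReal_le_of_le_ofReal (mul_nonneg (by linarith) measureReal_nonneg) ?_
  refine (ENNReal.sum_le_tsum _).trans ((tsum_measure_window_le measurable_excess 1 w).trans ?_)
  rw [ENNReal.ofReal_mul (by linarith), ofReal_measureReal, show 1 + w + 1 = w + 2 by ring]

section

variable {d m : ℕ} {vS : Fin m → E d} {aS : Fin m → ℝ} {K κ Λ θ a δ δ₂ β b : ℝ}
  {ν : Measure (E d)} [IsProbabilityMeasure ν]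

/-- Every step from outside into the enlarged target is a jump of the favoured kind, as `a ≤ 1`. -/
lemma mem_jumpSet_of_excess [Nonempty (Fin m)] (ha : a ≤ 1) {s s₁ : E d}
    (hs : excess (normal vS δ) (level aS β) b s ≤ 0)
    (hs₁ : 0 < excess (normal vS δ) (level aS β) b s₁) : s₁ ∈ jumpSet vS aS δ β b a s := by
  obtain ⟨j, hj⟩ := lt_excess_iff.1 hs₁
  have h1 := excess_le_iff.1 hs j
  refine ⟨j, ?_⟩
  have h2 : a * (level aS β j * b - inner ℝ s (normal vS δ j)) ≤
      1 * (level aS β j * b - inner ℝ s (normal vS δ j)) :=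
    mul_le_mul_of_nonneg_right ha (by linarith)
  rw [inner_sub_left]
  linarith

/-- From a state near the mean path at time `n`, a jump of the kind favoured by the approximating
kernel has an excess larger than `n`, up to a small error. -/
lemma nominalKernel_jumpSet_le [Nonempty (Fin m)]
    (h : HalfSpaceBounds (normal vS δ) (level aS β) K κ Λ) (ha0 : 0 ≤ a) (ha : a ≤ 1)
    (hb : 0 ≤ b) {s : E d} {n r w : ℝ} (hs : ‖s - n • drift d‖ ≤ r)
    (hw : (1 - a) * (Λ * b + n) + K * r ≤ w) :
    nominalKernel ν s (jumpSet vS aS δ β b a s) ≤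
      ν {x | n - w < excess (normal vS δ) (level aS β) b x} := by
  have hm : MeasurableSet (jumpSet vS aS δ β b a s) :=
    measurable_prodMk_left (measurableSet_jumpSet vS aS δ β b a)
  change ν.map (fun x => x + s) _ ≤ _
  rw [Measure.map_apply (measurable_add_const s) hm]
  refine measure_mono ?_
  rintro x ⟨j, hj⟩
  rw [add_sub_cancel_right] at hj
  have hr : 0 ≤ K * r := mul_nonneg h.K_pos.le ((norm_nonneg _).trans hs)
  have h1 : inner ℝ s (normal vS δ j) ≤ -n + K * r := by
    have h2 : inner ℝ (s - n • drift d) (normal vS δ j) ≤ K * r :=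
      (real_inner_le_norm _ _).trans ((mul_comm _ _).trans_le
        (mul_le_mul (h.norm_le j) hs (norm_nonneg _) h.K_pos.le))
    rw [inner_sub_left, inner_smul_left, h.inner_drift] at h2
    simp only [conj_trivial] at h2
    linarith
  refine lt_excess_iff.2 ⟨j, ?_⟩
  have h3 : a * (level aS β j * b + n - K * r) ≤
      a * (level aS β j * b - inner ℝ s (normal vS δ j)) :=
    mul_le_mul_of_nonneg_left (by linarith) ha0
  have h4 : (1 - a) * (level aS β j * b) ≤ (1 - a) * (Λ * b) :=
    mul_le_mul_of_nonneg_left (mul_le_mul_of_nonneg_right (h.level_le j) hb) (by linarith)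
  have h5 : a * (K * r) ≤ 1 * (K * r) := mul_le_mul_of_nonneg_right ha hr
  linarith

/-- A state with a positive value can be left towards the target with one jump. -/
lemma nominalKernel_jumpSet_ne_zero [Nonempty (Fin m)]
    (h : HalfSpaceBounds (normal vS δ) (level aS β) K κ Λ) (ha : a ≤ 1) (hb : 0 < b) {s : E d}
    (hs : excess (normal vS δ) (level aS β) b s ≤ 0) (hv : vFun ν vS aS δ β b s ≠ 0) :
    nominalKernel ν s (jumpSet vS aS δ β b a s) ≠ 0 := by
  intro h0
  refine hv ((h.lintegral_hit_eq hb s).trans ?_)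
  have hm : MeasurableSet (jumpSet vS aS δ β b a s) :=
    measurable_prodMk_left (measurableSet_jumpSet vS aS δ β b a)
  change ν.map (fun x => x + s) _ = 0 at h0
  rw [Measure.map_apply (measurable_add_const s) hm] at h0
  rw [lintegral_eq_zero_iff (by fun_prop)]
  filter_upwards [measure_eq_zero_iff_ae_notMem.1 h0] with y hy
  refine ENNReal.ofReal_eq_zero.2 (max_le (not_lt.1 fun hcon => ?_) le_rfl)
  exact hy (show y + s ∈ jumpSet vS aS δ β b a s from mem_jumpSet_of_excess ha hs hcon)

/-- No matter where the next state is, the density is at least the weight `1 - p` of the nominal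
kernel. -/
lemma one_sub_le_hatDensity (s₀ s₁ : E d) :
    1 - ENNReal.ofReal θ * nominalKernel ν s₀ (jumpSet vS aS δ β b a s₀)
      / vFun ν vS aS δ β b s₀ ≤ hatDensity ν vS aS θ a δ δ₂ β b s₀ s₁ := by
  refine le_trans (tsub_le_tsub_left ?_ 1) le_add_self
  unfold mixProb
  exact indicator_apply_le' (fun _ => min_le_left _ _) (fun _ => zero_le)

/-- A jump of the favoured kind has density at least `θ / v`, the probability of such jumps having
cancelled. -/
lemma div_le_hatDensity {s₀ s₁ : E d} (hs₁ : s₁ ∈ jumpSet vS aS δ β b a s₀)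
    (hr : rFun vS aS δ β b s₀ ≤ -δ₂ * b)
    (hP : nominalKernel ν s₀ (jumpSet vS aS δ β b a s₀) ≠ 0)
    (hv : ENNReal.ofReal θ * nominalKernel ν s₀ (jumpSet vS aS δ β b a s₀) ≤
      vFun ν vS aS δ β b s₀) :
    ENNReal.ofReal θ / vFun ν vS aS δ β b s₀ ≤ hatDensity ν vS aS θ a δ δ₂ β b s₀ s₁ := by
  refine le_trans (le_of_eq ?_) le_self_add
  have hmem : s₀ ∈ {s | rFun vS aS δ β b s ≤ -δ₂ * b} := hr
  rw [mixProb, indicator_of_mem hmem, indicator_of_mem hs₁,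
    min_eq_left (ENNReal.div_le_of_le_mul (by rwa [one_mul])), Pi.one_apply, mul_one]
  set p := nominalKernel ν s₀ (jumpSet vS aS δ β b a s₀)
  rw [div_eq_mul_inv, div_eq_mul_inv, div_eq_mul_inv, mul_assoc, mul_assoc, mul_left_comm p,
    ENNReal.mul_inv_cancel hP (measure_ne_top _ _), mul_one]

set_option maxHeartbeats 400000 in
/-- A lower bound for the likelihood ratio along a path that follows the mean path up to time `i`
and then jumps into the enlarged target. Before the jump, the factors `1 - p` telescope, since the
mean overshoot `J` satisfies `J n - J (n + 1) ≈ P(excess > n)`; the jump itself contributes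
`θ / J i`. -/
lemma ofReal_div_overshoot_le_prod [Nonempty (Fin m)]
    (h : HalfSpaceBounds (normal vS δ) (level aS β) K κ Λ)
    (hν : Integrable (fun x : E d => x) ν) {M c p r w σ τ : ℝ} (hb : 0 < b)
    (hθ0 : 0 < θ) (hθ : θ ≤ 1 - σ) (hσ : 0 ≤ σ) (ha0 : 0 ≤ a) (ha : a ≤ 1) (hδ₂ : δ₂ ≤ κ / 2)
    (hr : K * r ≤ κ / 2 * b) (hw : (1 - a) * ((Λ + M) * b) + K * r ≤ w)
    (hw0 : 0 ≤ w) (hwκ : w ≤ κ / 2 * b)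
    (hp : ν.real {x | -(κ / 2) * b ≤ excess (normal vS δ) (level aS β) b x} ≤ p)
    (hc : 0 < c) (hcJ : c ≤ overshoot ν (normal vS δ) (level aS β) b ((M + 1) * b))
    (h1 : K * r * p ≤ σ * c) (h2 : (w + 2) * p ≤ τ * c) (h3 : p ≤ (1 - σ) * c) (hτ : τ ≤ 1)
    {S : ℕ → E d} {i : ℕ} (hi : (i : ℝ) ≤ M * b)
    (hS : ∀ n ≤ i, ‖S n - (n : ℝ) • drift d‖ ≤ r)
    (hjump : 0 < excess (normal vS δ) (level aS β) b (S (i + 1))) :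
    ENNReal.ofReal (θ * (1 - τ) / ((1 + σ) * overshoot ν (normal vS δ) (level aS β) b 0)) ≤
      ∏ n ∈ Finset.range (i + 1), hatDensity ν vS aS θ a δ δ₂ β b (S n) (S (n + 1)) := by
  set Z := excess (normal vS δ) (level aS β) b with hZ
  set J : ℝ → ℝ := overshoot ν (normal vS δ) (level aS β) b with hJ
  have hκ := h.κ_pos
  have hr0 : 0 ≤ K * r := mul_nonneg h.K_pos.le ((norm_nonneg _).trans (hS 0 (Nat.zero_le _)))
  have hp0 : 0 ≤ p := measureReal_nonneg.trans hp
  have hσ1 : 0 < 1 - σ := hθ0.trans_le hθ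
  have hJanti : Antitone J := h.overshoot_anti hν hb.le
  have hnM : ∀ n ≤ i, (n : ℝ) ≤ M * b := fun n hn => le_trans (by exact_mod_cast hn) hi
  have hJc : ∀ n ≤ i, c ≤ J n := fun n hn => hcJ.trans (hJanti (by linarith [hnM n hn]))
  have hmeas : ∀ u : ℝ, -(κ / 2 * b) ≤ u → ν.real {x | u < Z x} ≤ p := fun u hu => by
    refine (measureReal_mono fun x (hx : u < Z x) => ?_).trans hp
    show -(κ / 2) * b ≤ Z x
    linarith
  -- the value function near the mean path
  have hlow : ∀ n ≤ i, ENNReal.ofReal ((1 - σ) * J n) ≤ vFun ν vS aS δ β b (S n) := by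
    intro n hn
    refine le_trans (ENNReal.ofReal_le_ofReal ?_) (h.lintegral_hit_bounds hν hb (hS n hn)).1
    have e1 := h.overshoot_sub_le hν hb.le n (K * r)
    have e2 := mul_le_mul_of_nonneg_left (hmeas n (by
      have : (0 : ℝ) ≤ n := Nat.cast_nonneg n
      have : 0 ≤ κ / 2 * b := by positivity
      linarith)) hr0
    have e3 := mul_le_mul_of_nonneg_left (hJc n hn) hσ
    linarith
  have hup : ∀ n ≤ i, vFun ν vS aS δ β b (S n) ≤ ENNReal.ofReal ((1 + σ) * J n) := by
    intro n hn
    refine (h.lintegral_hit_bounds hν hb (hS n hn)).2.trans (ENNReal.ofReal_le_ofReal ?_)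
    have e1 := h.overshoot_sub_le hν hb.le (n - K * r) (K * r)
    rw [sub_add_cancel] at e1
    have e2 := mul_le_mul_of_nonneg_left (hmeas (n - K * r) (by
      have : (0 : ℝ) ≤ n := Nat.cast_nonneg n
      linarith)) hr0
    have e3 := mul_le_mul_of_nonneg_left (hJc n hn) hσ
    linarith
  set q : ℕ → ℝ := fun n => ν.real {x | (n : ℝ) - w < Z x} with hq
  have hPq : ∀ n ≤ i, nominalKernel ν (S n) (jumpSet vS aS δ β b a (S n)) ≤
      ENNReal.ofReal (q n) := by
    intro n hn
    rw [hq, ofReal_measureReal]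
    refine nominalKernel_jumpSet_le h ha0 ha hb.le (hS n hn) ?_
    have := mul_le_mul_of_nonneg_left (hnM n hn) (sub_nonneg.2 ha)
    linarith
  set x : ℕ → ℝ := fun n => q n - ν.real {x | (n : ℝ) + 1 < Z x} with hx
  set f : ℕ → ℝ := fun n => max (1 - q n / J n) 0 with hf
  have hfac : ∀ n ≤ i, ENNReal.ofReal (f n) ≤
      hatDensity ν vS aS θ a δ δ₂ β b (S n) (S (n + 1)) := by
    intro n hn
    have hJn : 0 < J n := hc.trans_le (hJc n hn)
    have hqn : 0 ≤ q n := measureReal_nonneg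
    refine le_trans ?_ (one_sub_le_hatDensity _ _)
    rw [hf, ENNReal.ofReal_max, ENNReal.ofReal_zero, max_eq_left zero_le,
      ENNReal.ofReal_sub _ (by positivity), ENNReal.ofReal_one]
    refine tsub_le_tsub_left ?_ 1
    refine (ENNReal.div_le_div (mul_le_mul_right (hPq n hn) _) (hlow n hn)).trans ?_
    rw [← ENNReal.ofReal_mul hθ0.le, ← ENNReal.ofReal_div_of_pos (by positivity)]
    refine ENNReal.ofReal_le_ofReal ?_
    rw [mul_div_mul_comm]
    exact mul_le_of_le_one_left (by positivity) ((div_le_one hσ1).2 hθ)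
  have hprod : J i / J 0 * (1 - τ) ≤ ∏ n ∈ Finset.range i, f n := by
    have e1 := div_mul_le_prod (J := fun n : ℕ => J n) (f := f) (x := x) hc hJc
      (fun n _ => le_max_right _ _) (fun n _ => sub_nonneg.2 (measureReal_mono
        fun y (hy : (n : ℝ) + 1 < Z y) => show (n : ℝ) - w < Z y by linarith)) (by
        intro n hn
        have hJn : 0 < J n := hc.trans_le (hJc n hn.le)
        have e2 := h.le_overshoot_sub hν hb.le n
        have e3 : J n * (1 - q n / J n) ≤ J n * f n :=
          mul_le_mul_of_nonneg_left (le_max_left _ _) hJn.le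
        have e4 : J n * (1 - q n / J n) = J n - q n := by field_simp
        push_cast
        simp only [hx]
        linarith)
    simp only [Nat.cast_zero] at e1
    refine le_trans (mul_le_mul_of_nonneg_left ?_ ?_) e1
    · refine sub_le_sub_left ((div_le_iff₀ hc).2 ?_) 1
      refine (sum_measure_sub_le hw0 i).trans (le_trans ?_ h2)
      refine mul_le_mul_of_nonneg_left (le_trans (measureReal_mono fun y hy => ?_) hp)
        (by linarith)
      have hy' : -w ≤ Z y := hy
      show -(κ / 2) * b ≤ Z y
      linarith
    · have := hc.trans_le (hJc i le_rfl)
      have := hc.trans_le (hJc 0 (Nat.zero_le _))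
      simp only [Nat.cast_zero] at this
      positivity
  have hJi : 0 < J i := hc.trans_le (hJc i le_rfl)
  have hJ0 : 0 < J 0 := by simpa using hc.trans_le (hJc 0 (Nat.zero_le _))
  have hSi : Z (S i) ≤ -(κ / 2) * b := by
    have := h.excess_mean_le hb.le (hS i le_rfl)
    have hi0 : (0 : ℝ) ≤ i := Nat.cast_nonneg i
    linarith
  have hSi0 : Z (S i) ≤ 0 := by
    have : 0 ≤ κ / 2 * b := by positivity
    linarith
  have hlast : ENNReal.ofReal (θ / ((1 + σ) * J i)) ≤
      hatDensity ν vS aS θ a δ δ₂ β b (S i) (S (i + 1)) := by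
    refine le_trans ?_ (div_le_hatDensity (mem_jumpSet_of_excess ha hSi0 hjump) ?_ ?_ ?_)
    · rw [ENNReal.ofReal_div_of_pos (by positivity)]
      exact ENNReal.div_le_div_left (hup i le_rfl) _
    · refine hSi.trans ?_
      have := mul_le_mul_of_nonneg_right hδ₂ hb.le
      linarith
    · exact nominalKernel_jumpSet_ne_zero h ha hb hSi0
        ((ENNReal.ofReal_pos.2 (mul_pos hσ1 hJi)).trans_le (hlow i le_rfl)).ne'
    · refine le_trans (mul_le_mul_right (hPq i le_rfl) _) (le_trans ?_ (hlow i le_rfl))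
      rw [← ENNReal.ofReal_mul hθ0.le]
      refine ENNReal.ofReal_le_ofReal ?_
      have e1 : q i ≤ p := hmeas _ (by
        have hi0 : (0 : ℝ) ≤ i := Nat.cast_nonneg i
        linarith)
      have e2 : θ * q i ≤ 1 * p := mul_le_mul (by linarith) e1 measureReal_nonneg (by norm_num)
      have e3 := mul_le_mul_of_nonneg_left (hJc i le_rfl) hσ1.le
      linarith
  rw [Finset.prod_range_succ]
  calc ENNReal.ofReal (θ * (1 - τ) / ((1 + σ) * J 0))
      = ENNReal.ofReal (J i / J 0 * (1 - τ)) * ENNReal.ofReal (θ / ((1 + σ) * J i)) := by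
        rw [← ENNReal.ofReal_mul (mul_nonneg (by positivity) (by linarith))]
        congr 1
        field_simp
    _ ≤ _ := by
        refine mul_le_mul' ?_ hlast
        refine (ENNReal.ofReal_le_ofReal hprod).trans ?_
        rw [ENNReal.ofReal_prod_of_nonneg fun n _ => le_max_right _ _]
        exact Finset.prod_le_prod' fun n hn => hfac n (Finset.mem_range.1 hn).le

/-- The likelihood ratio is at least asymptotically `1 / J 0` along every path that follows the
mean path and then jumps into the enlarged target. -/
lemma HalfSpaceBounds.exists_le_prod_hatDensity [Nonempty (Fin m)]
    (h : HalfSpaceBounds (normal vS δ) (level aS β) K κ Λ)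
    (hν : Integrable (fun x : E d => x) ν) {α : ℝ} (hT : HasRegularTail ν α) {M c t : ℝ}
    (hc : 0 < c) (hM : 0 < M) (hcJ : ∀ᶠ b in atTop,
      c * (b * tail ν b) ≤ overshoot ν (normal vS δ) (level aS β) b ((M + 1) * b))
    (ht : 0 < t) (ht1 : t ≤ 1) (hθ : 1 - t / 2 ≤ θ) (hθ1 : θ < 1) :
    ∃ a₀ ε₀ : ℝ, a₀ < 1 ∧ 0 < ε₀ ∧ ∀ a, a₀ ≤ a → 0 ≤ a → a ≤ 1 → ∀ δ₂, δ₂ ≤ κ / 2 →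
      ∀ ε, 0 < ε → ε ≤ ε₀ → ∀ᶠ b in atTop, ∀ (S : ℕ → E d) (i : ℕ), (i : ℝ) ≤ M * b →
        (∀ n ≤ i, ‖S n - (n : ℝ) • drift d‖ ≤ ε * b) →
        0 < excess (normal vS δ) (level aS β) b (S (i + 1)) →
        ENNReal.ofReal ((1 - t) / overshoot ν (normal vS δ) (level aS β) b 0) ≤
          ∏ n ∈ Finset.range (i + 1), hatDensity ν vS aS θ a δ δ₂ β b (S n) (S (n + 1)) := by
  have hK := h.K_pos
  have hκ := h.κ_pos
  have hΛ : 0 < Λ := hκ.trans_le ((h.le_level (Classical.arbitrary _)).trans (h.level_le _))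
  obtain ⟨C, hC, hCev⟩ := h.exists_measure_excess_ge_le hT
  set σ := min (1 - θ) (t / 8) with hσ
  have hσ0 : 0 < σ := lt_min (by linarith) (by positivity)
  have hσt : σ ≤ t / 8 := min_le_right _ _
  set ω := min (κ / 2) (t / 8 * c / (2 * C)) with hω
  have hω0 : 0 < ω := by positivity
  have hωC : ω * (2 * C) ≤ t / 8 * c := (le_div_iff₀ (by positivity)).1 (min_le_right _ _)
  refine ⟨1 - ω / (2 * (Λ + M)), min (ω / (2 * K)) (σ * c / (K * C)), ?_,
    by positivity, ?_⟩
  · have : 0 < ω / (2 * (Λ + M)) := by positivity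
    linarith
  intro a ha ha0 ha1 δ₂ hδ₂ ε hε hεle
  have hε2 : ε * (2 * K) ≤ ω := (le_div_iff₀ (by positivity)).1
    (hεle.trans (min_le_left _ _))
  have hε3 : ε * (K * C) ≤ σ * c := (le_div_iff₀ (by positivity)).1
    (hεle.trans (min_le_right _ _))
  have ha2 : (1 - a) * (2 * (Λ + M)) ≤ ω :=
    (le_div_iff₀ (by positivity)).1 (by linarith)
  have hωκ : ω ≤ κ / 2 := min_le_left _ _
  have hσ1 : 0 < 1 - σ := by linarith
  filter_upwards [hCev, hcJ, eventually_ge_atTop (2 * (8 * C) / (t * c) * 2),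
    eventually_ge_atTop (C / ((1 - σ) * c)), eventually_gt_atTop 0] with b bC bJ b1 b2 hb S i hi hS
    hj
  have hV := hT.pos b
  have hR : 0 < b * tail ν b := mul_pos hb hV
  have hJ0 : 0 < overshoot ν (normal vS δ) (level aS β) b 0 :=
    (mul_pos hc hR).trans_le (bJ.trans (h.overshoot_anti hν hb.le (by positivity)))
  have b1' : 2 * (8 * C) * 2 ≤ b * (t * c) := by
    rwa [div_mul_eq_mul_div, div_le_iff₀ (by positivity)] at b1
  have b2' : C ≤ b * ((1 - σ) * c) := (div_le_iff₀ (by positivity)).1 b2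
  refine le_trans (ENNReal.ofReal_le_ofReal ?_) (ofReal_div_overshoot_le_prod (M := M)
    (c := c * (b * tail ν b)) (p := C * tail ν b) (r := ε * b) (w := ω * b) (σ := σ) (τ := t / 4)
    h hν hb (by linarith) (by linarith [min_le_left (1 - θ) (t / 8)]) hσ0.le ha0 ha1 hδ₂ ?_ ?_
    (by positivity) (mul_le_mul_of_nonneg_right hωκ hb.le) bC (by positivity) bJ ?_ ?_ ?_
    (by linarith) hi hS hj)
  · rw [div_le_div_iff₀ hJ0 (by positivity)]
    have e1 : (1 - t) * (1 + σ) ≤ θ * (1 - t / 4) := by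
      have e2 : (1 - t) * (1 + σ) ≤ (1 - t) * (1 + t / 8) :=
        mul_le_mul_of_nonneg_left (by linarith) (by linarith)
      have e3 : (1 - t / 2) * (1 - t / 4) ≤ θ * (1 - t / 4) :=
        mul_le_mul_of_nonneg_right hθ (by linarith)
      have e4 : 0 ≤ t * t := mul_nonneg ht.le ht.le
      linarith
    calc _ = (1 - t) * (1 + σ) * overshoot ν (normal vS δ) (level aS β) b 0 := by ring
      _ ≤ _ := mul_le_mul_of_nonneg_right e1 hJ0.le
  · have : K * ε ≤ κ / 2 := by linarith
    calc K * (ε * b) = K * ε * b := by ring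
      _ ≤ _ := mul_le_mul_of_nonneg_right this hb.le
  · calc _ = ((1 - a) * (Λ + M) + K * ε) * b := by ring
      _ ≤ ω * b := mul_le_mul_of_nonneg_right (by linarith) hb.le
  · calc _ = ε * (K * C) * (b * tail ν b) := by ring
      _ ≤ σ * c * (b * tail ν b) := mul_le_mul_of_nonneg_right hε3 hR.le
      _ = _ := by ring
  · calc (ω * b + 2) * (C * tail ν b) = (ω * C * b + 2 * C) * tail ν b := by ring
      _ ≤ (t / 4 * c * b) * tail ν b := by
          refine mul_le_mul_of_nonneg_right ?_ hV.le
          have := mul_le_mul_of_nonneg_right hωC hb.le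
          linarith
      _ = _ := by ring
  · calc C * tail ν b ≤ b * ((1 - σ) * c) * tail ν b := mul_le_mul_of_nonneg_right b2' hV.le
      _ = _ := by ring

end

/-! ### Total variation distance -/

/-- A probability measure `Q` whose density with respect to `P` is at least about `1 / P(H)` on an
event `G` that makes up most of `H` is close to `P` conditioned on `H`. A one-sided bound suffices
since both measures have total mass one. -/
lemma abs_sub_cond_le {Ω : Type*} [MeasurableSpace Ω] {P Q : Measure Ω} [IsProbabilityMeasure P]
    [IsProbabilityMeasure Q] {H G : Set Ω} (hH : MeasurableSet H) {I t : ℝ} (hI : 0 < I)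
    (ht : 0 ≤ t) (ht4 : t ≤ 1 / 4) (hPH : (1 - t) * I ≤ P.real H) (hHG : P.real (H \ G) ≤ t * I)
    (hQ : ∀ B, MeasurableSet B → (1 - t) / I * P.real (B ∩ G) ≤ Q.real B) {B : Set Ω}
    (hB : MeasurableSet B) : |Q.real B - (P[|H]).real B| ≤ 6 * t := by
  have hH0 : 0 < P.real H := (mul_pos (by linarith) hI).trans_le hPH
  have : IsProbabilityMeasure P[|H] := cond_isProbabilityMeasure fun h0 => by
    rw [Measure.real, h0] at hH0
    simp at hH0
  have key : ∀ B, MeasurableSet B → (P[|H]).real B ≤ Q.real B + 6 * t := by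
    intro B hB
    rw [measureReal_def, cond_apply hH, ENNReal.toReal_mul, ENNReal.toReal_inv, ← measureReal_def,
      ← measureReal_def, inv_mul_le_iff₀ hH0]
    have h1 : P.real (H ∩ B) ≤ P.real (B ∩ G) + P.real (H \ G) := by
      refine (measureReal_mono ?_).trans (measureReal_union_le _ _)
      rintro x ⟨hx, hxB⟩
      by_cases hxG : x ∈ G
      · exact Or.inl ⟨hxB, hxG⟩
      · exact Or.inr ⟨hx, hxG⟩
    set q := Q.real B with hq
    have hq0 : 0 ≤ q := measureReal_nonneg
    have hq1 : q ≤ 1 := measureReal_le_one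
    have h2 : P.real (B ∩ G) ≤ q * (1 + 4 / 3 * t) * I := by
      have h3 : (1 - t) * P.real (B ∩ G) ≤ q * I := by
        have := hQ B hB
        rwa [div_mul_eq_mul_div, div_le_iff₀ hI] at this
      have h4 : 1 ≤ (1 + 4 / 3 * t) * (1 - t) := by
        have := mul_nonneg ht (show 0 ≤ 1 / 4 - t by linarith)
        linarith
      calc P.real (B ∩ G) ≤ (1 + 4 / 3 * t) * (1 - t) * P.real (B ∩ G) :=
            le_mul_of_one_le_left measureReal_nonneg h4
        _ = (1 + 4 / 3 * t) * ((1 - t) * P.real (B ∩ G)) := by ring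
        _ ≤ (1 + 4 / 3 * t) * (q * I) := mul_le_mul_of_nonneg_left h3 (by linarith)
        _ = _ := by ring
    have h5 : q * (1 + 4 / 3 * t) + t ≤ (q + 6 * t) * (1 - t) := by
      have e1 := mul_nonneg ht (show 0 ≤ 1 / 4 - t by linarith)
      have e2 := mul_nonneg ht (show 0 ≤ 1 - q by linarith)
      linarith
    calc P.real (H ∩ B) ≤ (q * (1 + 4 / 3 * t) + t) * I := by linarith
      _ ≤ (q + 6 * t) * (1 - t) * I := mul_le_mul_of_nonneg_right h5 hI.le
      _ = (q + 6 * t) * ((1 - t) * I) := by ring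
      _ ≤ (q + 6 * t) * P.real H := mul_le_mul_of_nonneg_left hPH (by linarith)
      _ = _ := mul_comm _ _
  have h1 := key B hB
  have h2 := key Bᶜ hB.compl
  rw [probReal_compl_eq_one_sub hB, probReal_compl_eq_one_sub hB] at h2
  exact abs_le.2 ⟨by linarith, by linarith⟩

section

variable {d m : ℕ} {vS : Fin m → E d} {aS : Fin m → ℝ} {K κ Λ θ a δ δ₂ β γ b M ε : ℝ}
  {ν : Measure (E d)} [IsProbabilityMeasure ν]

lemma measurableSet_setOf_exists_excess {ι : Type} [Finite ι] [Nonempty ι] {v : ι → E d}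
    {c : ι → ℝ} : MeasurableSet {S : ℕ → E d | ∃ n, 0 < excess v c b (S n)} := by
  have : {S : ℕ → E d | ∃ n, 0 < excess v c b (S n)} =
      ⋃ n, {S | 0 < excess v c b (S n)} := by ext; simp
  rw [this]
  exact MeasurableSet.iUnion fun n => measurableSet_lt measurable_const (by fun_prop)

lemma measurableSet_jumpIn {ι : Type} [Finite ι] [Nonempty ι] {v : ι → E d} {c : ι → ℝ} :
    MeasurableSet (jumpIn v c M ε b) := by
  have : jumpIn v c M ε b = ⋃ i : ℕ, ⋃ _ : (i : ℝ) ≤ M * b,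
      (⋂ n : ℕ, ⋂ _ : n ≤ i, {S : ℕ → E d | ‖S n - (n : ℝ) • drift d‖ ≤ ε * b}) ∩
        {S | 0 < excess v c b (S (i + 1))} := by
    ext S
    simp only [jumpIn, mem_iUnion, mem_inter_iff, mem_iInter, exists_prop]
    rfl
  rw [this]
  refine MeasurableSet.iUnion fun i => MeasurableSet.iUnion fun _ => MeasurableSet.inter
    (MeasurableSet.iInter fun n => MeasurableSet.iInter fun _ => ?_) ?_
  · exact measurableSet_le (by fun_prop) measurable_const
  · exact measurableSet_lt measurable_const (by fun_prop)

/-- The lower bounds for the likelihood ratio on the disjoint events that the target is entered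
with one jump at time `i + 1` add up. -/
lemma HalfSpaceBounds.mul_walkLaw_jumpIn_le [Nonempty (Fin m)]
    (h : HalfSpaceBounds vS aS K κ Λ)
    (he : HalfSpaceBounds (normal vS δ) (level aS β) K κ Λ) (hb : 0 < b) (hM : 0 ≤ M)
    (hε : K * ε ≤ κ / 2) (hγ : M * ‖drift d‖ ^ 2 + ε * ‖drift d‖ < γ) {c : ℝ≥0∞}
    (hc : ∀ (S : ℕ → E d) (i : ℕ), (i : ℝ) ≤ M * b →
        (∀ n ≤ i, ‖S n - (n : ℝ) • drift d‖ ≤ ε * b) →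
        0 < excess (normal vS δ) (level aS β) b (S (i + 1)) →
        c ≤ ∏ n ∈ Finset.range (i + 1), hatDensity ν vS aS θ a δ δ₂ β b (S n) (S (n + 1)))
    {B : Set (ℕ → E d)} (hB : MeasurableSet B) :
    c * walkLaw ν 0 (B ∩ jumpIn vS aS M ε b) ≤ hatLaw ν vS aS θ a δ δ₂ β γ b 0 B := by
  have hκ := h.κ_pos
  set G : (i : ℕ) → Set ((k : Finset.Iic (i + 1)) → (fun _ : ℕ => E d) k) := fun i =>
    (⋂ k : Finset.Iic (i + 1), {S | (k : ℕ) ≤ i → ‖S k - ((k : ℕ) : ℝ) • drift d‖ ≤ ε * b}) ∩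
      {S | 0 < excess vS aS b (S ⟨i + 1, Finset.mem_Iic.2 le_rfl⟩)} with hG
  have hGm : ∀ i, MeasurableSet (G i) := by
    intro i
    refine MeasurableSet.inter (MeasurableSet.iInter fun k => ?_) ?_
    · by_cases hk : (k : ℕ) ≤ i
      · simp only [hk, true_imp_iff]
        exact measurableSet_le (((measurable_pi_apply
          (X := fun _ : Finset.Iic (i + 1) => E d) k).sub_const _).norm) measurable_const
      · simp [hk]
    · exact measurableSet_lt measurable_const (measurable_excess.comp
        (measurable_pi_apply (X := fun _ : Finset.Iic (i + 1) => E d) _))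
  set J : ℕ → Set (ℕ → E d) := fun i =>
    frestrictLe (π := fun _ : ℕ => E d) (i + 1) ⁻¹' G i with hJ
  have hJm : ∀ i, MeasurableSet (J i) := fun i => measurable_frestrictLe (i + 1) (hGm i)
  have hmem : ∀ i S, S ∈ J i ↔ (∀ n ≤ i, ‖S n - (n : ℝ) • drift d‖ ≤ ε * b) ∧
      0 < excess vS aS b (S (i + 1)) := by
    intro i S
    simp only [hJ, hG, mem_preimage, mem_inter_iff, mem_iInter]
    exact ⟨fun hS => ⟨fun n hn => hS.1 ⟨n, Finset.mem_Iic.2 (hn.trans (Nat.le_succ i))⟩ hn, hS.2⟩,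
      fun hS => ⟨fun k hk => hS.1 k hk, hS.2⟩⟩
  have hunion : jumpIn vS aS M ε b = ⋃ i ∈ Finset.range (⌊M * b⌋₊ + 1), J i := by
    ext S
    simp only [mem_iUnion, hmem, Finset.mem_range, Nat.lt_succ_iff, exists_prop,
      Nat.le_floor_iff (mul_nonneg hM hb.le)]
    rfl
  -- while the walk follows the mean path it stays outside of both targets
  have hneg : ∀ (S : ℕ → E d) (n : ℕ), ‖S n - (n : ℝ) • drift d‖ ≤ ε * b →
      excess (normal vS δ) (level aS β) b (S n) ≤ 0 := by
    intro S n hn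
    have h1 := he.excess_mean_le hb.le hn
    have h2 : K * ε * b ≤ κ / 2 * b := mul_le_mul_of_nonneg_right hε hb.le
    have h3 : 0 ≤ κ * b := by positivity
    have h4 : (0 : ℝ) ≤ n := Nat.cast_nonneg n
    linarith
  have hdisj : Pairwise (Function.onFun Disjoint J) := by
    have hlt : ∀ i k, i < k → Disjoint (J i) (J k) := fun i k hik =>
      disjoint_left.2 fun S hS hS' => by
        have h1 := ((hmem i S).1 hS).2
        have h2 := hneg S (i + 1) (((hmem k S).1 hS').1 (i + 1) hik)
        exact absurd (h1.trans_le (excess_le_excess_enlarge b _)) (not_lt.2 h2)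
    intro i k hik
    rcases lt_or_gt_of_ne hik with h' | h'
    · exact hlt i k h'
    · exact (hlt k i h').symm
  have hfar : ∀ (S : ℕ → E d) (n : ℕ), (n : ℝ) ≤ M * b → ‖S n - (n : ℝ) • drift d‖ ≤ ε * b →
      S n ∉ b • farSet d γ := by
    intro S n hnM hn hmem
    rw [mem_smul_set_iff_inv_smul_mem₀ hb.ne'] at hmem
    have h1 : γ ≤ inner ℝ (b⁻¹ • S n) (drift d) := hmem
    rw [inner_smul_left] at h1
    simp only [map_inv₀, conj_trivial] at h1
    rw [le_inv_mul_iff₀ hb] at h1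
    have h2 : inner ℝ (S n - (n : ℝ) • drift d) (drift d) ≤ ε * b * ‖drift d‖ :=
      (real_inner_le_norm _ _).trans (mul_le_mul_of_nonneg_right hn (norm_nonneg _))
    rw [inner_sub_left, inner_smul_left, real_inner_self_eq_norm_sq] at h2
    simp only [conj_trivial] at h2
    have h3 : (n : ℝ) * ‖drift d‖ ^ 2 ≤ M * b * ‖drift d‖ ^ 2 :=
      mul_le_mul_of_nonneg_right hnM (by positivity)
    have h4 := mul_lt_mul_of_pos_left hγ hb
    linarith
  have hle : ∀ i ∈ Finset.range (⌊M * b⌋₊ + 1), c * walkLaw ν 0 (B ∩ J i) ≤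
      hatLaw ν vS aS θ a δ δ₂ β γ b 0 (B ∩ J i) := by
    intro i hi
    have hiM : (i : ℝ) ≤ M * b :=
      (Nat.le_floor_iff (mul_nonneg hM hb.le)).1 (Nat.lt_succ_iff.1 (Finset.mem_range.1 hi))
    have hpos : ∀ S ∈ J i, 0 < excess (normal vS δ) (level aS β) b (S (i + 1)) := fun S hS =>
      ((hmem i S).1 hS).2.trans_le (excess_le_excess_enlarge b _)
    refine mul_walkLaw_le_hatLaw ν vS aS θ a δ δ₂ β γ b 0 (hGm i) (fun S hS n hn => ?_)
      (fun S hS => (mem_smul_halfSpaces_iff hb).2 (hpos S hS))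
      (fun S hS => hc S i hiM ((hmem i S).1 hS).1 (hpos S hS)) hB
    have hn' := ((hmem i S).1 hS).1 n hn
    rintro (h1 | h1)
    · exact absurd ((mem_smul_halfSpaces_iff hb).1 h1) (not_lt.2 (hneg S n hn'))
    · exact hfar S n (le_trans (by exact_mod_cast hn) hiM) hn' h1
  rw [hunion, inter_iUnion₂]
  calc c * walkLaw ν 0 (⋃ i ∈ Finset.range (⌊M * b⌋₊ + 1), B ∩ J i)
      ≤ c * ∑ i ∈ Finset.range (⌊M * b⌋₊ + 1), walkLaw ν 0 (B ∩ J i) := by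
        gcongr
        exact measure_biUnion_finset_le _ _
    _ = ∑ i ∈ Finset.range (⌊M * b⌋₊ + 1), c * walkLaw ν 0 (B ∩ J i) := Finset.mul_sum _ _ _
    _ ≤ ∑ i ∈ Finset.range (⌊M * b⌋₊ + 1), hatLaw ν vS aS θ a δ δ₂ β γ b 0 (B ∩ J i) :=
        Finset.sum_le_sum hle
    _ = hatLaw ν vS aS θ a δ δ₂ β γ b 0 (⋃ i ∈ Finset.range (⌊M * b⌋₊ + 1), B ∩ J i) := by
        rw [measure_biUnion_finset]
        · exact fun i _ k _ hik => (hdisj hik).mono inter_subset_right inter_subset_right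
        · exact fun i _ => hB.inter (hJm i)
    _ ≤ _ := measure_mono (iUnion₂_subset fun i _ => inter_subset_left)

end

end RuinWalk

/-- Total variation approximation of the random walk conditioned on ruin. The real `ρ` makes
precise that `θ, a` may be taken as close to `1`, `δ, δ₂` as close to `0`, and `β, γ` as large as
desired. -/
theorem theorem1 {d m : ℕ} (ν : Measure (E d)) [IsProbabilityMeasure ν]
    (hcont : ∀ x, ν {x} = 0) (α : ℝ) (hα : 1 < α) (μ : Measure (E d)) (hRV : IsRegularlyVarying ν α μ)
    (hInt : Integrable (fun x : E d => x) ν) (hMean : ∫ x, x ∂ν = drift d)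
    (vS : Fin m → E d) (aS : Fin m → ℝ) (haS : ∀ j, 0 < aS j)
    (hvS : ∀ j, inner ℝ (drift d) (vS j) = -1) (hμ : 0 < μ (halfSpaces vS aS)) :
    ∀ ε : ℝ, 0 < ε → ∀ ρ : ℝ, 0 < ρ →
      ∃ θ a δ δ₂ β γ b₀ : ℝ,
        θ ∈ Ioo (0 : ℝ) 1 ∧ a ∈ Ioo (0 : ℝ) 1 ∧ δ ∈ Ioo (0 : ℝ) 1 ∧ δ₂ ∈ Ioo (0 : ℝ) 1 ∧
        0 < β ∧ 0 < γ ∧ 0 < b₀ ∧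
        1 - ρ < θ ∧ 1 - ρ < a ∧ δ < ρ ∧ δ₂ < ρ ∧ 1 / ρ < β ∧ 1 / ρ < γ ∧
        ∀ b : ℝ, b₀ ≤ b → ∀ B : Set (ℕ → E d), MeasurableSet B →
          |(hatLaw ν vS aS θ a δ δ₂ β γ b 0).real B - (conditionedLaw ν vS aS b 0).real B| ≤ ε := by
  intro ε hε ρ hρ
  have hne : Nonempty (Fin m) := by
    by_contra hemp
    rw [not_nonempty_iff] at hemp
    have : halfSpaces vS aS = ∅ := by ext y; simp [halfSpaces]
    simp [this] at hμ
  obtain ⟨K₀, κ, Λ₀, h₀⟩ := exists_halfSpaceBounds haS hvS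
  have hκ := h₀.κ_pos
  have hT := hRV.hasRegularTail
  -- `t` is the relative accuracy of every estimate; the constants are chosen in the order
  -- `M`, then `δ, β`, then `θ`, `a`, `δ₂`, then the width `ε₂` of the tube, `γ`, and finally `b`
  set t := min (1 / 4) (ε / 6) with ht
  have ht0 : 0 < t := by positivity
  have ht4 : t ≤ 1 / 4 := min_le_left _ _
  have htε : 6 * t ≤ ε := by linarith [min_le_right (1 / 4) (ε / 6)]
  obtain ⟨c, hc, hlow⟩ := hRV.exists_le_overshoot hInt h₀ hμ le_rfl
  have ht' : 0 < t * c / 2 := by positivity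
  obtain ⟨M, ε₀, hM, hε₀, hruin⟩ := h₀.exists_ruin_estimates hT hα hInt hMean ht'
  obtain ⟨δ₀, β₀, hδ₀, hδ₀2, hκβ₀, henl⟩ := h₀.exists_overshoot_enlarge_le hT hα hInt ht'
  set δ := min δ₀ (ρ / 2) with hδ
  have hδ0 : 0 < δ := by positivity
  have hδ2 : δ ≤ 1 / 2 := (min_le_left _ _).trans hδ₀2
  set β := max β₀ (1 / ρ + 1) with hβ
  have hκβ : κ ≤ β := hκβ₀.trans (le_max_left _ _)
  have he := h₀.enlarge hδ0.le hδ2 hκβ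
  set K := 2 * (K₀ + ‖drift d‖⁻¹) + 1 with hK
  set Λ := max Λ₀ β with hΛ
  have hKpos := he.K_pos
  -- the bounds for the enlarged family also hold for the original one
  have h : HalfSpaceBounds vS aS K κ Λ :=
    ⟨he.K_pos, hκ, fun j => he.norm_le (.inl j), fun j => he.le_level (.inl j),
      fun j => he.level_le (.inl j), hvS⟩
  obtain ⟨c₁, hc₁, hlow₁⟩ := hRV.exists_le_overshoot hInt h hμ (show 0 ≤ M + 1 by linarith)
  have hmono : ∀ b, 0 ≤ b → ∀ r, overshoot ν vS aS b r ≤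
      overshoot ν (normal vS δ) (level aS β) b r := fun b hb r =>
    integral_mono (h.integrable_overshoot hInt hb r) (he.integrable_overshoot hInt hb r)
      fun x => max_le_max_right 0 (sub_le_sub_right (excess_le_excess_enlarge b x) r)
  set θ := max (1 - t / 2) (1 - ρ / 2) with hθ
  have hθ1 : θ < 1 := max_lt (by linarith) (by linarith)
  obtain ⟨a₀, ε₁, ha₀, hε₁, hdens⟩ := he.exists_le_prod_hatDensity (θ := θ) hInt hT hc₁ hM (by
    filter_upwards [hlow₁, eventually_ge_atTop 0] with b hb hb0
    exact hb.trans (hmono b hb0 _)) ht0 (by linarith) (le_max_left _ _) hθ1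
  set a := max a₀ (max (1 - ρ / 2) (1 / 2)) with ha
  have ha1 : a < 1 := max_lt ha₀ (max_lt (by linarith) (by norm_num))
  have ha2 : 1 / 2 ≤ a := (le_max_right _ _).trans (le_max_right _ _)
  have haρ : 1 - ρ / 2 ≤ a := (le_max_left _ _).trans (le_max_right _ _)
  set δ₂ := min (κ / 2) (min (ρ / 2) (1 / 2)) with hδ₂
  have hδ₂ρ : δ₂ ≤ ρ / 2 := (min_le_right _ _).trans (min_le_left _ _)
  have hδ₂2 : δ₂ ≤ 1 / 2 := (min_le_right _ _).trans (min_le_right _ _)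
  set ε₂ := min ε₀ (min ε₁ (κ / (2 * K))) with hε₂
  have hε₂0 : 0 < ε₂ := by positivity
  have hKε : K * ε₂ ≤ κ / 2 := by
    have h1 : ε₂ ≤ κ / (2 * K) := (min_le_right _ _).trans (min_le_right _ _)
    have h2 := (le_div_iff₀ (by positivity)).1 h1
    linarith
  -- up to time `M b` the tube around the mean path does not meet `b • farSet d γ`
  set γ := M * ‖drift d‖ ^ 2 + ε₂ * ‖drift d‖ + 1 + 1 / ρ with hγ
  have hρ1 : 0 < 1 / ρ := by positivity
  have hγ0 : 0 ≤ M * ‖drift d‖ ^ 2 + ε₂ * ‖drift d‖ := by positivity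
  have hev : ∀ᶠ b in atTop, 0 < b ∧ ∀ B : Set (ℕ → E d), MeasurableSet B →
      |(hatLaw ν vS aS θ a δ δ₂ β γ b 0).real B - (conditionedLaw ν vS aS b 0).real B| ≤ ε := by
    filter_upwards [hlow, hruin ε₂ hε₂0 (min_le_left _ _),
      henl δ hδ0.le (min_le_left _ _) β (le_max_left _ _),
      hdens a (le_max_left _ _) (by linarith) ha1.le δ₂ (min_le_left _ _) ε₂ hε₂0
        ((min_le_right _ _).trans (min_le_left _ _)), eventually_gt_atTop 0]
      with b b1 b2 b3 b4 hb
    refine ⟨hb, fun B hB => ?_⟩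
    rw [zero_mul] at b1
    set I := overshoot ν (normal vS δ) (level aS β) b 0 with hI
    have hR : 0 < b * tail ν b := mul_pos hb (hT.pos b)
    have hcI : c * (b * tail ν b) ≤ I := b1.trans (hmono b hb.le 0)
    have hI0 : 0 < I := (mul_pos hc hR).trans_le hcI
    have htI : t * (c * (b * tail ν b)) ≤ t * I := mul_le_mul_of_nonneg_left hcI ht0.le
    set H : Set (ℕ → E d) := {S | ∃ n, 0 < excess vS aS b (S n)} with hH
    have hhits : hits (b • halfSpaces vS aS) = H := by
      ext S
      exact exists_congr fun n => mem_smul_halfSpaces_iff hb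
    have hHm : MeasurableSet H := measurableSet_setOf_exists_excess
    have hPreal : ∀ T : Set (ℕ → E d), MeasurableSet T →
        (walkLaw ν 0).real T = (incLaw ν).real (walkPath 0 ⁻¹' T) := fun T hT => by
      rw [walkLaw_eq_map]
      exact map_measureReal_apply (measurable_walkPath 0) hT
    rw [conditionedLaw, hhits]
    refine (abs_sub_cond_le hHm hI0 ht0.le ht4 (G := jumpIn vS aS M ε₂ b) ?_ ?_ ?_ hB).trans htε
    · rw [hPreal H hHm]
      refine le_trans ?_ b2.2
      linarith
    · rw [hPreal _ (hHm.diff measurableSet_jumpIn)]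
      refine b2.1.trans ?_
      have := mul_pos hc hR
      have := mul_pos ht0 this
      linarith
    · intro B hB
      have h1 := h.mul_walkLaw_jumpIn_le (γ := γ) he hb hM.le hKε (by linarith) b4 hB
      have h2 := ENNReal.toReal_mono (measure_ne_top _ _) h1
      rwa [ENNReal.toReal_mul, ENNReal.toReal_ofReal
        (div_nonneg (by linarith) hI0.le)] at h2
  obtain ⟨b₀, hb₀⟩ := eventually_atTop.1 hev
  refine ⟨θ, a, δ, δ₂, β, γ, b₀, ⟨?_, hθ1⟩, ⟨by linarith, ha1⟩, ⟨hδ0, by linarith⟩,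
    ⟨by positivity, by linarith⟩, hκ.trans_le hκβ, by linarith, (hb₀ b₀ le_rfl).1, ?_,
    by linarith, ?_, by linarith, ?_, by linarith, fun b hb => (hb₀ b hb).2⟩
  · linarith [le_max_left (1 - t / 2) (1 - ρ / 2)]
  · linarith [le_max_right (1 - t / 2) (1 - ρ / 2)]
  · linarith [min_le_right δ₀ (ρ / 2)]
  · linarith [le_max_right β₀ (1 / ρ + 1)]
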